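/- Let $d\in\{2,3\}$, let $\Omega_1,\Omega_2\subset\mathbb R^d$ be bounded connected open sets with $C^3$ boundary and $\overline{\Omega_1}\subset\Omega_2$, and suppose that $\Omega=\Omega_2\setminus\overline{\Omega_1}$ is connected. Put $\Gamma=\partial\Omega_1$, $\Gamma_0=\partial\Omega_2$ and $H^1_\diamond(\Omega)=\{u\in H^1(\Omega): u|_{\Gamma_0}=0\}$. Let $\beta\in C^3(\mathbb R)$ be non-decreasing with $\beta(0)=0$ and $\beta',\beta'',\beta'''$ bounded, let $a\in L^\infty(\Gamma)$ with $a\ge a_0$ almost everywhere on $\Gamma$ for some constant $a_0>0$, and let $f\in L^2(\Omega)$, $g\in L^2(\Gamma)$. Define $$b(u,v)=\int_\Omega\nabla u\cdot\nabla v\,dx+\int_\Gamma a\,\beta(u)\,v\,ds,\qquad \ell_{f,g}(v)=-\int_\Omega f v\,dx+\int_\Gamma g v\,ds ,$$ and let $u\in H^1_\diamond(\Omega)$ satisfy $b(u,v)=\ell_{f,g}(v)$ for all $v\in H^1_\diamond(\Omega)$. Let $\mathcal T_h$ be an exact, conforming triangulation of $\overline\Omega$ by finitely many curved simplices $K=F_K(\hat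 K)$, where $\hat K$ is the closed reference simplex and $F_K\in C^2(\hat K;\mathbb R^d)$ is injective. Here conforming means that two different elements meet in the (possibly empty) image of a common proper face, on which their two parametrisations agree up to a relabelling of the vertices; exact means that the elements cover $\overline\Omega$ and that $\partial\Omega$ is a union of facets of elements. Let $h=\max_K\operatorname{diam}K$. Assume that $\mathcal T_h$ is quasi-uniform with constants $\kappa>0$, $c<1$, $c_2$: for every $K$ there is an invertible linear map $B_K$ with $\sup_{\hat K}\|(DF_K-B_K)B_K^{-1}\|\le c$ and $\sup_{\hat K}\|D^2F_K\|\le c_2\|B_K\|^2$, such that $B_K\hat K$ contains a ball of radius $h/\kappa$. Let $V_h$ be the space of continuous functions $v$ on $\overline\Omega$ for which $v\circ F_K$ is affine on $\hat K$ for every $K$, let $V_{\diamond,h}=V_h\cap H^1_\diamond(\Omega)$, and let $u_h\in V_{\diamond,h}$ satisfy $b(u_h,v)=\ell_{f,g}(v)$ for all $v\in V_{\diamond,h}$. Then $$\|u-u_h\|_{H^1(\Omega)}\le C\,h\,\|u\|_{H^2(\Omega)},$$ where the right-hand side is $+\infty$ if $u\notin H^2(\Omega)$, and where $C$ depends only on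 $\Omega_1$, $\Omega_2$, on upper bounds for $\|a\|_{L^\infty(\Gamma)}$ and $\|\beta'\|_{L^\infty(\mathbb R)}$, and on $\kappa$, $c$, $c_2$; in particular $C$ does not depend on $h$ or on the triangulation, nor on $f$, $g$, $u$. -/

import Mathlib

open MeasureTheory Set Filter Topology
open scoped NNReal ENNReal ContDiff

noncomputable section

namespace RobinFE

/-- Euclidean space `ℝ^d`. -/
abbrev E (d : ℕ) : Type := EuclideanSpace ℝ (Fin d)

/-- A bounded, connected (nonempty) open set whose boundary is of class `C³`: near each boundary
point `p` there are a unit vector `n` and a `C³` function `γ` of the component orthogonal to `n`,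
such that `D` is locally the set of points lying above the graph of `γ` in direction `n`. -/
structure IsC3Domain {d : ℕ} (D : Set (E d)) : Prop where
  isOpen : IsOpen D
  isConnected : IsConnected D
  isBounded : Bornology.IsBounded D
  exists_graph : ∀ p ∈ frontier D, ∃ (r : ℝ) (n : E d) (γ : E d → ℝ),
    0 < r ∧ ‖n‖ = 1 ∧ ContDiff ℝ 3 γ ∧
      ∀ y ∈ Metric.ball p r, (y ∈ D ↔ γ (y - inner ℝ n y • n) < inner ℝ n y)

/-- The surface measure on the boundary of a domain of `ℝ^d`: the `(d-1)`-dimensional Hausdorff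
measure of `ℝ^d`, normalised to agree with Lebesgue measure on hyperplanes, restricted to `S`. -/
def surfaceMeasure {d : ℕ} (S : Set (E d)) : Measure (E d) :=
  (Measure.euclideanHausdorffMeasure (d - 1)).restrict S

/-! ### Weak derivatives and the spaces `H¹(Ω)`, `H²(Ω)` -/

/-- `g` is a weak partial derivative `∂ᵢ u` of `u` in the open set `Ω`. -/
def HasWeakPartial {d : ℕ} (Ω : Set (E d)) (i : Fin d) (u g : E d → ℝ) : Prop :=
  LocallyIntegrableOn u Ω volume ∧ LocallyIntegrableOn g Ω volume ∧
    ∀ φ : E d → ℝ, ContDiff ℝ ∞ φ → HasCompactSupport φ → tsupport φ ⊆ Ω →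
      ∫ x in Ω, u x * fderiv ℝ φ x (EuclideanSpace.single i 1) = - ∫ x in Ω, g x * φ x

open Classical in
/-- The weak partial derivative `∂ᵢ u` (unique up to null sets of `Ω`); it is `0` by convention
if there is none. -/
def weakPartial {d : ℕ} (Ω : Set (E d)) (i : Fin d) (u : E d → ℝ) : E d → ℝ :=
  if h : ∃ g, HasWeakPartial Ω i u g then h.choose else 0

/-- `u ∈ H¹(Ω)`. -/
def MemH1 {d : ℕ} (Ω : Set (E d)) (u : E d → ℝ) : Prop :=
  MemLp u 2 (volume.restrict Ω) ∧
    ∀ i, ∃ g, HasWeakPartial Ω i u g ∧ MemLp g 2 (volume.restrict Ω)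

/-- `u ∈ H²(Ω)`. -/
def MemH2 {d : ℕ} (Ω : Set (E d)) (u : E d → ℝ) : Prop :=
  MemH1 Ω u ∧ ∀ i, MemH1 Ω (weakPartial Ω i u)

open Classical in
/-- The norm of `H¹(Ω)`, with value `∞` outside `H¹(Ω)`. -/
def h1Norm {d : ℕ} (Ω : Set (E d)) (u : E d → ℝ) : ℝ≥0∞ :=
  if MemH1 Ω u then
    (eLpNorm u 2 (volume.restrict Ω) ^ 2
      + ∑ i, eLpNorm (weakPartial Ω i u) 2 (volume.restrict Ω) ^ 2) ^ (1 / 2 : ℝ)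
  else ∞

open Classical in
/-- The norm of `H²(Ω)`, with value `∞` outside `H²(Ω)`. -/
def h2Norm {d : ℕ} (Ω : Set (E d)) (u : E d → ℝ) : ℝ≥0∞ :=
  if MemH2 Ω u then
    (eLpNorm u 2 (volume.restrict Ω) ^ 2
      + ∑ i, eLpNorm (weakPartial Ω i u) 2 (volume.restrict Ω) ^ 2
      + ∑ i, ∑ j, eLpNorm (weakPartial Ω j (weakPartial Ω i u)) 2 (volume.restrict Ω) ^ 2)
        ^ (1 / 2 : ℝ)
  else ∞

/-! ### Boundary traces -/

/-- `t ∈ L²(∂Ω)` is the boundary trace of `u ∈ H¹(Ω)`: there are functions smooth up to the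
boundary that converge to `u` in `H¹(Ω)` and whose boundary values converge to `t` in `L²(∂Ω)`
(so that the trace is the continuous extension of the restriction to the boundary). -/
def IsTrace {d : ℕ} (Ω : Set (E d)) (u t : E d → ℝ) : Prop :=
  MemLp t 2 (surfaceMeasure (frontier Ω)) ∧
    ∃ φ : ℕ → E d → ℝ, (∀ n, ContDiff ℝ ∞ (φ n)) ∧
      Tendsto (fun n => h1Norm Ω (fun x => u x - φ n x)) atTop (𝓝 0) ∧
      Tendsto (fun n => eLpNorm (fun x => t x - φ n x) 2 (surfaceMeasure (frontier Ω)))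
        atTop (𝓝 0)

open Classical in
/-- The boundary trace of `u` (unique up to null sets of `∂Ω`); it is `0` by convention if there
is none. -/
def trace {d : ℕ} (Ω : Set (E d)) (u : E d → ℝ) : E d → ℝ :=
  if h : ∃ t, IsTrace Ω u t then h.choose else 0

/-- The space `H¹_⋄(Ω)` of all `u ∈ H¹(Ω)` whose trace vanishes on the part `Γ₀` of `∂Ω`. -/
def MemH1Diamond {d : ℕ} (Ω Γ₀ : Set (E d)) (u : E d → ℝ) : Prop :=
  MemH1 Ω u ∧ ∃ t, IsTrace Ω u t ∧ t =ᵐ[surfaceMeasure Γ₀] 0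

/-! ### The forms of the nonlinear Robin problem -/

/-- `b(u,v) = ∫_Ω ∇u · ∇v dx + ∫_Γ a β(u) v ds`. -/
def formB {d : ℕ} (Ω Γ : Set (E d)) (a : E d → ℝ) (β : ℝ → ℝ) (u v : E d → ℝ) : ℝ :=
  (∫ x in Ω, ∑ i, weakPartial Ω i u x * weakPartial Ω i v x)
    + ∫ x, a x * β (trace Ω u x) * trace Ω v x ∂(surfaceMeasure Γ)

/-- `ℓ_{f,g}(v) = -∫_Ω f v dx + ∫_Γ g v ds`. -/
def formL {d : ℕ} (Ω Γ : Set (E d)) (f g v : E d → ℝ) : ℝ :=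
  - (∫ x in Ω, f x * v x) + ∫ x, g x * trace Ω v x ∂(surfaceMeasure Γ)

/-- `u ∈ H¹_⋄(Ω)` is a weak solution of `Δu = f` in `Ω`, `∂_ν u + a β(u) = g` on `Γ`, `u = 0` on
`Γ₀`. -/
def IsWeakSolution {d : ℕ} (Ω Γ Γ₀ : Set (E d)) (a : E d → ℝ) (β : ℝ → ℝ) (f g u : E d → ℝ) :
    Prop :=
  MemH1Diamond Ω Γ₀ u ∧
    ∀ v, MemH1Diamond Ω Γ₀ v → formB Ω Γ a β u v = formL Ω Γ f g v

/-! ### Curved triangulations and piecewise linear finite elements -/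

/-- The vertices `0, e₁, …, e_d` of the reference simplex. -/
def refVertex (d : ℕ) : Fin (d + 1) → E d :=
  Fin.cons 0 fun i => EuclideanSpace.single i 1

/-- The face of the reference simplex spanned by the vertices with index in `s`. -/
def refFace {d : ℕ} (s : Finset (Fin (d + 1))) : Set (E d) :=
  convexHull ℝ (refVertex d '' s)

/-- The (closed) reference simplex. -/
def refSimplex (d : ℕ) : Set (E d) :=
  convexHull ℝ (Set.range (refVertex d))

/-- An exact triangulation of `Ω` by finitely many curved simplices `K_i = F_i(K̂)`, the images of
the reference simplex `K̂` under injective `C²` maps `F_i`.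
* `iUnion_eq`: the elements cover `Ω` exactly.
* `conforming`: two different elements meet in the image of a common (possibly empty) proper face,
  on which the two parametrisations agree up to a relabelling `π` of the vertices (so that the
  mapped linear functions match across common faces).
* `frontier_eq`: the boundary of `Ω` is a union of curved facets of elements. -/
structure CurvedTriangulation {d : ℕ} (Ω : Set (E d)) where
  /-- the number of elements -/
  card : ℕ
  /-- the element maps -/
  map : Fin card → E d → E d
  contDiffOn : ∀ i, ContDiffOn ℝ 2 (map i) (refSimplex d)
  injOn : ∀ i, InjOn (map i) (refSimplex d)
  iUnion_eq : ⋃ i, map i '' refSimplex d = closure Ω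
  conforming : ∀ i j, i ≠ j → ∃ (s : Finset (Fin (d + 1))) (π : Equiv.Perm (Fin (d + 1))),
    s ≠ Finset.univ ∧
    map i '' refSimplex d ∩ map j '' refSimplex d = map i '' refFace s ∧
    ∀ w ∈ stdSimplex ℝ (Fin (d + 1)), (∀ k, k ∉ s → w k = 0) →
      map j (∑ k, w k • refVertex d (π k)) = map i (∑ k, w k • refVertex d k)
  frontier_eq : ∀ x ∈ frontier Ω, ∃ (i : Fin card) (s : Finset (Fin (d + 1))),
    s.card = d ∧ x ∈ map i '' refFace s ∧ map i '' refFace s ⊆ frontier Ω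

/-- The mesh size `h = max_K diam K`. -/
def CurvedTriangulation.meshSize {d : ℕ} {Ω : Set (E d)} (T : CurvedTriangulation Ω) : ℝ :=
  ⨆ i, Metric.diam (T.map i '' refSimplex d)

/-- Quasi-uniformity of a curved triangulation, with constants `κ, c, c₂`. Each element map `F` is
a perturbation of an invertible affine map with linear part `B` such that
* `sup ‖(DF - B) B⁻¹‖ ≤ c` (where `c < 1`) and `sup ‖D²F‖ ≤ c₂ ‖B‖²` on the reference simplex;
* the straight simplex contains a ball of radius `h / κ`, with `h` the mesh size of `T`.
The second item says both that the elements are shape regular and that they are of comparable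
size. -/
def CurvedTriangulation.IsQuasiUniform {d : ℕ} {Ω : Set (E d)} (T : CurvedTriangulation Ω)
    (κ c c₂ : ℝ) : Prop :=
  ∀ i, ∃ B : E d ≃L[ℝ] E d,
    (∀ x ∈ refSimplex d,
      ‖(fderivWithin ℝ (T.map i) (refSimplex d) x - (B : E d →L[ℝ] E d)).comp
        (B.symm : E d →L[ℝ] E d)‖ ≤ c ∧
      ‖iteratedFDerivWithin ℝ 2 (T.map i) (refSimplex d) x‖ ≤ c₂ * ‖(B : E d →L[ℝ] E d)‖ ^ 2) ∧
    ∃ z, Metric.closedBall z (T.meshSize / κ) ⊆ B '' refSimplex d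

/-- The finite element space `V_h` of continuous functions on the closure of `Ω` that are affine
on each element after mapping it to the reference simplex. -/
def CurvedTriangulation.MemV {d : ℕ} {Ω : Set (E d)} (T : CurvedTriangulation Ω)
    (v : E d → ℝ) : Prop :=
  ContinuousOn v (closure Ω) ∧
    ∀ i, ∃ A : E d →ᵃ[ℝ] ℝ, ∀ x ∈ refSimplex d, v (T.map i x) = A x

/-- The space `V_{⋄,h} = V_h ∩ H¹_⋄(Ω)`. -/
def CurvedTriangulation.MemVDiamond {d : ℕ} {Ω : Set (E d)} (T : CurvedTriangulation Ω)
    (Γ₀ : Set (E d)) (v : E d → ℝ) : Prop :=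
  T.MemV v ∧ MemH1Diamond Ω Γ₀ v

/-- `u_h ∈ V_{⋄,h}` is a Galerkin approximation: `b(u_h,v) = ℓ_{f,g}(v)` for all
`v ∈ V_{⋄,h}`. -/
def CurvedTriangulation.IsGalerkinSolution {d : ℕ} {Ω : Set (E d)} (T : CurvedTriangulation Ω)
    (Γ Γ₀ : Set (E d)) (a : E d → ℝ) (β : ℝ → ℝ) (f g uh : E d → ℝ) : Prop :=
  T.MemVDiamond Γ₀ uh ∧
    ∀ v, T.MemVDiamond Γ₀ v → formB Ω Γ a β uh v = formL Ω Γ f g v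

end RobinFE

end

noncomputable section

namespace RobinFE

variable {d : ℕ}

/-! ### Geometry of the domain -/

/-! The estimate is Céa's lemma for a monotone problem, combined with an interpolation estimate on
curved elements.

Quasi-optimality (`exists_h1Norm_sub_le_gradNorm_sub`). Let e = u - u_h and w ∈ V_{⋄,h}. The
function w - u_h is admissible in both equations, so b(u, w - u_h) = b(u_h, w - u_h). Since a ≥ 0
and β is monotone, a(β(u) - β(u_h))(u - u_h) ≥ 0 on Γ, and therefore ‖∇e‖² ≤ ∫_Ω ∇e·∇(u - w) + ∫_Γ
a(β(u) - β(u_h))(u - w). The Lipschitz bound for β, the trace inequality and the Poincaré inequality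
on H¹_⋄ bound the right-hand side by C‖∇e‖‖∇(u - w)‖. Both inequalities are proved for smooth
functions by integrating along lines (`exists_trace_inequality`, `exists_poincare`) and pass to
limits because traces are defined by smooth approximation.

Interpolation (`exists_memVDiamond_gradNorm_sub_le`). Mollification towards the inside of the domain
gives smooth φ_n → u in H². For d ≤ 3 the first order Taylor remainder at a vertex is bounded in L²
of the reference simplex by the second derivative (`lintegral_taylor_remainder_le`). This has two
uses. It gives a Sobolev bound on each element, so the φ_n converge uniformly to a continuous U,
which is the trace of u on the boundary and has nodal values. It also bounds the gradient error of
the nodal interpolant: on an element of size h the second derivative of φ ∘ F carries a factor h²,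
and returning to the element costs 1/h.

The interpolant w of U is Lipschitz, hence in H¹ and its own trace. It vanishes on Γ₀, because a
boundary facet is connected and so lies in one of the disjoint closed sets Γ, Γ₀. Replacing the
nodal values of φ_n by those of U costs a constant that depends on the mesh times sup |U - φ_n|; the
mesh is fixed while n → ∞, so this term disappears. -/

/-- Two open sets that coincide near `p` have the same closure near `p`, described by the same
graph. -/
theorem mem_closure_iff_of_graph {d : ℕ} {D : Set (E d)} {p n : E d} {r : ℝ} {γ : E d → ℝ}
    (hn : ‖n‖ = 1) (hγ : Continuous γ)
    (h : ∀ y ∈ Metric.ball p r, (y ∈ D ↔ γ (y - inner ℝ n y • n) < inner ℝ n y))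
    {y : E d} (hy : y ∈ Metric.ball p r) :
    y ∈ closure D ↔ γ (y - inner ℝ n y • n) ≤ inner ℝ n y := by
  have hc1 : Continuous fun y : E d => γ (y - inner ℝ n y • n) := by fun_prop
  have hc2 : Continuous fun y : E d => inner ℝ n y := by fun_prop
  constructor
  · intro hcl
    have h1 : y ∈ closure (D ∩ Metric.ball p r) :=
      inter_comm D _ ▸ Metric.isOpen_ball.inter_closure ⟨hy, hcl⟩
    exact closure_minimal (fun z hz => ((h z hz.2).1 hz.1).le) (isClosed_le hc1 hc2) h1
  · intro hle
    -- Moving up along `n` does not change the component orthogonal to `n`, so `y + s • n` lies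
    -- strictly above the graph for `s > 0`.
    have hcont : Tendsto (fun s : ℝ => y + s • n) (𝓝[>] 0) (𝓝 y) := by
      have : Continuous fun s : ℝ => y + s • n := by fun_prop
      have h0 := this.tendsto 0
      simp only [zero_smul, add_zero] at h0
      exact h0.mono_left nhdsWithin_le_nhds
    refine mem_closure_of_tendsto hcont ?_
    filter_upwards [hcont.eventually (Metric.isOpen_ball.mem_nhds hy), self_mem_nhdsWithin]
      with s hs hs0
    rw [h _ hs]
    have hnn : inner ℝ n n = (1 : ℝ) := by rw [real_inner_self_eq_norm_sq, hn]; norm_num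
    have e1 : inner ℝ n (y + s • n) = inner ℝ n y + s := by
      rw [inner_add_right, inner_smul_right, hnn, mul_one]
    have e2 : y + s • n - (inner ℝ n y + s) • n = y - inner ℝ n y • n := by
      rw [add_smul]; abel
    rw [e1, e2]
    have : (0 : ℝ) < s := hs0
    linarith

/-! ### The boundary of the annular domain -/

section Annulus

variable {Ω₁ Ω₂ : Set (E d)}

/-- This fails for general open sets, whose boundary points may be interior to their closure. With a
graph, moving down along `n` leaves the closure of `Ω₁`. -/
theorem frontier_left_subset_frontier_diff (hΩ₁ : IsC3Domain Ω₁) (hΩ₂ : IsOpen Ω₂)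
    (h : closure Ω₁ ⊆ Ω₂) : frontier Ω₁ ⊆ frontier (Ω₂ \ closure Ω₁) := by
  intro p hp
  have hopen : IsOpen (Ω₂ \ closure Ω₁) := hΩ₂.sdiff isClosed_closure
  rw [hopen.frontier_eq]
  have hpc : p ∈ closure Ω₁ := frontier_subset_closure hp
  refine ⟨?_, fun h' => h'.2 hpc⟩
  obtain ⟨r, n, γ, hr, hn, hγ, hg⟩ := hΩ₁.exists_graph p hp
  have hp0 : inner ℝ n p ≤ γ (p - inner ℝ n p • n) := by
    by_contra hlt
    push Not at hlt
    have := (hg p (Metric.mem_ball_self hr)).2 hlt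
    rw [hΩ₁.isOpen.frontier_eq] at hp
    exact hp.2 this
  have hcont : Tendsto (fun s : ℝ => p + s • n) (𝓝[<] 0) (𝓝 p) := by
    have : Continuous fun s : ℝ => p + s • n := by fun_prop
    have h0 := this.tendsto 0
    simp only [zero_smul, add_zero] at h0
    exact h0.mono_left nhdsWithin_le_nhds
  refine mem_closure_of_tendsto hcont ?_
  filter_upwards [hcont.eventually (Metric.isOpen_ball.mem_nhds (Metric.mem_ball_self hr)),
    hcont.eventually (hΩ₂.mem_nhds (h hpc)), self_mem_nhdsWithin] with s hs hs2 hs0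
  refine ⟨hs2, ?_⟩
  rw [mem_closure_iff_of_graph hn hγ.continuous hg hs]
  have hnn : inner ℝ n n = (1 : ℝ) := by rw [real_inner_self_eq_norm_sq, hn]; norm_num
  have e1 : inner ℝ n (p + s • n) = inner ℝ n p + s := by
    rw [inner_add_right, inner_smul_right, hnn, mul_one]
  have e2 : p + s • n - (inner ℝ n p + s) • n = p - inner ℝ n p • n := by
    rw [add_smul]; abel
  rw [e1, e2]
  have : s < (0 : ℝ) := hs0
  linarith

theorem frontier_right_subset_frontier_diff (hΩ₂ : IsOpen Ω₂)
    (h : closure Ω₁ ⊆ Ω₂) : frontier Ω₂ ⊆ frontier (Ω₂ \ closure Ω₁) := by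
  intro p hp
  have hopen : IsOpen (Ω₂ \ closure Ω₁) := hΩ₂.sdiff isClosed_closure
  rw [hopen.frontier_eq]
  rw [hΩ₂.frontier_eq] at hp
  refine ⟨?_, fun h' => hp.2 h'.1⟩
  have h1 : p ∈ (closure Ω₁)ᶜ := fun h' => hp.2 (h h')
  rw [sdiff_eq, inter_comm]
  exact (isOpen_compl_iff.2 isClosed_closure).inter_closure ⟨h1, hp.1⟩

theorem frontier_diff_subset (hΩ₁ : IsOpen Ω₁) (hΩ₂ : IsOpen Ω₂) :
    frontier (Ω₂ \ closure Ω₁) ⊆ frontier Ω₁ ∪ frontier Ω₂ := by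
  intro p hp
  have hopen : IsOpen (Ω₂ \ closure Ω₁) := hΩ₂.sdiff isClosed_closure
  rw [hopen.frontier_eq] at hp
  by_cases h2 : p ∈ Ω₂
  · left
    rw [hΩ₁.frontier_eq]
    have hp1 : p ∈ closure Ω₁ := by
      by_contra h1
      exact hp.2 ⟨h2, h1⟩
    refine ⟨hp1, fun h1 => ?_⟩
    obtain ⟨y, hy1, hy2⟩ := mem_closure_iff.1 hp.1 _ hΩ₁ h1
    exact hy2.2 (subset_closure hy1)
  · right
    rw [hΩ₂.frontier_eq]
    exact ⟨closure_mono sdiff_subset hp.1, h2⟩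

/-- Near `∂Ω₁` the difference is the complement of the closure of `Ω₁`, the region strictly below
the graph. Turning the picture upside down, with normal `-n` and graph function `-γ`, makes it the
region above a graph. -/
theorem isC3Domain_diff (hΩ₁ : IsC3Domain Ω₁) (hΩ₂ : IsC3Domain Ω₂) (h : closure Ω₁ ⊆ Ω₂)
    (hc : IsConnected (Ω₂ \ closure Ω₁)) : IsC3Domain (Ω₂ \ closure Ω₁) where
  isOpen := hΩ₂.isOpen.sdiff isClosed_closure
  isConnected := hc
  isBounded := hΩ₂.isBounded.subset sdiff_subset
  exists_graph := by
    intro p hp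
    rcases frontier_diff_subset hΩ₁.isOpen hΩ₂.isOpen hp with hp1 | hp2
    · obtain ⟨r, n, γ, hr, hn, hγ, hg⟩ := hΩ₁.exists_graph p hp1
      obtain ⟨r₂, hr₂, hb₂⟩ :=
        Metric.isOpen_iff.1 hΩ₂.isOpen p (h (frontier_subset_closure hp1))
      refine ⟨min r r₂, -n, fun y => -γ y, lt_min hr hr₂, by simpa using hn, hγ.neg, ?_⟩
      intro y hy
      have hy1 : y ∈ Metric.ball p r := Metric.ball_subset_ball (min_le_left _ _) hy
      have hy2 : y ∈ Ω₂ := hb₂ (Metric.ball_subset_ball (min_le_right _ _) hy)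
      have e : y - inner ℝ (-n) y • (-n) = y - inner ℝ n y • n := by
        rw [inner_neg_left, neg_smul_neg]
      rw [e, inner_neg_left, neg_lt_neg_iff, ← not_le,
        ← mem_closure_iff_of_graph hn hγ.continuous hg hy1]
      exact ⟨fun h' => h'.2, fun h' => ⟨hy2, h'⟩⟩
    · obtain ⟨r, n, γ, hr, hn, hγ, hg⟩ := hΩ₂.exists_graph p hp2
      have hp1 : p ∈ (closure Ω₁)ᶜ := fun h' => by
        rw [hΩ₂.isOpen.frontier_eq] at hp2
        exact hp2.2 (h h')
      obtain ⟨r₂, hr₂, hb₂⟩ := Metric.isOpen_iff.1 isClosed_closure.isOpen_compl p hp1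
      refine ⟨min r r₂, n, γ, lt_min hr hr₂, hn, hγ, ?_⟩
      intro y hy
      have hy1 : y ∈ Metric.ball p r := Metric.ball_subset_ball (min_le_left _ _) hy
      have hy2 : y ∈ (closure Ω₁)ᶜ := hb₂ (Metric.ball_subset_ball (min_le_right _ _) hy)
      rw [← hg y hy1]
      exact ⟨fun h' => h'.1, fun h' => ⟨h', hy2⟩⟩

end Annulus

/-! ### Interior cones and boundary charts -/

/-- The uniform interior cone condition at points of the closure. -/
theorem IsC3Domain.exists_cone {d : ℕ} {D : Set (E d)} (hD : IsC3Domain D) {p : E d}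
    (hp : p ∈ closure D) : ∃ (n : E d) (r ε : ℝ), 0 < r ∧ 0 < ε ∧
      ∀ x ∈ closure D ∩ Metric.ball p r, ∀ τ : ℝ, 0 < τ → τ < r → ∀ v : E d, ‖v - n‖ < ε →
        x + τ • v ∈ D := by
  by_cases hpD : p ∈ D
  · obtain ⟨R, hR, hb⟩ := Metric.isOpen_iff.1 hD.isOpen p hpD
    -- At an interior point no direction is needed: `n = 0` and `ε = 1` make the cone a ball.
    refine ⟨0, R / 2, 1, by positivity, one_pos, ?_⟩
    intro x hx τ hτ hτr v hv
    apply hb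
    rw [sub_zero] at hv
    have h1 : dist x p < R / 2 := hx.2
    rw [Metric.mem_ball, dist_eq_norm]
    rw [dist_eq_norm] at h1
    calc ‖x + τ • v - p‖ = ‖(x - p) + τ • v‖ := by congr 1; abel
      _ ≤ ‖x - p‖ + ‖τ • v‖ := norm_add_le _ _
      _ < R := by
        rw [norm_smul, Real.norm_of_nonneg hτ.le]
        nlinarith [norm_nonneg v]
  · have hpf : p ∈ frontier D := by
      rw [hD.isOpen.frontier_eq]; exact ⟨hp, hpD⟩
    obtain ⟨r, n, γ, hr, hn, hγ, hg⟩ := hD.exists_graph p hpf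
    obtain ⟨Λ, t, ht, hlip⟩ := (hγ.of_le (by norm_num : (1 : WithTop ℕ∞) ≤ 3)).locallyLipschitz
      (p - inner ℝ n p • n)
    let π : E d → E d := fun y => y - inner ℝ n y • n
    have hπc : Continuous π := by fun_prop
    obtain ⟨r₁, hr₁, hb₁⟩ := Metric.mem_nhds_iff.1 (hπc.continuousAt.preimage_mem_nhds ht)
    have hΛ : (0 : ℝ) ≤ Λ := Λ.2
    -- Along `τ • v` the height grows by at least `τ (1 - ε)` while the graph rises by at most `2 Λ
    -- τ ε`. The choice `ε (1 + 2 Λ) = 1 / 2` leaves room between the two.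
    set ε : ℝ := 1 / (2 * (1 + 2 * Λ)) with hε
    have hε0 : 0 < ε := by positivity
    have hε1 : ε * (1 + 2 * Λ) = 1 / 2 := by rw [hε]; field_simp
    have hεle : ε ≤ 1 := by
      rw [hε, div_le_one (by positivity)]; linarith
    set r' := min r r₁ / 4 with hr'
    have hr'0 : 0 < r' := by positivity
    have hr'1 : r' * 4 ≤ r := by rw [hr']; linarith [min_le_left r r₁]
    have hr'2 : r' * 4 ≤ r₁ := by rw [hr']; linarith [min_le_right r r₁]
    refine ⟨n, r', ε, hr'0, hε0, ?_⟩
    intro x hx τ hτ hτr v hv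
    have hxp : ‖x - p‖ < r' := by rw [← dist_eq_norm]; exact hx.2
    have hvn : ‖v‖ ≤ 2 := by
      calc ‖v‖ = ‖(v - n) + n‖ := by congr 1; abel
        _ ≤ ‖v - n‖ + ‖n‖ := norm_add_le _ _
        _ ≤ 2 := by rw [hn]; linarith
    have hxv : ‖x + τ • v - p‖ < r' * 4 := by
      calc ‖x + τ • v - p‖ = ‖(x - p) + τ • v‖ := by congr 1; abel
        _ ≤ ‖x - p‖ + ‖τ • v‖ := norm_add_le _ _
        _ < r' * 4 := by
          rw [norm_smul, Real.norm_of_nonneg hτ.le]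
          nlinarith [norm_nonneg v]
    have hxb : x ∈ Metric.ball p r := by
      rw [Metric.mem_ball, dist_eq_norm]; linarith
    have hxvb : x + τ • v ∈ Metric.ball p r := by
      rw [Metric.mem_ball, dist_eq_norm]; linarith
    have hx1 := (mem_closure_iff_of_graph hn hγ.continuous hg hxb).1 hx.1
    rw [hg _ hxvb]
    change γ (π (x + τ • v)) < _
    have hnn : inner ℝ n n = (1 : ℝ) := by rw [real_inner_self_eq_norm_sq, hn]; norm_num
    have hiw : |inner ℝ n (v - n)| ≤ ‖v - n‖ := by
      simpa [hn] using abs_real_inner_le_norm n (v - n)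
    have e1 : inner ℝ n (x + τ • v) = inner ℝ n x + τ * (1 + inner ℝ n (v - n)) := by
      rw [inner_add_right, inner_smul_right, inner_sub_right, hnn]; ring
    have hl := hlip.dist_le_mul (π (x + τ • v))
      (hb₁ (by rw [Metric.mem_ball, dist_eq_norm]; linarith)) (π x)
      (hb₁ (by rw [Metric.mem_ball, dist_eq_norm]; linarith))
    have e2 : π (x + τ • v) - π x = τ • ((v - n) - inner ℝ n (v - n) • n) := by
      simp only [π]
      rw [inner_add_right, inner_smul_right, inner_sub_right, hnn]
      module
    have hn2 : ‖(v - n) - inner ℝ n (v - n) • n‖ ≤ 2 * ‖v - n‖ := by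
      calc _ ≤ ‖v - n‖ + ‖inner ℝ n (v - n) • n‖ := norm_sub_le _ _
        _ ≤ 2 * ‖v - n‖ := by
          rw [norm_smul, hn, mul_one, Real.norm_eq_abs]; linarith
    rw [dist_eq_norm, dist_eq_norm, e2, norm_smul, Real.norm_of_nonneg hτ.le] at hl
    have hl2 := (le_abs_self _).trans hl
    have hb := (abs_le.1 hiw).1
    have h3 : (Λ : ℝ) * (τ * ‖v - n - inner ℝ n (v - n) • n‖) ≤ Λ * (τ * (2 * ε)) := by
      gcongr
      linarith
    have h4 : τ * (-ε) ≤ τ * inner ℝ n (v - n) := by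
      gcongr
      linarith
    rw [e1]
    have h5 : γ (π x) ≤ inner ℝ n x := hx1
    have h6 : τ * (ε * (1 + 2 * Λ)) = τ * (1 / 2) := by rw [hε1]
    nlinarith

/-- A boundary chart at `p`: a measure preserving homeomorphism, straightening the lines in a
direction `n`, that flattens the boundary of `D` near `p`. -/
structure BoundaryChart {m : ℕ} (D : Set (E (m + 1))) (p : E (m + 1)) where
  /-- the straightening map -/
  Φ : E m × ℝ ≃ₜ E (m + 1)
  /-- the vertical direction -/
  n : E (m + 1)
  /-- the base point -/
  z₀ : E m
  /-- the radius of the base -/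
  ρ : ℝ
  /-- the height -/
  δ : ℝ
  /-- the Lipschitz constant of the graph -/
  Λ : ℝ≥0
  ρ_pos : 0 < ρ
  δ_pos : 0 < δ
  norm_n : ‖n‖ = 1
  apply_eq : ∀ z s, Φ (z, s) = Φ (z, 0) + s • n
  measurePreserving : MeasurePreserving Φ volume volume
  apply_base : Φ (z₀, 0) = p
  lipschitz : LipschitzOnWith Λ (fun z => Φ (z, 0)) (Metric.ball z₀ ρ)
  antilipschitz : AntilipschitzWith 1 (fun z => Φ (z, 0))
  mem_iff : ∀ z ∈ Metric.ball z₀ ρ, ∀ s ∈ Ioo (-δ) δ, (Φ (z, s) ∈ D ↔ 0 < s)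

/-- The product carries the `L²` norm so that the frame is an isometry and hence preserves volume.
-/
theorem exists_orthogonal_frame {m : ℕ} (n : E (m + 1)) (hn : ‖n‖ = 1) :
    ∃ R : WithLp 2 (E m × ℝ) ≃ₗᵢ[ℝ] E (m + 1), R (WithLp.toLp 2 (0, 1)) = n := by
  have hn0 : n ≠ 0 := by rintro rfl; simp at hn
  have hfr : Module.finrank ℝ (ℝ ∙ n)ᗮ = m := by
    have : Fact (Module.finrank ℝ (E (m + 1)) = m + 1) := ⟨by simp⟩
    exact Submodule.finrank_orthogonal_span_singleton hn0
  let J : E m ≃ₗᵢ[ℝ] (ℝ ∙ n)ᗮ :=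
    ((stdOrthonormalBasis ℝ (ℝ ∙ n)ᗮ).reindex (finCongr hfr)).repr.symm
  have hort : ∀ z, inner ℝ n (J z : E (m + 1)) = (0 : ℝ) := fun z =>
    Submodule.mem_orthogonal_singleton_iff_inner_right.1 (J z).2
  let R₀ : WithLp 2 (E m × ℝ) →ₗ[ℝ] E (m + 1) :=
    { toFun := fun w => (J w.fst : E (m + 1)) + w.snd • n
      map_add' := by intro a b; simp [add_smul]; abel
      map_smul' := by intro c a; simp [mul_smul] }
  let R₁ : WithLp 2 (E m × ℝ) →ₗᵢ[ℝ] E (m + 1) :=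
    { R₀ with
      norm_map' := by
        intro w
        change ‖(J w.fst : E (m + 1)) + w.snd • n‖ = ‖w‖
        rw [← sq_eq_sq₀ (norm_nonneg _) (norm_nonneg _), WithLp.prod_norm_sq_eq_of_L2,
          @norm_add_sq_real, inner_smul_right, real_inner_comm, hort, norm_smul, hn]
        have : ‖(J w.fst : E (m + 1))‖ = ‖w.fst‖ := by
          rw [← J.norm_map]; rfl
        rw [this]; ring }
  have hdim : Module.finrank ℝ (WithLp 2 (E m × ℝ)) = Module.finrank ℝ (E (m + 1)) := by
    rw [(WithLp.linearEquiv 2 ℝ (E m × ℝ)).finrank_eq]; simp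
  refine ⟨R₁.toLinearIsometryEquiv hdim, ?_⟩
  change (J (0 : E m) : E (m + 1)) + (1 : ℝ) • n = n
  simp

/-- The chart is the shear `(z, s) ↦ (z, g z + s)`, with `g` the graph function in the frame,
followed by the orthogonal frame. A shear preserves volume by Fubini, so no Jacobian appears. -/
theorem IsC3Domain.exists_boundaryChart {m : ℕ} {D : Set (E (m + 1))} (hD : IsC3Domain D)
    {p : E (m + 1)} (hp : p ∈ frontier D) : Nonempty (BoundaryChart D p) := by
  obtain ⟨r, n, γ, hr, hn, hγ, hg⟩ := hD.exists_graph p hp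
  obtain ⟨R, hR⟩ := exists_orthogonal_frame n hn
  have hnn : inner ℝ n n = (1 : ℝ) := by rw [real_inner_self_eq_norm_sq, hn]; norm_num
  let J : E m → E (m + 1) := fun z => R (WithLp.toLp 2 (z, 0))
  have hJiso : Isometry J := by
    refine R.isometry.comp (Isometry.of_dist_eq fun a b => ?_)
    rw [WithLp.prod_dist_eq_of_L2]
    simp
  have hJn : ∀ z, inner ℝ n (J z) = (0 : ℝ) := by
    intro z
    rw [← hR, R.inner_map_map, WithLp.prod_inner_apply]
    simp
  have hRdec : ∀ z (t : ℝ), R (WithLp.toLp 2 (z, t)) = J z + t • n := by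
    intro z t
    rw [← hR, ← map_smul, ← map_add]
    congr 1
    apply (WithLp.equiv 2 (E m × ℝ)).injective
    ext <;> simp
  let g : E m → ℝ := fun z => γ (J z)
  have hgc : Continuous g := hγ.continuous.comp hJiso.continuous
  let S : E m × ℝ ≃ₜ E m × ℝ :=
    { toFun := fun q => (q.1, g q.1 + q.2)
      invFun := fun q => (q.1, q.2 - g q.1)
      left_inv := fun q => by simp
      right_inv := fun q => by simp
      continuous_toFun := by fun_prop
      continuous_invFun := by fun_prop }
  have hS : MeasurePreserving S volume volume := by
    refine (MeasurePreserving.id (volume : Measure (E m))).skew_product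
      (g := fun z t => g z + t) (by fun_prop) (ae_of_all _ fun z => ?_)
    exact (measurePreserving_add_left volume (g z)).map_eq
  let Φ : E m × ℝ ≃ₜ E (m + 1) :=
    (S.trans (WithLp.homeomorphProd 2 (E m) ℝ).symm).trans R.toHomeomorph
  have hΦ : ∀ z s, Φ (z, s) = J z + (g z + s) • n := fun z s => hRdec z (g z + s)
  have hΦmp : MeasurePreserving Φ volume volume :=
    R.measurePreserving.comp ((WithLp.volume_preserving_toLp (E m) ℝ).comp hS)
  have hin : ∀ z s, inner ℝ n (Φ (z, s)) = g z + s := by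
    intro z s
    rw [hΦ, inner_add_right, inner_smul_right, hJn, hnn]; ring
  have hpr : ∀ z s, Φ (z, s) - inner ℝ n (Φ (z, s)) • n = J z := by
    intro z s
    rw [hin, hΦ]; abel
  have hmem : ∀ z s, Φ (z, s) ∈ Metric.ball p r → (Φ (z, s) ∈ D ↔ 0 < s) := by
    intro z s h
    rw [hg _ h, hpr, hin]
    exact lt_add_iff_pos_right _
  obtain ⟨⟨z₀, s₀⟩, hq⟩ := Φ.surjective p
  -- The point `p` lies on the graph: `s₀ > 0` would put it in the open set `D`, and `s₀ < 0` would
  -- keep it away from the closure of `D`.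
  have hs₀ : s₀ = 0 := by
    have hp' := hp
    rw [hD.isOpen.frontier_eq] at hp'
    have hle : ¬ 0 < s₀ := fun h0 => hp'.2 (by
      rw [← hq]; exact (hmem z₀ s₀ (by rw [hq]; exact Metric.mem_ball_self hr)).2 h0)
    by_contra hne
    have hlt : s₀ < 0 := lt_of_le_of_ne (not_lt.1 hle) hne
    have hcl : p ∈ closure (D ∩ Metric.ball p r) :=
      inter_comm D _ ▸ Metric.isOpen_ball.inter_closure ⟨Metric.mem_ball_self hr, hp'.1⟩
    have hsub : closure (D ∩ Metric.ball p r) ⊆ {y | 0 ≤ (Φ.symm y).2} := by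
      refine closure_minimal (fun y hy => ?_)
        (isClosed_le continuous_const (continuous_snd.comp Φ.symm.continuous))
      have hy' : Φ ((Φ.symm y).1, (Φ.symm y).2) = y := Φ.apply_symm_apply y
      have := (hmem (Φ.symm y).1 (Φ.symm y).2 (by rw [hy']; exact hy.2)).1
        (by rw [hy']; exact hy.1)
      exact this.le
    have := hsub hcl
    rw [← hq] at this
    simp only [mem_ofPred_eq, Homeomorph.symm_apply_apply] at this
    linarith
  subst hs₀
  obtain ⟨Λ, t, ht, hlip⟩ := (hγ.of_le (by norm_num : (1 : WithTop ℕ∞) ≤ 3)).locallyLipschitz (J z₀)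
  obtain ⟨ρ₁, hρ₁, hb₁⟩ := Metric.mem_nhds_iff.1 (hJiso.continuous.continuousAt.preimage_mem_nhds ht)
  have hnb : Φ ⁻¹' (Metric.ball p r) ∈ 𝓝 (z₀, (0 : ℝ)) :=
    Φ.continuous.continuousAt.preimage_mem_nhds (by
      rw [hq]; exact Metric.isOpen_ball.mem_nhds (Metric.mem_ball_self hr))
  obtain ⟨ρ₂, hρ₂, hb₂⟩ := Metric.mem_nhds_iff.1 hnb
  refine ⟨{ Φ := Φ, n := n, z₀ := z₀, ρ := min ρ₁ ρ₂, δ := ρ₂, Λ := 1 + Λ,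
            ρ_pos := lt_min hρ₁ hρ₂, δ_pos := hρ₂, norm_n := hn, apply_eq := ?_,
            measurePreserving := hΦmp, apply_base := hq, lipschitz := ?_, antilipschitz := ?_,
            mem_iff := ?_ }⟩
  · intro z s
    rw [hΦ, hΦ]; module
  · have hg1 : LipschitzOnWith Λ g (Metric.ball z₀ (min ρ₁ ρ₂)) := by
      have h1 : LipschitzOnWith (Λ * 1) (γ ∘ J) (Metric.ball z₀ (min ρ₁ ρ₂)) :=
        hlip.comp (hJiso.lipschitz.lipschitzOnWith)
          (fun z hz => hb₁ (Metric.ball_subset_ball (min_le_left _ _) hz))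
      rwa [mul_one] at h1
    refine LipschitzOnWith.of_dist_le_mul fun a ha b hb => ?_
    have h2 := hg1.dist_le_mul a ha b hb
    rw [hΦ, hΦ, dist_eq_norm]
    calc ‖J a + (g a + 0) • n - (J b + (g b + 0) • n)‖
        = ‖(J a - J b) + (g a - g b) • n‖ := by congr 1; module
      _ ≤ ‖J a - J b‖ + ‖(g a - g b) • n‖ := norm_add_le _ _
      _ ≤ dist a b + Λ * dist a b := by
        rw [norm_smul, hn, mul_one, ← dist_eq_norm, ← dist_eq_norm, hJiso.dist_eq]
        gcongr
      _ = _ := by push_cast; ring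
  -- The increment of the graph map is `J a - J b` plus a multiple of `n` orthogonal to it, so by
  -- Pythagoras it is at least as long as `a - b`.
  · refine AntilipschitzWith.of_le_mul_dist fun a b => ?_
    rw [hΦ, hΦ, NNReal.coe_one, one_mul, ← hJiso.dist_eq, dist_eq_norm, dist_eq_norm]
    have e : J a + (g a + 0) • n - (J b + (g b + 0) • n) = (J a - J b) + (g a - g b) • n := by
      module
    rw [e, ← sq_le_sq₀ (norm_nonneg _) (norm_nonneg _), @norm_add_sq_real, inner_smul_right,
      inner_sub_left, real_inner_comm, hJn, real_inner_comm, hJn]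
    nlinarith [sq_nonneg ‖(g a - g b) • n‖]
  · intro z hz s hs
    refine hmem z s (hb₂ ?_)
    rw [Metric.mem_ball, Prod.dist_eq, max_lt_iff]
    refine ⟨(Metric.mem_ball.1 hz).trans_le (min_le_right _ _), ?_⟩
    rw [Real.dist_eq, sub_zero, abs_lt]
    exact hs

/-! ### Comparison of integrals -/

theorem sq_lintegral_mul_le {α : Type*} [MeasurableSpace α] {μ : Measure α} {f g : α → ℝ≥0∞}
    (hf : AEMeasurable f μ) (hg : AEMeasurable g μ) :
    (∫⁻ x, f x * g x ∂μ) ^ 2 ≤ (∫⁻ x, f x ^ 2 ∂μ) * ∫⁻ x, g x ^ 2 ∂μ := by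
  have h := ENNReal.lintegral_mul_le_Lp_mul_Lq μ Real.HolderConjugate.two_two hf hg
  simp only [Pi.mul_apply, ENNReal.rpow_ofNat] at h
  have h2 := pow_le_pow_left₀ (zero_le) h 2
  refine h2.trans_eq ?_
  rw [mul_pow, ← ENNReal.rpow_natCast, ← ENNReal.rpow_natCast, ← ENNReal.rpow_mul,
    ← ENNReal.rpow_mul]
  norm_num

theorem sq_lintegral_le {α : Type*} [MeasurableSpace α] {μ : Measure α} {f : α → ℝ≥0∞}
    (hf : AEMeasurable f μ) : (∫⁻ x, f x ∂μ) ^ 2 ≤ μ univ * ∫⁻ x, f x ^ 2 ∂μ := by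
  simpa using sq_lintegral_mul_le (f := fun _ => 1) aemeasurable_const hf

theorem ennreal_add_sq_le (a b : ℝ≥0∞) : (a + b) ^ 2 ≤ 2 * a ^ 2 + 2 * b ^ 2 := by
  have := ENNReal.rpow_add_le_mul_rpow_add_rpow a b (p := 2) (by norm_num)
  norm_num [mul_add] at this
  exact this

/-- A substitute for the change of variables formula: bounds up to a constant need only a bound for
the measure of images of subsets, which every Lipschitz map satisfies. -/
theorem lintegral_image_le {X Y : Type*} [MeasurableSpace X] [MeasurableSpace Y] {μ : Measure X}
    {ν : Measure Y} {F : X → Y} {s : Set X} (hs : MeasurableSet s)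
    (hF : AEMeasurable F (μ.restrict s)) {c : ℝ≥0∞}
    (h : ∀ A ⊆ s, ν (F '' A) ≤ c * μ A) {f : Y → ℝ≥0∞} (hf : Measurable f) :
    ∫⁻ y in F '' s, f y ∂ν ≤ c * ∫⁻ x in s, f (F x) ∂μ := by
  have hle : ν.restrict (F '' s) ≤ c • (μ.restrict s).map F := by
    refine Measure.le_iff.2 fun B hB => ?_
    rw [Measure.restrict_apply hB, Measure.smul_apply, smul_eq_mul,
      Measure.map_apply_of_aemeasurable hF hB, Measure.restrict_apply' hs]
    have : B ∩ F '' s = F '' (F ⁻¹' B ∩ s) := by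
      rw [inter_comm, ← image_inter_preimage, inter_comm]
    rw [this]
    exact h _ inter_subset_right
  calc ∫⁻ y in F '' s, f y ∂ν ≤ ∫⁻ y, f y ∂(c • (μ.restrict s).map F) := lintegral_mono' hle le_rfl
    _ = c * ∫⁻ x in s, f (F x) ∂μ := by
      rw [lintegral_smul_measure, lintegral_map' hf.aemeasurable hF, smul_eq_mul]

theorem lintegral_comp_le {X Y : Type*} [MeasurableSpace X] [MeasurableSpace Y] {μ : Measure X}
    {ν : Measure Y} {F : X → Y} {s : Set X} (hs : MeasurableSet s)
    (hF : AEMeasurable F (μ.restrict s)) {c : ℝ≥0∞}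
    (h : ∀ A ⊆ s, μ A ≤ c * ν (F '' A)) {f : Y → ℝ≥0∞} (hf : Measurable f) :
    ∫⁻ x in s, f (F x) ∂μ ≤ c * ∫⁻ y in F '' s, f y ∂ν := by
  have hle : (μ.restrict s).map F ≤ c • ν.restrict (F '' s) := by
    refine Measure.le_iff.2 fun B hB => ?_
    rw [Measure.smul_apply, smul_eq_mul, Measure.map_apply_of_aemeasurable hF hB,
      Measure.restrict_apply' hs, Measure.restrict_apply hB]
    have : B ∩ F '' s = F '' (F ⁻¹' B ∩ s) := by
      rw [inter_comm, ← image_inter_preimage, inter_comm]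
    rw [this]
    exact h _ inter_subset_right
  calc ∫⁻ x in s, f (F x) ∂μ = ∫⁻ y, f y ∂(μ.restrict s).map F := by
        rw [lintegral_map' hf.aemeasurable hF]
    _ ≤ ∫⁻ y, f y ∂(c • ν.restrict (F '' s)) := lintegral_mono' hle le_rfl
    _ = c * ∫⁻ y in F '' s, f y ∂ν := by rw [lintegral_smul_measure, smul_eq_mul]

theorem euclideanHausdorffMeasure_image_le {X Y : Type*} [MetricSpace X] [MeasurableSpace X]
    [BorelSpace X] [MetricSpace Y] [MeasurableSpace Y] [BorelSpace Y] {K : ℝ≥0} {F : X → Y}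
    {s : Set X} (h : LipschitzOnWith K F s) (k : ℕ) :
    Measure.euclideanHausdorffMeasure k (F '' s)
      ≤ (K : ℝ≥0∞) ^ k * Measure.euclideanHausdorffMeasure k s := by
  rw [Measure.euclideanHausdorffMeasure_def, Measure.euclideanHausdorffMeasure_def,
    Measure.smul_apply, Measure.smul_apply, ENNReal.smul_def, ENNReal.smul_def, smul_eq_mul,
    smul_eq_mul, mul_left_comm]
  gcongr
  have := h.hausdorffMeasure_image_le (d := (k : ℝ)) (Nat.cast_nonneg k)
  rwa [ENNReal.rpow_natCast] at this

theorem euclideanHausdorffMeasure_le_image {X Y : Type*} [MetricSpace X] [MeasurableSpace X]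
    [BorelSpace X] [MetricSpace Y] [MeasurableSpace Y] [BorelSpace Y] {K : ℝ≥0} {F : X → Y}
    {s : Set X} (h : ∀ x ∈ s, ∀ y ∈ s, dist x y ≤ K * dist (F x) (F y)) (k : ℕ) :
    Measure.euclideanHausdorffMeasure k s
      ≤ (K : ℝ≥0∞) ^ k * Measure.euclideanHausdorffMeasure k (F '' s) := by
  rcases s.eq_empty_or_nonempty with rfl | ⟨x₀, -⟩
  · simp
  have : Nonempty X := ⟨x₀⟩
  have hinj : InjOn F s := fun x hx y hy hxy => by
    have := h x hx y hy
    rw [hxy, dist_self, mul_zero] at this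
    exact dist_le_zero.1 this
  have hinv : ∀ x ∈ s, Function.invFunOn F s (F x) = x := fun x hx => hinj.leftInvOn_invFunOn hx
  have hl : LipschitzOnWith K (Function.invFunOn F s) (F '' s) := by
    refine LipschitzOnWith.of_dist_le_mul ?_
    rintro _ ⟨x, hx, rfl⟩ _ ⟨y, hy, rfl⟩
    rw [hinv x hx, hinv y hy]
    exact h x hx y hy
  have := euclideanHausdorffMeasure_image_le hl k
  rwa [image_image, image_congr hinv, image_id'] at this

/-! ### One-dimensional estimates -/

/-- The fundamental theorem of calculus and the Cauchy–Schwarz inequality. The trace and Poincaré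
inequalities both reduce to this estimate on lines. -/
theorem enorm_sq_le_of_contDiff {g : ℝ → ℝ} (hg : ContDiff ℝ 1 g) {A B a b : ℝ}
    (ha : a ∈ Icc A B) (hb : b ∈ Icc A B) :
    ‖g b‖ₑ ^ 2 ≤ 2 * ‖g a‖ₑ ^ 2
      + 2 * (ENNReal.ofReal (B - A) * ∫⁻ t in Ioo A B, ‖deriv g t‖ₑ ^ 2) := by
  have hdc : Continuous (deriv g) := hg.continuous_deriv le_rfl
  have h1 : ‖g b - g a‖ₑ ≤ ∫⁻ t in Ioo A B, ‖deriv g t‖ₑ := by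
    have hftc : ∫ t in a..b, deriv g t = g b - g a :=
      intervalIntegral.integral_deriv_eq_sub
        (fun x _ => (hg.differentiable (by norm_num)).differentiableAt)
        (hdc.intervalIntegrable _ _)
    have h2 : ‖∫ t in a..b, deriv g t‖ₑ = ‖∫ t in uIoc a b, deriv g t‖ₑ := by
      rw [← ofReal_norm, ← ofReal_norm, intervalIntegral.norm_intervalIntegral_eq]
    rw [← hftc, h2]
    refine (enorm_integral_le_lintegral_enorm _).trans ?_
    rw [restrict_Ioo_eq_restrict_Ioc]
    refine lintegral_mono_set ?_
    exact Ioc_subset_Ioc (le_min ha.1 hb.1) (max_le ha.2 hb.2)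
  calc ‖g b‖ₑ ^ 2 = ‖g a + (g b - g a)‖ₑ ^ 2 := by congr 2; ring
    _ ≤ (‖g a‖ₑ + ‖g b - g a‖ₑ) ^ 2 := by gcongr; exact enorm_add_le _ _
    _ ≤ 2 * ‖g a‖ₑ ^ 2 + 2 * ‖g b - g a‖ₑ ^ 2 := ennreal_add_sq_le _ _
    _ ≤ _ := by
      gcongr
      refine (pow_le_pow_left₀ (zero_le) h1 2).trans ?_
      refine (sq_lintegral_le (by fun_prop)).trans_eq ?_
      simp

theorem enorm_sq_line_le {F : Type*} [NormedAddCommGroup F] [NormedSpace ℝ F] {φ : F → ℝ}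
    (hφ : ContDiff ℝ 1 φ) (x v : F) {A B a b : ℝ} (ha : a ∈ Icc A B) (hb : b ∈ Icc A B) :
    ‖φ (x + b • v)‖ₑ ^ 2 ≤ 2 * ‖φ (x + a • v)‖ₑ ^ 2 + 2 * (ENNReal.ofReal (B - A) *
      (‖v‖ₑ ^ 2 * ∫⁻ t in Ioo A B, ‖fderiv ℝ φ (x + t • v)‖ₑ ^ 2)) := by
  have hg : ContDiff ℝ 1 (fun t : ℝ => φ (x + t • v)) := by fun_prop
  refine (enorm_sq_le_of_contDiff hg ha hb).trans ?_
  have hd : ∀ t, deriv (fun t : ℝ => φ (x + t • v)) t = fderiv ℝ φ (x + t • v) v := by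
    intro t
    have h1 : HasDerivAt (fun t : ℝ => x + t • v) v t := by
      simpa using ((hasDerivAt_id t).smul_const v).const_add x
    exact ((hφ.differentiable (by norm_num)).differentiableAt.hasFDerivAt.comp_hasDerivAt t h1).deriv
  have hc : Continuous fun t : ℝ => fderiv ℝ φ (x + t • v) :=
    (hφ.continuous_fderiv (by norm_num)).comp (by fun_prop)
  have hm : Measurable fun t : ℝ => ‖fderiv ℝ φ (x + t • v)‖ₑ ^ 2 :=
    ((ENNReal.continuous_pow 2).comp hc.enorm).measurable
  rw [← lintegral_const_mul (‖v‖ₑ ^ 2) hm]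
  gcongr with t
  rw [hd, ← mul_pow, mul_comm]
  gcongr
  exact (fderiv ℝ φ (x + t • v)).le_opENorm v

/-! ### Charts and integrals -/

namespace BoundaryChart

variable {m : ℕ} {D : Set (E (m + 1))} {p : E (m + 1)} (c : BoundaryChart D p)

/-- The graph map of the chart. -/
def graph (z : E m) : E (m + 1) := c.Φ (z, 0)

/-- The base of the chart. -/
def base : Set (E m) := Metric.ball c.z₀ c.ρ

/-- The chart neighbourhood. -/
def nbhd : Set (E (m + 1)) := c.Φ '' (c.base ×ˢ Ioo (-c.δ) c.δ)

/-- The upper half of the chart neighbourhood. -/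
def upper : Set (E (m + 1)) := c.Φ '' (c.base ×ˢ Ioo 0 c.δ)

theorem continuous_graph : Continuous c.graph := by
  unfold graph; fun_prop

theorem isOpen_nbhd : IsOpen c.nbhd :=
  c.Φ.isOpen_image.2 (Metric.isOpen_ball.prod isOpen_Ioo)

theorem isOpen_upper : IsOpen c.upper :=
  c.Φ.isOpen_image.2 (Metric.isOpen_ball.prod isOpen_Ioo)

theorem mem_nbhd : p ∈ c.nbhd := by
  refine ⟨(c.z₀, 0), ⟨Metric.mem_ball_self c.ρ_pos, ?_⟩, c.apply_base⟩
  simp [c.δ_pos]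

theorem upper_subset : c.upper ⊆ D := by
  rintro _ ⟨⟨z, s⟩, ⟨hz, hs⟩, rfl⟩
  exact (c.mem_iff z hz s ⟨by linarith [hs.1, c.δ_pos], hs.2⟩).2 hs.1

theorem upper_nonempty : c.upper.Nonempty :=
  ⟨_, ⟨(c.z₀, c.δ / 2), ⟨Metric.mem_ball_self c.ρ_pos, by
    have := c.δ_pos
    exact ⟨by positivity, by dsimp only; linarith⟩⟩, rfl⟩⟩

theorem frontier_inter_nbhd (hD : IsOpen D) : frontier D ∩ c.nbhd = c.graph '' c.base := by
  apply Subset.antisymm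
  · rintro x ⟨hx, ⟨⟨z, s⟩, ⟨hz, hs⟩, rfl⟩⟩
    rw [hD.frontier_eq] at hx
    have h1 : ¬ 0 < s := fun h => hx.2 ((c.mem_iff z hz s hs).2 h)
    have h2 : ¬ s < 0 := by
      intro h
      have hopen : IsOpen (c.Φ '' (c.base ×ˢ Ioo (-c.δ) 0)) :=
        c.Φ.isOpen_image.2 (Metric.isOpen_ball.prod isOpen_Ioo)
      obtain ⟨y, ⟨⟨z', s'⟩, ⟨hz', hs'⟩, rfl⟩, hy⟩ :=
        mem_closure_iff.1 hx.1 _ hopen ⟨(z, s), ⟨hz, hs.1, h⟩, rfl⟩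
      have := (c.mem_iff z' hz' s' ⟨hs'.1, hs'.2.trans c.δ_pos⟩).1 hy
      exact absurd this hs'.2.not_gt
    have h0 : s = 0 := le_antisymm (not_lt.1 h1) (not_lt.1 h2)
    subst h0
    exact ⟨z, hz, rfl⟩
  · rintro _ ⟨z, hz, rfl⟩
    have h0 : (0 : ℝ) ∈ Ioo (-c.δ) c.δ := by simp [c.δ_pos]
    refine ⟨?_, ⟨(z, 0), ⟨hz, h0⟩, rfl⟩⟩
    rw [hD.frontier_eq]
    refine ⟨?_, fun h => lt_irrefl _ ((c.mem_iff z hz 0 h0).1 h)⟩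
    have hcont : Tendsto (fun s : ℝ => c.Φ (z, s)) (𝓝[>] 0) (𝓝 (c.graph z)) := by
      have : Continuous fun s : ℝ => c.Φ (z, s) := by fun_prop
      exact (this.tendsto 0).mono_left nhdsWithin_le_nhds
    refine mem_closure_of_tendsto hcont ?_
    filter_upwards [Ioo_mem_nhdsGT c.δ_pos] with s hs
    exact (c.mem_iff z hz s ⟨by linarith [hs.1, c.δ_pos], hs.2⟩).2 hs.1

theorem lintegral_upper {f : E (m + 1) → ℝ≥0∞} (hf : Measurable f) :
    ∫⁻ x in c.upper, f x = ∫⁻ z in c.base, ∫⁻ s in Ioo 0 c.δ, f (c.graph z + s • c.n) := by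
  have hmeas : Measurable fun q : E m × ℝ => f (c.Φ q) := hf.comp c.Φ.continuous.measurable
  rw [upper, ← c.measurePreserving.setLIntegral_comp_emb c.Φ.measurableEmbedding, Measure.volume_eq_prod,
    ← Measure.prod_restrict, lintegral_prod _ hmeas.aemeasurable]
  have h : ∀ z s, c.Φ (z, s) = c.graph z + s • c.n := c.apply_eq
  simp only [h]

theorem lintegral_graph_le {f : E (m + 1) → ℝ≥0∞} (hf : Measurable f) :
    ∫⁻ x in c.graph '' c.base, f x ∂(Measure.euclideanHausdorffMeasure m)
      ≤ (c.Λ : ℝ≥0∞) ^ m * ∫⁻ z in c.base, f (c.graph z) := by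
  refine lintegral_image_le Metric.isOpen_ball.measurableSet c.continuous_graph.aemeasurable
    (fun A hA => ?_) hf
  have := euclideanHausdorffMeasure_image_le (c.lipschitz.mono hA) m
  rwa [EuclideanSpace.euclideanHausdorffMeasure_eq_volume] at this

theorem lintegral_le_graph {f : E (m + 1) → ℝ≥0∞} (hf : Measurable f) :
    ∫⁻ z in c.base, f (c.graph z) ≤
      ∫⁻ x in c.graph '' c.base, f x ∂(Measure.euclideanHausdorffMeasure m) := by
  rw [← one_mul (∫⁻ x in c.graph '' c.base, f x ∂(Measure.euclideanHausdorffMeasure m))]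
  refine lintegral_comp_le Metric.isOpen_ball.measurableSet c.continuous_graph.aemeasurable
    (fun A hA => ?_) hf
  have := euclideanHausdorffMeasure_le_image (K := 1) (F := c.graph) (s := A)
    (fun x _ y _ => c.antilipschitz.le_mul_dist x y) m
  rwa [EuclideanSpace.euclideanHausdorffMeasure_eq_volume, ENNReal.coe_one, one_pow] at this

/-- On each vertical fibre the value at height `0` is compared with the value at height `s`, and the
result is integrated over `s ∈ (0, δ)`. This integration produces the factor `δ` on the left. -/
theorem lintegral_graph_le_upper {φ : E (m + 1) → ℝ} (hφ : ContDiff ℝ 1 φ) :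
    ENNReal.ofReal c.δ * ∫⁻ z in c.base, ‖φ (c.graph z)‖ₑ ^ 2
      ≤ 2 * (∫⁻ x in c.upper, ‖φ x‖ₑ ^ 2)
        + 2 * (ENNReal.ofReal c.δ ^ 2 * ∫⁻ x in c.upper, ‖fderiv ℝ φ x‖ₑ ^ 2) := by
  have hφm := hφ.continuous.measurable
  have hdm := (hφ.continuous_fderiv (by norm_num)).measurable
  have hgm := c.continuous_graph.measurable
  rw [c.lintegral_upper (by fun_prop), c.lintegral_upper (by fun_prop),
    ← lintegral_const_mul' _ _ (by finiteness), ← lintegral_const_mul' _ _ (by finiteness),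
    ← lintegral_const_mul' _ _ (by finiteness), ← lintegral_const_mul' _ _ (by finiteness),
    ← lintegral_add_left ((Measurable.lintegral_prod_right'
      (f := fun q : E m × ℝ => ‖φ (c.graph q.1 + q.2 • c.n)‖ₑ ^ 2) (by fun_prop)).const_mul _)]
  refine lintegral_mono fun z => ?_
  have h1 : ENNReal.ofReal c.δ * ‖φ (c.graph z)‖ₑ ^ 2
      = ∫⁻ _ in Ioo 0 c.δ, ‖φ (c.graph z)‖ₑ ^ 2 := by
    rw [setLIntegral_const, Real.volume_Ioo, sub_zero, mul_comm]
  rw [h1]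
  have h2 : ∀ s ∈ Ioo 0 c.δ, ‖φ (c.graph z)‖ₑ ^ 2 ≤ 2 * ‖φ (c.graph z + s • c.n)‖ₑ ^ 2
      + 2 * (ENNReal.ofReal c.δ *
        ∫⁻ t in Ioo 0 c.δ, ‖fderiv ℝ φ (c.graph z + t • c.n)‖ₑ ^ 2) := by
    intro s hs
    have h3 := enorm_sq_line_le hφ (c.graph z) c.n (A := 0) (B := c.δ) (a := s) (b := 0)
      ⟨hs.1.le, hs.2.le⟩ ⟨le_rfl, c.δ_pos.le⟩
    have hn1 : ‖c.n‖ₑ = 1 := by rw [← ofReal_norm, c.norm_n]; simp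
    rw [zero_smul, add_zero, sub_zero, hn1, one_pow, one_mul] at h3
    exact h3
  refine (setLIntegral_mono (by fun_prop) h2).trans_eq ?_
  rw [lintegral_add_left (by fun_prop), lintegral_const_mul _ (by fun_prop), setLIntegral_const,
    Real.volume_Ioo, sub_zero]
  ring

theorem lintegral_upper_le {φ : E (m + 1) → ℝ} (hφ : ContDiff ℝ 1 φ) :
    ∫⁻ x in c.upper, ‖φ x‖ₑ ^ 2
      ≤ 2 * (ENNReal.ofReal c.δ * ∫⁻ z in c.base, ‖φ (c.graph z)‖ₑ ^ 2)
        + 2 * (ENNReal.ofReal c.δ ^ 2 * ∫⁻ x in c.upper, ‖fderiv ℝ φ x‖ₑ ^ 2) := by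
  have hφm := hφ.continuous.measurable
  have hdm := (hφ.continuous_fderiv (by norm_num)).measurable
  have hgm := c.continuous_graph.measurable
  rw [c.lintegral_upper (by fun_prop), c.lintegral_upper (by fun_prop),
    ← lintegral_const_mul' _ _ (by finiteness), ← lintegral_const_mul' _ _ (by finiteness),
    ← lintegral_const_mul' _ _ (by finiteness), ← lintegral_const_mul' _ _ (by finiteness),
    ← lintegral_add_left (by fun_prop)]
  refine lintegral_mono fun z => ?_
  have h2 : ∀ s ∈ Ioo 0 c.δ, ‖φ (c.graph z + s • c.n)‖ₑ ^ 2 ≤ 2 * ‖φ (c.graph z)‖ₑ ^ 2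
      + 2 * (ENNReal.ofReal c.δ *
        ∫⁻ t in Ioo 0 c.δ, ‖fderiv ℝ φ (c.graph z + t • c.n)‖ₑ ^ 2) := by
    intro s hs
    have h3 := enorm_sq_line_le hφ (c.graph z) c.n (A := 0) (B := c.δ) (a := 0) (b := s)
      ⟨le_rfl, c.δ_pos.le⟩ ⟨hs.1.le, hs.2.le⟩
    have hn1 : ‖c.n‖ₑ = 1 := by rw [← ofReal_norm, c.norm_n]; simp
    rw [zero_smul, add_zero, sub_zero, hn1, one_pow, one_mul] at h3
    exact h3
  refine (setLIntegral_mono (by fun_prop) h2).trans_eq ?_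
  rw [setLIntegral_const, Real.volume_Ioo, sub_zero]
  ring

/-- A chart can be shrunk into any neighbourhood. -/
theorem exists_shrink (c : BoundaryChart D p) {r : ℝ} (hr : 0 < r) :
    ∃ c' : BoundaryChart D p, c'.nbhd ⊆ Metric.ball p r := by
  have hnb : c.Φ ⁻¹' (Metric.ball p r) ∈ 𝓝 (c.z₀, (0 : ℝ)) :=
    c.Φ.continuous.continuousAt.preimage_mem_nhds (by
      rw [c.apply_base]; exact Metric.isOpen_ball.mem_nhds (Metric.mem_ball_self hr))
  obtain ⟨t, ht, hb⟩ := Metric.mem_nhds_iff.1 hnb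
  refine ⟨{ c with
    ρ := min c.ρ t
    δ := min c.δ t
    ρ_pos := lt_min c.ρ_pos ht
    δ_pos := lt_min c.δ_pos ht
    lipschitz := c.lipschitz.mono (Metric.ball_subset_ball (min_le_left _ _))
    mem_iff := fun z hz s hs => c.mem_iff z (Metric.ball_subset_ball (min_le_left _ _) hz) s
      ⟨by linarith [hs.1, min_le_left c.δ t], hs.2.trans_le (min_le_left _ _)⟩ }, ?_⟩
  rintro _ ⟨⟨z, s⟩, ⟨hz, hs⟩, rfl⟩
  refine hb ?_
  have h1 : dist z c.z₀ < min c.ρ t := hz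
  have h2 : s ∈ Ioo (-min c.δ t) (min c.δ t) := hs
  rw [Metric.mem_ball, Prod.dist_eq, max_lt_iff]
  refine ⟨h1.trans_le (min_le_right _ _), ?_⟩
  rw [Real.dist_eq, sub_zero, abs_lt]
  exact ⟨by linarith [h2.1, min_le_right c.δ t], h2.2.trans_le (min_le_right _ _)⟩

end BoundaryChart

/-! ### Trace and Poincaré inequalities for smooth functions -/

/-- The estimate holds near each boundary point by a chart, and the constants add up over a finite
cover of the compact boundary. -/
theorem exists_trace_inequality {m : ℕ} {D : Set (E (m + 1))} (hD : IsC3Domain D) :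
    ∃ C : ℝ≥0, ∀ φ : E (m + 1) → ℝ, ContDiff ℝ 1 φ →
      ∫⁻ x, ‖φ x‖ₑ ^ 2 ∂(surfaceMeasure (frontier D))
        ≤ C * ((∫⁻ x in D, ‖φ x‖ₑ ^ 2) + ∫⁻ x in D, ‖fderiv ℝ φ x‖ₑ ^ 2) := by
  have hcomp : IsCompact (frontier D) :=
    hD.isBounded.isCompact_closure.of_isClosed_subset isClosed_frontier frontier_subset_closure
  -- The repeated intersection lets the compactness induction vary the second factor only.
  suffices H : ∃ C : ℝ≥0, ∀ φ : E (m + 1) → ℝ, ContDiff ℝ 1 φ →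
      ∫⁻ x in frontier D ∩ frontier D, ‖φ x‖ₑ ^ 2 ∂(Measure.euclideanHausdorffMeasure m)
        ≤ C * ((∫⁻ x in D, ‖φ x‖ₑ ^ 2) + ∫⁻ x in D, ‖fderiv ℝ φ x‖ₑ ^ 2) by
    simpa [surfaceMeasure] using H
  refine hcomp.induction_on (p := fun K => ∃ C : ℝ≥0, ∀ φ : E (m + 1) → ℝ, ContDiff ℝ 1 φ →
      ∫⁻ x in frontier D ∩ K, ‖φ x‖ₑ ^ 2 ∂(Measure.euclideanHausdorffMeasure m)
        ≤ C * ((∫⁻ x in D, ‖φ x‖ₑ ^ 2) + ∫⁻ x in D, ‖fderiv ℝ φ x‖ₑ ^ 2)) ?_ ?_ ?_ ?_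
  · exact ⟨0, fun φ _ => by simp⟩
  · rintro s t hst ⟨C, hC⟩
    exact ⟨C, fun φ hφ => (lintegral_mono_set (inter_subset_inter_right _ hst)).trans (hC φ hφ)⟩
  · rintro s t ⟨C, hC⟩ ⟨C', hC'⟩
    refine ⟨C + C', fun φ hφ => ?_⟩
    rw [inter_union_distrib_left, ENNReal.coe_add, add_mul]
    exact (lintegral_union_le _ _ _).trans (add_le_add (hC φ hφ) (hC' φ hφ))
  · intro p hp
    obtain ⟨c⟩ := hD.exists_boundaryChart hp
    have hδ : 0 < ENNReal.ofReal c.δ := ENNReal.ofReal_pos.2 c.δ_pos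
    let B : ℝ≥0 := 2 * c.Λ ^ m * (Real.toNNReal c.δ)⁻¹ + 2 * c.Λ ^ m * Real.toNNReal c.δ
    refine ⟨c.nbhd, mem_nhdsWithin_of_mem_nhds (c.isOpen_nbhd.mem_nhds c.mem_nbhd), B,
      fun φ hφ => ?_⟩
    have hφm := hφ.continuous.measurable
    rw [c.frontier_inter_nbhd hD.isOpen]
    refine (c.lintegral_graph_le (f := fun x => ‖φ x‖ₑ ^ 2) (by fun_prop)).trans ?_
    have h1 := c.lintegral_graph_le_upper hφ
    have hX : ∫⁻ x in c.upper, ‖φ x‖ₑ ^ 2 ≤ ∫⁻ x in D, ‖φ x‖ₑ ^ 2 :=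
      lintegral_mono_set c.upper_subset
    have hY : ∫⁻ x in c.upper, ‖fderiv ℝ φ x‖ₑ ^ 2 ≤ ∫⁻ x in D, ‖fderiv ℝ φ x‖ₑ ^ 2 :=
      lintegral_mono_set c.upper_subset
    generalize (∫⁻ x in D, ‖φ x‖ₑ ^ 2) = X at *
    generalize (∫⁻ x in D, ‖fderiv ℝ φ x‖ₑ ^ 2) = Y at *
    have h2 : ∫⁻ z in c.base, ‖φ (c.graph z)‖ₑ ^ 2
        ≤ (ENNReal.ofReal c.δ)⁻¹ * (2 * X + 2 * (ENNReal.ofReal c.δ ^ 2 * Y)) := by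
      rw [← ENNReal.mul_le_iff_le_inv hδ.ne' ENNReal.ofReal_ne_top]
      refine h1.trans ?_
      gcongr
    have hδc : ENNReal.ofReal c.δ = (Real.toNNReal c.δ : ℝ≥0∞) := rfl
    have hδ0 : Real.toNNReal c.δ ≠ 0 := (Real.toNNReal_pos.2 c.δ_pos).ne'
    refine (mul_le_mul_right h2 _).trans ?_
    rw [hδc, ← ENNReal.coe_inv hδ0]
    have e : ((Real.toNNReal c.δ)⁻¹ : ℝ≥0) * (Real.toNNReal c.δ) ^ 2 = Real.toNNReal c.δ := by
      field_simp
    calc (c.Λ : ℝ≥0∞) ^ m * (((Real.toNNReal c.δ)⁻¹ : ℝ≥0)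
            * (2 * X + 2 * ((Real.toNNReal c.δ : ℝ≥0∞) ^ 2 * Y)))
        = ((2 * c.Λ ^ m * (Real.toNNReal c.δ)⁻¹ : ℝ≥0) : ℝ≥0∞) * X
          + ((2 * c.Λ ^ m * ((Real.toNNReal c.δ)⁻¹ * (Real.toNNReal c.δ) ^ 2) : ℝ≥0) : ℝ≥0∞)
            * Y := by push_cast; ring
      _ ≤ (B : ℝ≥0∞) * X + (B : ℝ≥0∞) * Y := by
        rw [e]
        gcongr
        · exact le_self_add
        · exact le_add_self
      _ = _ := by ring

/-- This is the trace inequality for the constant function `1`. -/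
theorem surfaceMeasure_frontier_lt_top {m : ℕ} {D : Set (E (m + 1))} (hD : IsC3Domain D) :
    surfaceMeasure (frontier D) univ < ⊤ := by
  obtain ⟨C, hC⟩ := exists_trace_inequality hD
  have h := hC (fun _ => 1) contDiff_const
  simp only [enorm_one, one_pow, lintegral_const, one_mul, fderiv_fun_const] at h
  refine h.trans_lt ?_
  have hv : volume D < ⊤ := hD.isBounded.measure_lt_top
  simp [ENNReal.mul_lt_top_iff, hv]

/-- The graph map does not decrease distances, so the surface has at least the measure of the base
of a chart that is shrunk into the ball. -/
theorem surfaceMeasure_pos {m : ℕ} {D : Set (E (m + 1))} (hD : IsC3Domain D) {p : E (m + 1)}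
    (hp : p ∈ frontier D) {r : ℝ} (hr : 0 < r) :
    0 < surfaceMeasure (frontier D) (Metric.ball p r) := by
  obtain ⟨c₀⟩ := hD.exists_boundaryChart hp
  obtain ⟨c, hc⟩ := c₀.exists_shrink hr
  have h1 := c.lintegral_le_graph (f := fun _ => 1) measurable_const
  simp only [lintegral_const, one_mul, Measure.restrict_apply_univ] at h1
  rw [surfaceMeasure, Measure.restrict_apply Metric.isOpen_ball.measurableSet]
  refine lt_of_lt_of_le (Metric.measure_ball_pos volume c.z₀ c.ρ_pos) (h1.trans ?_)
  rw [← c.frontier_inter_nbhd hD.isOpen, Nat.add_sub_cancel, inter_comm]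
  exact measure_mono (inter_subset_inter_left _ hc)

/-- Integrates along the segments from `x` to `x + v`; by Tonelli and translation invariance each
`t` contributes at most the integral of the gradient over `D`. -/
theorem lintegral_translate_le {d : ℕ} {D A : Set (E d)} {v : E d}
    (h : ∀ x ∈ A, ∀ t ∈ Ioo (0 : ℝ) 1, x + t • v ∈ D) {φ : E d → ℝ} (hφ : ContDiff ℝ 1 φ) :
    ∫⁻ x in A, ‖φ x‖ₑ ^ 2 ≤ 2 * (∫⁻ x in (fun y => y + v) '' A, ‖φ x‖ₑ ^ 2)
      + 2 * (‖v‖ₑ ^ 2 * ∫⁻ x in D, ‖fderiv ℝ φ x‖ₑ ^ 2) := by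
  have hφm := hφ.continuous.measurable
  have hdm := (hφ.continuous_fderiv (by norm_num)).measurable
  have hmp := measurePreserving_add_right (volume : Measure (E d)) v
  rw [← hmp.setLIntegral_comp_emb (measurableEmbedding_addRight v)]
  have h1 : ∀ x, ‖φ x‖ₑ ^ 2 ≤ 2 * ‖φ (x + v)‖ₑ ^ 2
      + 2 * (‖v‖ₑ ^ 2 * ∫⁻ t in Ioo (0 : ℝ) 1, ‖fderiv ℝ φ (x + t • v)‖ₑ ^ 2) := by
    intro x
    have := enorm_sq_line_le hφ x v (A := 0) (B := 1) (a := 1) (b := 0) (by simp) (by simp)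
    simpa using this
  refine (lintegral_mono h1).trans ?_
  have hmeas : Measurable fun q : E d × ℝ => ‖fderiv ℝ φ (q.1 + q.2 • v)‖ₑ ^ 2 := by fun_prop
  rw [lintegral_add_left (by fun_prop), lintegral_const_mul _ (by fun_prop),
    lintegral_const_mul' _ _ (by finiteness), lintegral_const_mul' _ _ (by finiteness)]
  refine add_le_add le_rfl (mul_le_mul' le_rfl (mul_le_mul' le_rfl ?_))
  rw [lintegral_lintegral_swap hmeas.aemeasurable]
  calc ∫⁻ t in Ioo (0 : ℝ) 1, ∫⁻ x in A, ‖fderiv ℝ φ (x + t • v)‖ₑ ^ 2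
      ≤ ∫⁻ _ in Ioo (0 : ℝ) 1, ∫⁻ x in D, ‖fderiv ℝ φ x‖ₑ ^ 2 := by
        refine setLIntegral_mono measurable_const fun t ht => ?_
        have hmp' := measurePreserving_add_right (volume : Measure (E d)) (t • v)
        rw [hmp'.setLIntegral_comp_emb (measurableEmbedding_addRight (t • v))
          (fun x => ‖fderiv ℝ φ x‖ₑ ^ 2)]
        refine lintegral_mono_set ?_
        rintro _ ⟨x, hx, rfl⟩
        exact h x hx t ht
    _ = _ := by simp

/-- The Poincaré inequality for functions that are controlled on a piece of the boundary. -/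
theorem exists_poincare {m : ℕ} {D : Set (E (m + 1))} (hD : IsC3Domain D) {p : E (m + 1)}
    (hp : p ∈ frontier D) {r : ℝ} (hr : 0 < r) :
    ∃ C : ℝ≥0, ∀ φ : E (m + 1) → ℝ, ContDiff ℝ 1 φ →
      ∫⁻ x in D, ‖φ x‖ₑ ^ 2 ≤ C * ((∫⁻ x in D, ‖fderiv ℝ φ x‖ₑ ^ 2)
        + ∫⁻ x in Metric.ball p r, ‖φ x‖ₑ ^ 2 ∂(surfaceMeasure (frontier D))) := by
  let Q : (E (m + 1) → ℝ) → ℝ≥0∞ := fun φ => (∫⁻ x in D, ‖fderiv ℝ φ x‖ₑ ^ 2)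
        + ∫⁻ x in Metric.ball p r, ‖φ x‖ₑ ^ 2 ∂(surfaceMeasure (frontier D))
  -- A point is good if the `L²` norm near it is controlled by `Q`. Goodness propagates along
  -- translations: from a boundary chart into `D`, through `D` by connectedness, and to the closure
  -- along the interior cones. Compactness then gives a single constant.
  let good : E (m + 1) → Prop := fun x => ∃ t : ℝ, 0 < t ∧ ∃ C : ℝ≥0,
    ∀ φ : E (m + 1) → ℝ, ContDiff ℝ 1 φ → ∫⁻ y in D ∩ Metric.ball x t, ‖φ y‖ₑ ^ 2 ≤ C * Q φ
  have hgood_open : ∀ x, good x → ∃ t > 0, ∀ y ∈ Metric.ball x t, good y := by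
    rintro x ⟨t, ht, C, hC⟩
    refine ⟨t, ht, fun y hy => ⟨t - dist y x, by simpa using hy, C, fun φ hφ => ?_⟩⟩
    refine (lintegral_mono_set (inter_subset_inter_right _ ?_)).trans (hC φ hφ)
    exact Metric.ball_subset_ball' (by linarith)
  have htrans : ∀ x v, good (x + v) → (∃ s > 0, ∀ y ∈ D ∩ Metric.ball x s,
      ∀ t ∈ Ioc (0 : ℝ) 1, y + t • v ∈ D) → good x := by
    rintro x v ⟨t, ht, C, hC⟩ ⟨s, hs, h⟩
    refine ⟨min s t, lt_min hs ht, 2 * C + 2 * ‖v‖₊ ^ 2, fun φ hφ => ?_⟩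
    refine (lintegral_translate_le (D := D) (v := v) (fun y hy τ hτ => h y ⟨hy.1,
        Metric.ball_subset_ball (min_le_left _ _) hy.2⟩ τ ⟨hτ.1, hτ.2.le⟩) hφ).trans ?_
    have h1 : (fun y => y + v) '' (D ∩ Metric.ball x (min s t)) ⊆ D ∩ Metric.ball (x + v) t := by
      rintro _ ⟨y, hy, rfl⟩
      have h0 := h y ⟨hy.1, Metric.ball_subset_ball (min_le_left _ _) hy.2⟩ 1 (by simp)
      rw [one_smul] at h0
      refine ⟨h0, ?_⟩
      have : dist y x < t := Metric.ball_subset_ball (min_le_right _ _) hy.2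
      simpa using this
    have h2 := (lintegral_mono_set (μ := volume) (f := fun y => ‖φ y‖ₑ ^ 2) h1).trans (hC φ hφ)
    have h3 : ∫⁻ x in D, ‖fderiv ℝ φ x‖ₑ ^ 2 ≤ Q φ := le_self_add
    calc _ ≤ 2 * (C * Q φ) + 2 * (‖v‖ₑ ^ 2 * Q φ) := by gcongr
      _ = _ := by
        rw [enorm_eq_nnnorm]; push_cast; ring
  have hgood_interior : ∀ x ∈ D, good x := by
    have hopenG : IsOpen {x | good x} := by
      rw [Metric.isOpen_iff]
      intro x hx
      obtain ⟨t, ht, h⟩ := hgood_open x hx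
      exact ⟨t, ht, h⟩
    -- A good point close to `x` would make `x` good, since the short segments between them stay in
    -- a ball contained in `D`.
    have hopenN : IsOpen (D ∩ {x | ¬ good x}) := by
      rw [Metric.isOpen_iff]
      rintro x ⟨hxD, hx⟩
      obtain ⟨R, hR, hb⟩ := Metric.isOpen_iff.1 hD.isOpen x hxD
      refine ⟨R / 2, by positivity, fun y hy => ⟨hb (Metric.ball_subset_ball (by linarith) hy),
        fun hg => hx ?_⟩⟩
      refine htrans x (y - x) (by simpa using hg) ⟨R / 2, by positivity, fun z hz t ht => hb ?_⟩
      have h1 : ‖z - x‖ < R / 2 := by rw [← dist_eq_norm]; exact hz.2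
      have h2 : ‖y - x‖ < R / 2 := by rw [← dist_eq_norm]; exact hy
      rw [Metric.mem_ball, dist_eq_norm]
      calc ‖z + t • (y - x) - x‖ = ‖(z - x) + t • (y - x)‖ := by congr 1; abel
        _ ≤ ‖z - x‖ + ‖t • (y - x)‖ := norm_add_le _ _
        _ < R := by
          rw [norm_smul, Real.norm_of_nonneg ht.1.le]
          nlinarith [norm_nonneg (y - x), ht.2]
    -- Points above the controlled piece of the boundary are good: integrating up from the graph
    -- bounds `φ` by its boundary values and its gradient.
    have hne : (D ∩ {x | good x}).Nonempty := by
      obtain ⟨c₀⟩ := hD.exists_boundaryChart hp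
      obtain ⟨c, hc⟩ := c₀.exists_shrink hr
      obtain ⟨x, hx⟩ := c.upper_nonempty
      obtain ⟨t, ht, hb⟩ := Metric.isOpen_iff.1 c.isOpen_upper x hx
      refine ⟨x, c.upper_subset hx, t, ht,
        2 * Real.toNNReal c.δ + 2 * Real.toNNReal c.δ ^ 2, fun φ hφ => ?_⟩
      have hφm := hφ.continuous.measurable
      refine (lintegral_mono_set (inter_subset_right.trans hb)).trans
        ((c.lintegral_upper_le hφ).trans ?_)
      have h1 := c.lintegral_le_graph (f := fun x => ‖φ x‖ₑ ^ 2) (by fun_prop)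
      have h2 : ∫⁻ x in c.graph '' c.base, ‖φ x‖ₑ ^ 2 ∂(Measure.euclideanHausdorffMeasure m)
          ≤ Q φ := by
        refine le_trans ?_ (le_add_self (a := ∫⁻ x in Metric.ball p r, ‖φ x‖ₑ ^ 2
          ∂(surfaceMeasure (frontier D))))
        rw [surfaceMeasure, Measure.restrict_restrict Metric.isOpen_ball.measurableSet,
          ← c.frontier_inter_nbhd hD.isOpen, Nat.add_sub_cancel, inter_comm]
        exact lintegral_mono_set (inter_subset_inter_left _ hc)
      have h3 : ∫⁻ x in c.upper, ‖fderiv ℝ φ x‖ₑ ^ 2 ≤ Q φ :=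
        (lintegral_mono_set c.upper_subset).trans le_self_add
      have h4 := h1.trans h2
      calc _ ≤ 2 * (ENNReal.ofReal c.δ * Q φ) + 2 * (ENNReal.ofReal c.δ ^ 2 * Q φ) := by
            gcongr
        _ = _ := by
          have hδc : ENNReal.ofReal c.δ = (Real.toNNReal c.δ : ℝ≥0∞) := rfl
          rw [hδc]; push_cast; ring
    have := hD.isConnected.isPreconnected.subset_left_of_subset_union hopenG hopenN
      (disjoint_left.2 fun x hx hx' => hx'.2 hx)
      (fun x hx => (em (good x)).imp id fun h => ⟨hx, h⟩) hne
    exact this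
  have hgood : ∀ x ∈ closure D, good x := by
    intro x hx
    obtain ⟨n, s, ε, hs, hε, h⟩ := hD.exists_cone hx
    have hcone : ∀ y ∈ closure D ∩ Metric.ball x s, ∀ t ∈ Ioc (0 : ℝ) 1,
        y + t • ((s / 2) • n) ∈ D := by
      intro y hy t ht
      rw [smul_smul]
      have h1 : 0 < t * (s / 2) := mul_pos ht.1 (by positivity)
      exact h y hy _ h1 (by nlinarith [ht.2]) n (by simpa using hε)
    refine htrans x ((s / 2) • n) (hgood_interior _ ?_) ⟨s, hs, fun y hy =>
      hcone y ⟨subset_closure hy.1, hy.2⟩⟩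
    simpa using hcone x ⟨hx, Metric.mem_ball_self hs⟩ 1 (by simp)
  have hfin : ∃ C : ℝ≥0, ∀ φ : E (m + 1) → ℝ, ContDiff ℝ 1 φ →
      ∫⁻ x in D ∩ closure D, ‖φ x‖ₑ ^ 2 ≤ C * Q φ := by
    refine hD.isBounded.isCompact_closure.induction_on (p := fun K => ∃ C : ℝ≥0,
      ∀ φ : E (m + 1) → ℝ, ContDiff ℝ 1 φ → ∫⁻ x in D ∩ K, ‖φ x‖ₑ ^ 2 ≤ C * Q φ) ?_ ?_ ?_ ?_
    · exact ⟨0, fun φ _ => by simp⟩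
    · rintro s t hst ⟨C, hC⟩
      exact ⟨C, fun φ hφ => (lintegral_mono_set (inter_subset_inter_right _ hst)).trans (hC φ hφ)⟩
    · rintro s t ⟨C, hC⟩ ⟨C', hC'⟩
      refine ⟨C + C', fun φ hφ => ?_⟩
      rw [inter_union_distrib_left, ENNReal.coe_add, add_mul]
      exact (lintegral_union_le _ _ _).trans (add_le_add (hC φ hφ) (hC' φ hφ))
    · intro x hx
      obtain ⟨t, ht, C, hC⟩ := hgood x hx
      exact ⟨Metric.ball x t, mem_nhdsWithin_of_mem_nhds (Metric.ball_mem_nhds x ht), C, hC⟩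
  rwa [inter_eq_left.2 subset_closure] at hfin

/-! ### Calculus of weak derivatives -/


/-- The classical partial derivative. -/
def pd (i : Fin d) (φ : E d → ℝ) (x : E d) : ℝ := fderiv ℝ φ x (EuclideanSpace.single i 1)

theorem contDiff_pd {φ : E d → ℝ} (hφ : ContDiff ℝ ∞ φ) (i : Fin d) : ContDiff ℝ ∞ (pd i φ) :=
  (hφ.fderiv_right (m := ∞) (by norm_num)).clm_apply contDiff_const

theorem norm_le_sum_apply_single {F : Type*} [NormedAddCommGroup F] [NormedSpace ℝ F]
    (T : E d →L[ℝ] F) : ‖T‖ ≤ ∑ i, ‖T (EuclideanSpace.single i 1)‖ := by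
  refine T.opNorm_le_bound (Finset.sum_nonneg fun i _ => norm_nonneg _) fun x => ?_
  have hx : x = ∑ i, x i • EuclideanSpace.single i (1 : ℝ) := by
    have := (EuclideanSpace.basisFun (Fin d) ℝ).sum_repr x
    simp only [EuclideanSpace.basisFun_repr, EuclideanSpace.basisFun_apply] at this
    exact this.symm
  calc ‖T x‖ = ‖∑ i, x i • T (EuclideanSpace.single i 1)‖ := by
        conv_lhs => rw [hx]
        simp
    _ ≤ ∑ i, ‖x i • T (EuclideanSpace.single i 1)‖ := norm_sum_le _ _
    _ ≤ ∑ i, ‖T (EuclideanSpace.single i 1)‖ * ‖x‖ := by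
        refine Finset.sum_le_sum fun i _ => ?_
        rw [norm_smul, mul_comm]
        gcongr
        exact PiLp.norm_apply_le x i
    _ = _ := by rw [Finset.sum_mul]

theorem eLpNorm_two_sq {α F : Type*} [MeasurableSpace α] [NormedAddCommGroup F] (μ : Measure α)
    (f : α → F) : eLpNorm f 2 μ ^ 2 = ∫⁻ x, ‖f x‖ₑ ^ 2 ∂μ := by
  have := eLpNorm_nnreal_pow_eq_lintegral (μ := μ) (f := f) (p := 2) (by norm_num)
  simpa using this

theorem eLpNorm_le_sum {α F : Type*} [MeasurableSpace α] [NormedAddCommGroup F] {μ : Measure α}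
    {ι : Type*} [Fintype ι] {f : α → F} {g : ι → α → ℝ}
    (hg : ∀ i, AEStronglyMeasurable (g i) μ) (h : ∀ x, ‖f x‖ ≤ ∑ i, ‖g i x‖) :
    eLpNorm f 2 μ ≤ ∑ i, eLpNorm (g i) 2 μ := by
  calc eLpNorm f 2 μ ≤ eLpNorm (∑ i, fun x => ‖g i x‖) 2 μ :=
        eLpNorm_mono fun x => by
          rw [Finset.sum_apply]
          exact (h x).trans (le_abs_self _)
    _ ≤ ∑ i, eLpNorm (fun x => ‖g i x‖) 2 μ :=
        eLpNorm_sum_le (fun i _ => (hg i).norm) (by norm_num)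
    _ = _ := by simp only [eLpNorm_norm]

theorem LocallyIntegrableOn.integrableOn_mul_test {Ω : Set (E d)} {u ψ : E d → ℝ}
    (hu : LocallyIntegrableOn u Ω volume) (hψ : Continuous ψ) (hc : HasCompactSupport ψ)
    (hs : tsupport ψ ⊆ Ω) : IntegrableOn (fun x => u x * ψ x) Ω volume := by
  have h1 : IntegrableOn (fun x => u x * ψ x) (tsupport ψ) volume :=
    (hu.integrableOn_compact_subset hs hc).mul_continuousOn hψ.continuousOn hc
  have h2 : Function.support (fun x => u x * ψ x) ⊆ tsupport ψ := fun x hx =>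
    subset_tsupport ψ fun h => hx (by simp only [h, mul_zero])
  exact ((integrableOn_iff_integrable_of_support_subset h2).1 h1).integrableOn

/-- The fundamental lemma of the calculus of variations. It makes the arbitrary choice in
`weakPartial` harmless under integrals and norms. -/
theorem HasWeakPartial.ae_eq {Ω : Set (E d)} (hΩ : IsOpen Ω) {i : Fin d} {u g g' : E d → ℝ}
    (h : HasWeakPartial Ω i u g) (h' : HasWeakPartial Ω i u g') :
    g =ᵐ[volume.restrict Ω] g' := by
  have key := hΩ.ae_eq_zero_of_integral_contDiff_smul_eq_zero (μ := volume) (h.2.1.sub h'.2.1)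
    (fun ψ hψ hc hs => by
      have e1 := h.2.2 ψ hψ hc hs
      have e2 := h'.2.2 ψ hψ hc hs
      have e3 : ∫ x in Ω, g x * ψ x = ∫ x in Ω, g' x * ψ x := by linarith
      rw [← setIntegral_eq_integral_of_forall_compl_eq_zero (s := Ω)]
      · have : ∀ x, ψ x • (g - g') x = g x * ψ x - g' x * ψ x := fun x => by
          simp only [Pi.sub_apply, smul_eq_mul]; ring
        simp only [this]
        rw [integral_sub (LocallyIntegrableOn.integrableOn_mul_test h.2.1 hψ.continuous hc hs)
          (LocallyIntegrableOn.integrableOn_mul_test h'.2.1 hψ.continuous hc hs), e3, sub_self]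
      · intro x hx
        rw [image_eq_zero_of_notMem_tsupport fun h => hx (hs h), zero_smul])
  rw [Filter.EventuallyEq, ae_restrict_iff' hΩ.measurableSet]
  filter_upwards [key] with x hx hxΩ
  exact sub_eq_zero.1 (hx hxΩ)

theorem HasWeakPartial.weakPartial {Ω : Set (E d)} {i : Fin d} {u g : E d → ℝ}
    (h : HasWeakPartial Ω i u g) : HasWeakPartial Ω i u (weakPartial Ω i u) := by
  have hex : ∃ g, HasWeakPartial Ω i u g := ⟨g, h⟩
  rw [RobinFE.weakPartial, dif_pos hex]
  exact hex.choose_spec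

theorem HasWeakPartial.weakPartial_ae_eq {Ω : Set (E d)} (hΩ : IsOpen Ω) {i : Fin d}
    {u g : E d → ℝ} (h : HasWeakPartial Ω i u g) :
    RobinFE.weakPartial Ω i u =ᵐ[volume.restrict Ω] g :=
  h.weakPartial.ae_eq hΩ h

theorem HasWeakPartial.sub {Ω : Set (E d)} {i : Fin d} {u v g k : E d → ℝ}
    (h : HasWeakPartial Ω i u g) (h' : HasWeakPartial Ω i v k) :
    HasWeakPartial Ω i (fun x => u x - v x) (fun x => g x - k x) := by
  refine ⟨h.1.sub h'.1, h.2.1.sub h'.2.1, fun ψ hψ hc hs => ?_⟩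
  have hpc : Continuous fun x => fderiv ℝ ψ x (EuclideanSpace.single i 1) :=
    (contDiff_pd hψ i).continuous
  have hpcs := hc.fderiv_apply ℝ (EuclideanSpace.single i (1 : ℝ))
  have hps := (tsupport_fderiv_apply_subset ℝ (f := ψ) (EuclideanSpace.single i (1 : ℝ))).trans hs
  simp only [_root_.sub_mul]
  rw [integral_sub (LocallyIntegrableOn.integrableOn_mul_test h.1 hpc hpcs hps)
      (LocallyIntegrableOn.integrableOn_mul_test h'.1 hpc hpcs hps),
    integral_sub (LocallyIntegrableOn.integrableOn_mul_test h.2.1 hψ.continuous hc hs)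
      (LocallyIntegrableOn.integrableOn_mul_test h'.2.1 hψ.continuous hc hs),
    h.2.2 ψ hψ hc hs, h'.2.2 ψ hψ hc hs]
  ring

theorem hasWeakPartial_of_contDiff (Ω : Set (E d)) (i : Fin d) {φ : E d → ℝ}
    (hφ : ContDiff ℝ ∞ φ) : HasWeakPartial Ω i φ (pd i φ) := by
  have hpc := (contDiff_pd hφ i).continuous
  refine ⟨hφ.continuous.locallyIntegrable.locallyIntegrableOn _,
    hpc.locallyIntegrable.locallyIntegrableOn _, fun ψ hψ hc hs => ?_⟩
  have hψc : Continuous fun x => fderiv ℝ ψ x (EuclideanSpace.single i 1) :=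
    (contDiff_pd hψ i).continuous
  have hpcs := hc.fderiv_apply ℝ (EuclideanSpace.single i (1 : ℝ))
  rw [setIntegral_eq_integral_of_forall_compl_eq_zero,
    setIntegral_eq_integral_of_forall_compl_eq_zero]
  · refine integral_mul_fderiv_eq_neg_fderiv_mul_of_integrable ?_ ?_ ?_
      (fun x _ => (hφ.differentiable (by norm_num)).differentiableAt)
      (fun x _ => (hψ.differentiable (by norm_num)).differentiableAt)
    · exact (hpc.mul hψ.continuous).integrable_of_hasCompactSupport hc.mul_left
    · exact (hφ.continuous.mul hψc).integrable_of_hasCompactSupport hpcs.mul_left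
    · exact (hφ.continuous.mul hψ.continuous).integrable_of_hasCompactSupport hc.mul_left
  · intro x hx
    rw [image_eq_zero_of_notMem_tsupport fun h => hx (hs h), mul_zero]
  · intro x hx
    have : x ∉ tsupport fun x => fderiv ℝ ψ x (EuclideanSpace.single i (1 : ℝ)) := fun h =>
      hx (hs (tsupport_fderiv_apply_subset ℝ _ h))
    rw [image_eq_zero_of_notMem_tsupport
      (f := fun x => fderiv ℝ ψ x (EuclideanSpace.single i (1 : ℝ))) this, mul_zero]

/-! ### The space `H¹` -/

theorem MemH1.memLp_weakPartial {Ω : Set (E d)} (hΩ : IsOpen Ω) {u : E d → ℝ} (hu : MemH1 Ω u)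
    (i : Fin d) : MemLp (weakPartial Ω i u) 2 (volume.restrict Ω) := by
  obtain ⟨g, hg, hg2⟩ := hu.2 i
  exact (memLp_congr_ae (hg.weakPartial_ae_eq hΩ)).2 hg2

theorem MemH1.hasWeakPartial {Ω : Set (E d)} {u : E d → ℝ} (hu : MemH1 Ω u) (i : Fin d) :
    HasWeakPartial Ω i u (weakPartial Ω i u) := by
  obtain ⟨g, hg, -⟩ := hu.2 i
  exact hg.weakPartial

theorem MemH1.sub {Ω : Set (E d)} (hΩ : IsOpen Ω) {u v : E d → ℝ} (hu : MemH1 Ω u)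
    (hv : MemH1 Ω v) : MemH1 Ω (fun x => u x - v x) :=
  ⟨hu.1.sub hv.1, fun i => ⟨_, (hu.hasWeakPartial i).sub (hv.hasWeakPartial i),
    (hu.memLp_weakPartial hΩ i).sub (hv.memLp_weakPartial hΩ i)⟩⟩

theorem MemH1.weakPartial_sub {Ω : Set (E d)} (hΩ : IsOpen Ω) {u v : E d → ℝ} (hu : MemH1 Ω u)
    (hv : MemH1 Ω v) (i : Fin d) : weakPartial Ω i (fun x => u x - v x) =ᵐ[volume.restrict Ω]
      fun x => weakPartial Ω i u x - weakPartial Ω i v x :=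
  ((hu.hasWeakPartial i).sub (hv.hasWeakPartial i)).weakPartial_ae_eq hΩ

theorem memLp_restrict_of_continuous {Ω : Set (E d)} (hΩ : Bornology.IsBounded Ω) {φ : E d → ℝ}
    (hφ : Continuous φ) : MemLp φ 2 (volume.restrict Ω) := by
  obtain ⟨C, hC⟩ := hΩ.isCompact_closure.exists_bound_of_continuousOn hφ.continuousOn
  have : IsFiniteMeasure (volume.restrict (closure Ω)) :=
    ⟨by simpa using hΩ.isCompact_closure.measure_lt_top⟩
  have h1 : MemLp φ 2 (volume.restrict (closure Ω)) :=
    MemLp.of_bound hφ.aestronglyMeasurable C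
      ((ae_restrict_iff' isClosed_closure.measurableSet).2 (ae_of_all _ hC))
  exact h1.mono_measure (Measure.restrict_mono subset_closure le_rfl)

theorem memH1_of_contDiff {Ω : Set (E d)} (hΩ : Bornology.IsBounded Ω) {φ : E d → ℝ}
    (hφ : ContDiff ℝ ∞ φ) : MemH1 Ω φ :=
  ⟨memLp_restrict_of_continuous hΩ hφ.continuous, fun i => ⟨_, hasWeakPartial_of_contDiff Ω i hφ,
    memLp_restrict_of_continuous hΩ (contDiff_pd hφ i).continuous⟩⟩

/-- The sum of the `L²` norms of the weak partial derivatives. -/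
def gradNorm (Ω : Set (E d)) (u : E d → ℝ) : ℝ≥0∞ :=
  ∑ i, eLpNorm (weakPartial Ω i u) 2 (volume.restrict Ω)

theorem sum_sq_le_sq_sum {ι : Type*} (s : Finset ι) (f : ι → ℝ≥0∞) :
    ∑ i ∈ s, f i ^ 2 ≤ (∑ i ∈ s, f i) ^ 2 := by
  rw [sq (∑ i ∈ s, f i), Finset.sum_mul]
  refine Finset.sum_le_sum fun i hi => ?_
  rw [sq]
  gcongr
  exact Finset.single_le_sum (fun _ _ => zero_le) hi

theorem h1Norm_le {Ω : Set (E d)} {u : E d → ℝ} (hu : MemH1 Ω u) :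
    h1Norm Ω u ≤ eLpNorm u 2 (volume.restrict Ω) + gradNorm Ω u := by
  rw [h1Norm, if_pos hu]
  have h1 : eLpNorm u 2 (volume.restrict Ω) ^ 2
      + ∑ i, eLpNorm (weakPartial Ω i u) 2 (volume.restrict Ω) ^ 2
      ≤ (eLpNorm u 2 (volume.restrict Ω) + gradNorm Ω u) ^ 2 := by
    calc _ ≤ eLpNorm u 2 (volume.restrict Ω) ^ 2 + gradNorm Ω u ^ 2 := by
          gcongr
          exact sum_sq_le_sq_sum _ _
      _ ≤ _ := by
          rw [add_sq]
          exact add_le_add_left le_self_add _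
  calc _ ≤ ((eLpNorm u 2 (volume.restrict Ω) + gradNorm Ω u) ^ 2) ^ (1 / 2 : ℝ) := by gcongr
    _ = _ := by
      rw [← ENNReal.rpow_natCast, ← ENNReal.rpow_mul]; norm_num

theorem le_rpow_half_of_sq_le {a b : ℝ≥0∞} (h : a ^ 2 ≤ b) : a ≤ b ^ (1 / 2 : ℝ) := by
  calc a = (a ^ 2) ^ (1 / 2 : ℝ) := by
        rw [← ENNReal.rpow_natCast, ← ENNReal.rpow_mul]; norm_num
    _ ≤ _ := by gcongr

theorem eLpNorm_le_h1Norm (Ω : Set (E d)) (u : E d → ℝ) :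
    eLpNorm u 2 (volume.restrict Ω) ≤ h1Norm Ω u := by
  rw [h1Norm]
  split_ifs with hu
  · exact le_rpow_half_of_sq_le le_self_add
  · exact le_top

theorem eLpNorm_weakPartial_le_h1Norm (Ω : Set (E d)) (u : E d → ℝ) (i : Fin d) :
    eLpNorm (weakPartial Ω i u) 2 (volume.restrict Ω) ≤ h1Norm Ω u := by
  rw [h1Norm]
  split_ifs with hu
  · refine le_rpow_half_of_sq_le (le_trans ?_ le_add_self)
    exact Finset.single_le_sum (f := fun i => eLpNorm (weakPartial Ω i u) 2 (volume.restrict Ω) ^ 2)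
      (fun _ _ => zero_le) (Finset.mem_univ i)
  · exact le_top

theorem eLpNorm_fderiv_le {μ : Measure (E d)} {φ : E d → ℝ} (hφ : ContDiff ℝ ∞ φ) :
    eLpNorm (fderiv ℝ φ) 2 μ ≤ ∑ i, eLpNorm (pd i φ) 2 μ :=
  eLpNorm_le_sum (fun i => (contDiff_pd hφ i).continuous.aestronglyMeasurable)
    (fun x => norm_le_sum_apply_single (fderiv ℝ φ x))

/-- A square estimate gives an estimate of the norms. -/
theorem le_mul_add_of_sq_le {a b c : ℝ≥0∞} {C : ℝ≥0} (h : a ^ 2 ≤ C * (b ^ 2 + c ^ 2)) :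
    a ≤ (C + 1 : ℝ≥0) * (b + c) := by
  rw [← ENNReal.pow_le_pow_left_iff two_ne_zero]
  refine h.trans ?_
  rw [mul_pow]
  gcongr
  · calc (C : ℝ≥0∞) ≤ ((C + 1 : ℝ≥0) : ℝ≥0∞) := by exact_mod_cast le_self_add
      _ ≤ ((C + 1 : ℝ≥0) : ℝ≥0∞) ^ 2 :=
        le_self_pow₀ (by exact_mod_cast le_add_self) two_ne_zero
  · rw [add_sq]
    exact add_le_add_left le_self_add _

/-! ### Traces -/


theorem gradNorm_le_h1Norm (Ω : Set (E d)) (u : E d → ℝ) : gradNorm Ω u ≤ d * h1Norm Ω u := by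
  calc gradNorm Ω u ≤ ∑ _i : Fin d, h1Norm Ω u :=
        Finset.sum_le_sum fun i _ => eLpNorm_weakPartial_le_h1Norm Ω u i
    _ = _ := by simp

theorem gradNorm_sub_le {Ω : Set (E d)} (hΩ : IsOpen Ω) {u v : E d → ℝ} (hu : MemH1 Ω u)
    (hv : MemH1 Ω v) : gradNorm Ω (fun x => u x - v x) ≤ gradNorm Ω u + gradNorm Ω v := by
  rw [gradNorm, gradNorm, gradNorm, ← Finset.sum_add_distrib]
  refine Finset.sum_le_sum fun i _ => ?_
  rw [eLpNorm_congr_ae (hu.weakPartial_sub hΩ hv i)]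
  exact eLpNorm_sub_le (hu.memLp_weakPartial hΩ i).1 (hv.memLp_weakPartial hΩ i).1 (by norm_num)

theorem h1Norm_sub_le {Ω : Set (E d)} (hΩ : IsOpen Ω) {u v : E d → ℝ} (hu : MemH1 Ω u)
    (hv : MemH1 Ω v) :
    h1Norm Ω (fun x => u x - v x) ≤ (d + 1) * (h1Norm Ω u + h1Norm Ω v) := by
  refine (h1Norm_le (hu.sub hΩ hv)).trans ?_
  have h1 := eLpNorm_sub_le hu.1.1 hv.1.1 (p := 2) (by norm_num)
  have h2 := gradNorm_sub_le hΩ hu hv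
  have h3 := eLpNorm_le_h1Norm Ω u
  have h4 := eLpNorm_le_h1Norm Ω v
  have h5 := gradNorm_le_h1Norm Ω u
  have h6 := gradNorm_le_h1Norm Ω v
  calc _ ≤ (h1Norm Ω u + h1Norm Ω v) + (d * h1Norm Ω u + d * h1Norm Ω v) :=
        add_le_add (h1.trans (add_le_add h3 h4)) (h2.trans (add_le_add h5 h6))
    _ = _ := by ring

theorem exists_trace_inequality_eLpNorm {m : ℕ} {D : Set (E (m + 1))} (hD : IsC3Domain D) :
    ∃ C : ℝ≥0, ∀ φ : E (m + 1) → ℝ, ContDiff ℝ ∞ φ →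
      eLpNorm φ 2 (surfaceMeasure (frontier D)) ≤ C * (eLpNorm φ 2 (volume.restrict D)
        + ∑ i, eLpNorm (pd i φ) 2 (volume.restrict D)) := by
  obtain ⟨C, hC⟩ := exists_trace_inequality hD
  refine ⟨C + 1, fun φ hφ => ?_⟩
  have h := hC φ (hφ.of_le (by norm_cast))
  simp only [← eLpNorm_two_sq] at h
  refine (le_mul_add_of_sq_le h).trans ?_
  gcongr
  exact eLpNorm_fderiv_le hφ

theorem IsTrace.exists_approx {Ω : Set (E d)} (hΩ : IsOpen Ω) (hb : Bornology.IsBounded Ω)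
    {u t : E d → ℝ} (hu : MemH1 Ω u) (h : IsTrace Ω u t) :
    ∃ φ : ℕ → E d → ℝ, (∀ n, ContDiff ℝ ∞ (φ n)) ∧
      Tendsto (fun n => eLpNorm (fun x => u x - φ n x) 2 (volume.restrict Ω)) atTop (𝓝 0) ∧
      (∀ i, Tendsto (fun n => eLpNorm (fun x => weakPartial Ω i u x - pd i (φ n) x) 2
        (volume.restrict Ω)) atTop (𝓝 0)) ∧
      Tendsto (fun n => eLpNorm (fun x => t x - φ n x) 2 (surfaceMeasure (frontier Ω)))
        atTop (𝓝 0) := by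
  obtain ⟨-, φ, hφ, h1, h2⟩ := h
  refine ⟨φ, hφ, ?_, fun i => ?_, h2⟩
  · exact tendsto_of_tendsto_of_tendsto_of_le_of_le tendsto_const_nhds h1 (fun _ => zero_le)
      fun n => eLpNorm_le_h1Norm Ω _
  · refine tendsto_of_tendsto_of_tendsto_of_le_of_le tendsto_const_nhds h1 (fun _ => zero_le)
      fun n => ?_
    refine le_trans (le_of_eq ?_) (eLpNorm_weakPartial_le_h1Norm Ω _ i)
    have hn := memH1_of_contDiff hb (hφ n)
    refine (eLpNorm_congr_ae (((hu.hasWeakPartial i).sub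
      (hasWeakPartial_of_contDiff Ω i (hφ n))).weakPartial_ae_eq hΩ)).symm

theorem eLpNorm_le_of_sub {α : Type*} [MeasurableSpace α] {μ : Measure α} {f g : α → ℝ}
    (hf : AEStronglyMeasurable f μ) (hg : AEStronglyMeasurable g μ) :
    eLpNorm g 2 μ ≤ eLpNorm f 2 μ + eLpNorm (fun x => f x - g x) 2 μ := by
  have h := eLpNorm_sub_le hf (hf.sub hg) (p := 2) (by norm_num)
  have e : f - (f - g) = g := by abel
  rwa [e] at h

/-- Estimates for smooth functions carry over to limits. -/
theorem IsTrace.eLpNorm_le {m : ℕ} {D : Set (E (m + 1))} (hD : IsC3Domain D) {C : ℝ≥0}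
    (hC : ∀ φ : E (m + 1) → ℝ, ContDiff ℝ ∞ φ →
      eLpNorm φ 2 (surfaceMeasure (frontier D)) ≤ C * (eLpNorm φ 2 (volume.restrict D)
        + ∑ i, eLpNorm (pd i φ) 2 (volume.restrict D)))
    {u t : E (m + 1) → ℝ} (hu : MemH1 D u) (h : IsTrace D u t) :
    eLpNorm t 2 (surfaceMeasure (frontier D))
      ≤ C * (eLpNorm u 2 (volume.restrict D) + gradNorm D u) := by
  obtain ⟨φ, hφ, h1, h2, h3⟩ := h.exists_approx hD.isOpen hD.isBounded hu
  have hlim : Tendsto (fun n => eLpNorm (fun x => t x - φ n x) 2 (surfaceMeasure (frontier D))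
      + C * ((eLpNorm u 2 (volume.restrict D)
          + eLpNorm (fun x => u x - φ n x) 2 (volume.restrict D))
        + ∑ i, (eLpNorm (weakPartial D i u) 2 (volume.restrict D)
          + eLpNorm (fun x => weakPartial D i u x - pd i (φ n) x) 2 (volume.restrict D))))
      atTop (𝓝 (0 + C * ((eLpNorm u 2 (volume.restrict D) + 0)
        + ∑ i, (eLpNorm (weakPartial D i u) 2 (volume.restrict D) + 0)))) :=
    h3.add (ENNReal.Tendsto.const_mul ((tendsto_const_nhds.add h1).add
      (tendsto_finsetSum _ fun i _ => tendsto_const_nhds.add (h2 i)))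
      (Or.inr ENNReal.coe_ne_top))
  simp only [add_zero, zero_add] at hlim
  refine ge_of_tendsto' hlim fun n => ?_
  have hc := (hφ n).continuous
  have e1 : eLpNorm t 2 (surfaceMeasure (frontier D)) ≤
      eLpNorm (φ n) 2 (surfaceMeasure (frontier D))
        + eLpNorm (fun x => t x - φ n x) 2 (surfaceMeasure (frontier D)) := by
    have e := eLpNorm_sub_comm t (φ n) 2 (surfaceMeasure (frontier D))
    have := eLpNorm_le_of_sub (f := φ n) (g := t) hc.aestronglyMeasurable h.1.1
    change _ ≤ _ + eLpNorm (φ n - t) 2 _ at this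
    rwa [← e] at this
  refine e1.trans ?_
  rw [add_comm]
  gcongr
  refine (hC _ (hφ n)).trans ?_
  gcongr with i
  · exact eLpNorm_le_of_sub hu.1.1 hc.aestronglyMeasurable
  · exact eLpNorm_le_of_sub (hu.memLp_weakPartial hD.isOpen i).1
      (contDiff_pd (hφ n) i).continuous.aestronglyMeasurable

theorem IsTrace.sub {Ω : Set (E d)} (hΩ : IsOpen Ω) (hb : Bornology.IsBounded Ω)
    {u v t s : E d → ℝ} (hu : MemH1 Ω u) (hv : MemH1 Ω v) (h : IsTrace Ω u t)
    (h' : IsTrace Ω v s) : IsTrace Ω (fun x => u x - v x) (fun x => t x - s x) := by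
  obtain ⟨ht, φ, hφ, h1, h2⟩ := h
  obtain ⟨hs, ψ, hψ, h1', h2'⟩ := h'
  refine ⟨ht.sub hs, fun n x => φ n x - ψ n x, fun n => (hφ n).sub (hψ n), ?_, ?_⟩
  · have hlim : Tendsto (fun n => ((d : ℝ≥0∞) + 1) * (h1Norm Ω (fun x => u x - φ n x)
        + h1Norm Ω (fun x => v x - ψ n x))) atTop (𝓝 ((d + 1) * (0 + 0))) :=
      ENNReal.Tendsto.const_mul (h1.add h1') (Or.inr (by finiteness))
    rw [add_zero, mul_zero] at hlim
    refine tendsto_of_tendsto_of_tendsto_of_le_of_le tendsto_const_nhds hlim (fun _ => zero_le)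
      fun n => ?_
    have := h1Norm_sub_le hΩ (hu.sub hΩ (memH1_of_contDiff hb (hφ n)))
      (hv.sub hΩ (memH1_of_contDiff hb (hψ n)))
    refine le_trans (le_of_eq ?_) this
    congr 1; ext x; ring
  · have hlim := h2.add h2'
    rw [add_zero] at hlim
    refine tendsto_of_tendsto_of_tendsto_of_le_of_le tendsto_const_nhds hlim (fun _ => zero_le)
      fun n => ?_
    refine le_trans (le_of_eq ?_) (eLpNorm_sub_le
      (ht.1.sub (hφ n).continuous.aestronglyMeasurable)
      (hs.1.sub (hψ n).continuous.aestronglyMeasurable) (by norm_num))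
    congr 1; ext x; simp only [Pi.sub_apply]; ring

/-- The difference of two traces of `u` is a trace of `u - u`, so the trace inequality bounds it by
`0`. -/
theorem IsTrace.ae_eq {m : ℕ} {D : Set (E (m + 1))} (hD : IsC3Domain D)
    {u t s : E (m + 1) → ℝ} (hu : MemH1 D u) (h : IsTrace D u t) (h' : IsTrace D u s) :
    t =ᵐ[surfaceMeasure (frontier D)] s := by
  obtain ⟨C, hC⟩ := exists_trace_inequality_eLpNorm hD
  have h0 := (h.sub hD.isOpen hD.isBounded hu hu h').eLpNorm_le hD hC (hu.sub hD.isOpen hu)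
  have hg : gradNorm D (fun x => u x - u x) = 0 := by
    refine Finset.sum_eq_zero fun i _ => ?_
    rw [eLpNorm_congr_ae (hu.weakPartial_sub hD.isOpen hu i)]
    simp
  have hz : eLpNorm (fun x => u x - u x) 2 (volume.restrict D) = 0 := by
    simp only [sub_self]
    exact eLpNorm_zero
  rw [hg, hz, add_zero, mul_zero, nonpos_iff_eq_zero] at h0
  change eLpNorm (t - s) 2 _ = 0 at h0
  rw [eLpNorm_eq_zero_iff (h.1.1.sub h'.1.1) (by norm_num)] at h0
  filter_upwards [h0] with x hx
  exact sub_eq_zero.1 hx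

theorem IsTrace.isTrace_trace {Ω : Set (E d)} {u t : E d → ℝ} (h : IsTrace Ω u t) :
    IsTrace Ω u (trace Ω u) := by
  have hex : ∃ t, IsTrace Ω u t := ⟨t, h⟩
  rw [trace, dif_pos hex]
  exact hex.choose_spec

theorem MemH1Diamond.isTrace_trace {Ω Γ₀ : Set (E d)} {u : E d → ℝ} (h : MemH1Diamond Ω Γ₀ u) :
    IsTrace Ω u (trace Ω u) := by
  obtain ⟨-, t, ht, -⟩ := h
  exact ht.isTrace_trace

theorem MemH1Diamond.sub {Ω Γ₀ : Set (E d)} (hΩ : IsOpen Ω) (hb : Bornology.IsBounded Ω)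
    {u v : E d → ℝ} (hu : MemH1Diamond Ω Γ₀ u) (hv : MemH1Diamond Ω Γ₀ v) :
    MemH1Diamond Ω Γ₀ (fun x => u x - v x) := by
  obtain ⟨hu1, t, ht, ht0⟩ := hu
  obtain ⟨hv1, s, hs, hs0⟩ := hv
  refine ⟨hu1.sub hΩ hv1, _, ht.sub hΩ hb hu1 hv1 hs, ?_⟩
  filter_upwards [ht0, hs0] with x hx hx'
  rw [hx, hx']; simp

theorem MemH1Diamond.trace_sub {m : ℕ} {D Γ₀ : Set (E (m + 1))} (hD : IsC3Domain D)
    {u v : E (m + 1) → ℝ} (hu : MemH1Diamond D Γ₀ u) (hv : MemH1Diamond D Γ₀ v) :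
    trace D (fun x => u x - v x) =ᵐ[surfaceMeasure (frontier D)]
      fun x => trace D u x - trace D v x :=
  (hu.sub hD.isOpen hD.isBounded hv).isTrace_trace.ae_eq hD (hu.1.sub hD.isOpen hv.1)
    (hu.isTrace_trace.sub hD.isOpen hD.isBounded hu.1 hv.1 hv.isTrace_trace)

/-- The Poincaré inequality on `H¹_⋄`. -/
theorem exists_poincare_memH1Diamond {m : ℕ} {D Γ₀ : Set (E (m + 1))} (hD : IsC3Domain D)
    {p : E (m + 1)} (hp : p ∈ frontier D) {r : ℝ} (hr : 0 < r)
    (hΓ₀ : frontier D ∩ Metric.ball p r ⊆ Γ₀) :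
    ∃ C : ℝ≥0, ∀ u, MemH1Diamond D Γ₀ u → eLpNorm u 2 (volume.restrict D) ≤ C * gradNorm D u := by
  obtain ⟨C, hC⟩ := exists_poincare hD hp hr
  refine ⟨C + 1, fun u hu => ?_⟩
  obtain ⟨hu1, t, ht, ht0⟩ := hu
  obtain ⟨φ, hφ, h1, h2, h3⟩ := ht.exists_approx hD.isOpen hD.isBounded hu1
  -- On the ball the trace vanishes, so there `φ n` has the same norm as `t - φ n`, which tends to
  -- `0`.
  have ht0' : t =ᵐ[(surfaceMeasure (frontier D)).restrict (Metric.ball p r)] 0 := by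
    refine Filter.EventuallyEq.filter_mono ht0 (ae_mono ?_)
    rw [surfaceMeasure, Measure.restrict_restrict Metric.isOpen_ball.measurableSet, inter_comm]
    exact Measure.restrict_mono hΓ₀ le_rfl
  have hlim : Tendsto (fun n => eLpNorm (fun x => u x - φ n x) 2 (volume.restrict D)
      + ((C + 1 : ℝ≥0) : ℝ≥0∞) * (∑ i, (eLpNorm (weakPartial D i u) 2 (volume.restrict D)
          + eLpNorm (fun x => weakPartial D i u x - pd i (φ n) x) 2 (volume.restrict D))
        + eLpNorm (fun x => t x - φ n x) 2 (surfaceMeasure (frontier D))))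
      atTop (𝓝 (0 + ((C + 1 : ℝ≥0) : ℝ≥0∞) *
        (∑ i, (eLpNorm (weakPartial D i u) 2 (volume.restrict D) + 0) + 0))) :=
    h1.add (ENNReal.Tendsto.const_mul ((tendsto_finsetSum _ fun i _ =>
      tendsto_const_nhds.add (h2 i)).add h3) (Or.inr ENNReal.coe_ne_top))
  simp only [add_zero, zero_add] at hlim
  refine ge_of_tendsto' hlim fun n => ?_
  have hc := (hφ n).continuous
  have e1 : eLpNorm u 2 (volume.restrict D) ≤ eLpNorm (φ n) 2 (volume.restrict D)
        + eLpNorm (fun x => u x - φ n x) 2 (volume.restrict D) := by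
    have e := eLpNorm_sub_comm u (φ n) 2 (volume.restrict D)
    have := eLpNorm_le_of_sub (f := φ n) (g := u) hc.aestronglyMeasurable hu1.1.1
    change _ ≤ _ + eLpNorm (φ n - u) 2 _ at this
    rwa [← e] at this
  refine e1.trans ?_
  rw [add_comm]
  gcongr
  have h := hC (φ n) ((hφ n).of_le (by norm_cast))
  simp only [← eLpNorm_two_sq] at h
  refine (le_mul_add_of_sq_le h).trans ?_
  gcongr
  · refine (eLpNorm_fderiv_le (hφ n)).trans ?_
    gcongr with i
    exact eLpNorm_le_of_sub (hu1.memLp_weakPartial hD.isOpen i).1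
      (contDiff_pd (hφ n) i).continuous.aestronglyMeasurable
  · calc eLpNorm (φ n) 2 ((surfaceMeasure (frontier D)).restrict (Metric.ball p r))
        = eLpNorm (fun x => t x - φ n x) 2
          ((surfaceMeasure (frontier D)).restrict (Metric.ball p r)) := by
          refine eLpNorm_congr_norm_ae ?_
          filter_upwards [ht0'] with x hx
          rw [hx]; simp
      _ ≤ _ := eLpNorm_mono_measure _ Measure.restrict_le_self

/-! ### Mollification -/


theorem tendsto_eLpNorm_translate {f : E d → ℝ} (hf : MemLp f 2 volume) :
    Tendsto (fun z : E d => eLpNorm (fun x => f (x - z) - f x) 2 volume) (𝓝 0) (𝓝 0) := by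
  have : Fact ((2 : ℝ≥0∞) ≠ ⊤) := ⟨by norm_num⟩
  have hcont : Continuous fun z : E d => (DomAddAct.mk (-z)) +ᵥ hf.toLp f :=
    (DomAddAct.continuous_mk.comp continuous_neg).vadd continuous_const
  have h1 := (tendsto_iff_edist_tendsto_0.1 (hcont.tendsto 0))
  refine h1.congr fun z => ?_
  rw [neg_zero, DomAddAct.mk_zero, zero_vadd, DomAddAct.mk_vadd_toLp, Lp.edist_toLp_toLp]
  congr 1
  ext x
  simp only [Pi.sub_apply, vadd_eq_add]
  rw [neg_add_eq_sub]

/-- The convolution of two functions. -/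
def conv (f k : E d → ℝ) (x : E d) : ℝ := ∫ t, f t * k (x - t)

theorem conv_eq (f k : E d → ℝ) :
    conv f k = convolution f k (ContinuousLinearMap.mul ℝ ℝ) volume := by
  ext x; simp [conv, convolution_def]

theorem contDiff_conv {f k : E d → ℝ} (hf : LocallyIntegrable f volume) (hk : ContDiff ℝ ∞ k)
    (hc : HasCompactSupport k) : ContDiff ℝ ∞ (conv f k) := by
  rw [conv_eq]
  exact hc.contDiff_convolution_right (n := ⊤) _ hf hk

theorem integrable_conv {f k : E d → ℝ} (hf : LocallyIntegrable f volume) (hk : Continuous k)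
    (hc : HasCompactSupport k) (x : E d) : Integrable fun t => f t * k (x - t) := by
  have := hc.convolutionExists_right (ContinuousLinearMap.mul ℝ ℝ) hf hk x
  simpa [ConvolutionExistsAt] using this

theorem pd_conv {f k : E d → ℝ} (hf : LocallyIntegrable f volume) (hk : ContDiff ℝ ∞ k)
    (hc : HasCompactSupport k) (i : Fin d) (x : E d) : pd i (conv f k) x = conv f (pd i k) x := by
  have hk1 : ContDiff ℝ 1 k := hk.of_le (by norm_cast)
  rw [conv_eq, pd, (hc.hasFDerivAt_convolution_right (ContinuousLinearMap.mul ℝ ℝ) hf hk1 x).fderiv,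
    convolution_precompR_apply _ hf (hc.fderiv ℝ) (hk1.continuous_fderiv one_ne_zero), conv_eq]
  rfl

theorem conv_sub_eq {f k : E d → ℝ} (hf : LocallyIntegrable f volume) (hk : Continuous k)
    (hc : HasCompactSupport k) (hk1 : ∫ x, k x = 1) (x : E d) (a : ℝ) :
    conv f k x - a = ∫ z, (f (x - z) - a) * k z := by
  have h1 : Integrable fun z => f (x - z) * k z := by
    have := (integrable_conv hf hk hc x).comp_sub_left x
    simpa using this
  have h2 : Integrable fun z => a * k z := (hk.integrable_of_hasCompactSupport hc).const_mul a
  simp only [_root_.sub_mul]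
  rw [integral_sub h1 h2, integral_const_mul, hk1, mul_one, conv,
    ← integral_sub_left_eq_self (fun t => f t * k (x - t)) volume x]
  simp

/-- The error is an average of `f (x - z) - f x` against the probability density `k`. Cauchy–Schwarz
with `k = k^(1/2) k^(1/2)` moves the square inside the average, and Tonelli reduces the bound to
single translations. -/
theorem eLpNorm_conv_sub_le {f k : E d → ℝ} (hfm : Measurable f) (hf : LocallyIntegrable f volume)
    (hk : Continuous k) (hc : HasCompactSupport k) (hk0 : ∀ x, 0 ≤ k x) (hk1 : ∫ x, k x = 1)
    {ε : ℝ≥0∞} (h : ∀ z, k z ≠ 0 → eLpNorm (fun x => f (x - z) - f x) 2 volume ≤ ε) :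
    eLpNorm (fun x => conv f k x - f x) 2 volume ≤ ε := by
  have hkm := hk.measurable
  have hkint : ∫⁻ z, ‖k z‖ₑ = 1 := by
    have := ofReal_integral_eq_lintegral_ofReal (μ := volume) (hk.integrable_of_hasCompactSupport hc)
      (ae_of_all _ hk0)
    rw [hk1, ENNReal.ofReal_one] at this
    rw [this]
    refine lintegral_congr fun z => ?_
    rw [← ofReal_norm, Real.norm_of_nonneg (hk0 z)]
  rw [← ENNReal.pow_le_pow_left_iff two_ne_zero, eLpNorm_two_sq]
  have hjm : Measurable fun q : E d × E d => f (q.1 - q.2) - f q.1 := by fun_prop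
  calc ∫⁻ x, ‖conv f k x - f x‖ₑ ^ 2
      ≤ ∫⁻ x, ∫⁻ z, ‖f (x - z) - f x‖ₑ ^ 2 * ‖k z‖ₑ := by
        refine lintegral_mono fun x => ?_
        have h1 : ‖conv f k x - f x‖ₑ ≤ ∫⁻ z, (‖f (x - z) - f x‖ₑ * ‖k z‖ₑ ^ (1 / 2 : ℝ))
            * ‖k z‖ₑ ^ (1 / 2 : ℝ) := by
          rw [conv_sub_eq hf hk hc hk1]
          refine (enorm_integral_le_lintegral_enorm _).trans_eq (lintegral_congr fun z => ?_)
          rw [enorm_mul, mul_assoc, ← ENNReal.rpow_add_of_nonneg _ _ (by norm_num) (by norm_num)]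
          norm_num
        have h2 := sq_lintegral_mul_le (μ := (volume : Measure (E d)))
          (f := fun z => ‖f (x - z) - f x‖ₑ * ‖k z‖ₑ ^ (1 / 2 : ℝ))
          (g := fun z => ‖k z‖ₑ ^ (1 / 2 : ℝ)) (by fun_prop) (by fun_prop)
        have h3 : ∀ z, (‖k z‖ₑ ^ (1 / 2 : ℝ)) ^ 2 = ‖k z‖ₑ := fun z => by
          rw [← ENNReal.rpow_natCast, ← ENNReal.rpow_mul]; norm_num
        simp only [mul_pow, h3, hkint, mul_one] at h2
        exact (pow_le_pow_left₀ zero_le h1 2).trans h2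
    _ = ∫⁻ z, ∫⁻ x, ‖f (x - z) - f x‖ₑ ^ 2 * ‖k z‖ₑ :=
        lintegral_lintegral_swap (Measurable.aemeasurable (by fun_prop))
    _ ≤ ∫⁻ z, ε ^ 2 * ‖k z‖ₑ := by
        refine lintegral_mono fun z => ?_
        rw [lintegral_mul_const _ (by fun_prop)]
        by_cases hz : k z = 0
        · simp [hz]
        · gcongr
          rw [← eLpNorm_two_sq]
          gcongr
          exact h z hz
    _ = ε ^ 2 := by rw [lintegral_const_mul _ (by fun_prop), hkint, mul_one]

theorem tendsto_conv {f : E d → ℝ} (hf : MemLp f 2 volume) {k : ℕ → E d → ℝ} {ρ : ℕ → ℝ}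
    (hk : ∀ n, Continuous (k n)) (hc : ∀ n, HasCompactSupport (k n)) (hk0 : ∀ n x, 0 ≤ k n x)
    (hk1 : ∀ n, ∫ x, k n x = 1) (hρ : Tendsto ρ atTop (𝓝 0))
    (hkρ : ∀ n z, k n z ≠ 0 → ‖z‖ ≤ ρ n) :
    Tendsto (fun n => eLpNorm (fun x => conv f (k n) x - f x) 2 volume) atTop (𝓝 0) := by
  wlog hfm : Measurable f generalizing f
  · obtain ⟨f', hf'm, hff'⟩ := hf.1
    have h1 := this ((memLp_congr_ae hff').1 hf) hf'm.measurable
    refine h1.congr fun n => eLpNorm_congr_ae ?_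
    filter_upwards [hff'] with x hx
    rw [hx]
    congr 1
    refine integral_congr_ae ?_
    filter_upwards [hff'] with t ht
    rw [ht]
  rw [ENNReal.tendsto_nhds_zero]
  intro ε hε
  have h1 := (ENNReal.tendsto_nhds_zero.1 (tendsto_eLpNorm_translate hf)) ε hε
  obtain ⟨r, hr, hb⟩ := Metric.eventually_nhds_iff.1 h1
  filter_upwards [hρ.eventually (gt_mem_nhds hr)] with n hn
  refine eLpNorm_conv_sub_le hfm (hf.locallyIntegrable (by norm_num)) (hk n) (hc n) (hk0 n)
    (hk1 n) fun z hz => hb ?_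
  rw [dist_zero_right]
  exact (hkρ n z hz).trans_lt hn

/-- If the reflected kernel at `x` is supported in `D`, it is a test function for `u` in `D`. The
jump of the extension by zero across the boundary is then not seen. -/
theorem pd_conv_indicator {D : Set (E d)} (hD : IsOpen D) {j : Fin d} {u g k : E d → ℝ}
    (hu : HasWeakPartial D j u g) (hU : LocallyIntegrable (D.indicator u) volume)
    (hk : ContDiff ℝ ∞ k) (hc : HasCompactSupport k) {x : E d}
    (hx : ∀ y, x - y ∈ tsupport k → y ∈ D) :
    pd j (conv (D.indicator u) k) x = conv (D.indicator g) k x := by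
  rw [pd_conv hU hk hc]
  have hψ : ContDiff ℝ ∞ fun t => k (x - t) := hk.comp (contDiff_const.sub contDiff_id)
  have hψc : HasCompactSupport fun t => k (x - t) :=
    hc.comp_homeomorph (Homeomorph.subLeft x)
  have hψs : tsupport (fun t => k (x - t)) ⊆ D := by
    intro t ht
    refine hx t ?_
    exact (tsupport_comp_subset_preimage k (f := fun t => x - t) (by fun_prop)) ht
  have hd : ∀ t, fderiv ℝ (fun t => k (x - t)) t (EuclideanSpace.single j 1)
      = - pd j k (x - t) := by
    intro t
    have h1 : HasFDerivAt (fun t : E d => x - t) (-ContinuousLinearMap.id ℝ (E d)) t :=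
      (hasFDerivAt_id t).const_sub x
    have h2 := ((hk.differentiable (by norm_num)).differentiableAt (x := x - t)).hasFDerivAt.comp t h1
    have h3 : fderiv ℝ (fun t => k (x - t)) t = _ := h2.fderiv
    rw [h3]
    simp [pd]
  have h := hu.2.2 _ hψ hψc hψs
  simp only [hd] at h
  have e : ∀ (w q : E d → ℝ), conv (D.indicator w) q x = ∫ t in D, w t * q (x - t) := by
    intro w q
    rw [← integral_indicator hD.measurableSet, conv]
    refine integral_congr_ae (ae_of_all _ fun t => ?_)
    by_cases ht : t ∈ D <;> simp [ht]
  rw [e, e]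
  simp only [mul_neg, integral_neg] at h
  linarith

/-- A partition of unity with kernels that look into the domain. -/
structure MollifierFamily (D : Set (E d)) where
  /-- the number of patches -/
  N : ℕ
  /-- the patches -/
  V : Fin N → Set (E d)
  /-- the partition of unity -/
  χ : Fin N → E d → ℝ
  /-- the kernels -/
  k : Fin N → ℕ → E d → ℝ
  /-- the sizes of the kernels -/
  ρ : Fin N → ℕ → ℝ
  contDiff_χ : ∀ i, ContDiff ℝ ∞ (χ i)
  tsupport_χ : ∀ i, tsupport (χ i) ⊆ V i
  sum_χ : ∀ x ∈ closure D, ∑ i, χ i x = 1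
  contDiff_k : ∀ i n, ContDiff ℝ ∞ (k i n)
  compact_k : ∀ i n, HasCompactSupport (k i n)
  nonneg_k : ∀ i n x, 0 ≤ k i n x
  integral_k : ∀ i n, ∫ x, k i n x = 1
  tendsto_ρ : ∀ i, Tendsto (ρ i) atTop (𝓝 0)
  norm_le_ρ : ∀ i n z, k i n z ≠ 0 → ‖z‖ ≤ ρ i n
  mem_of_sub_mem : ∀ i n, ∀ x ∈ closure D ∩ V i, ∀ y, x - y ∈ tsupport (k i n) → y ∈ D

open scoped Manifold in
-- The kernels are bumps of radius `τ ε / 2` centred at `-τ n`. If `x - y` is in the support, then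
-- `y = x + τ v` with `‖v - n‖ < ε`, so the cone condition puts `y` in `D` even when `x` is a
-- boundary point.
theorem IsC3Domain.exists_mollifierFamily {D : Set (E d)} (hD : IsC3Domain D) :
    Nonempty (MollifierFamily D) := by
  have hcone : ∀ p : closure D, ∃ (n : E d) (r ε : ℝ), 0 < r ∧ 0 < ε ∧
      ∀ x ∈ closure D ∩ Metric.ball p r, ∀ τ : ℝ, 0 < τ → τ < r → ∀ v : E d, ‖v - n‖ < ε →
        x + τ • v ∈ D := fun p => hD.exists_cone p.2
  choose n r ε hr hε hcone using hcone
  obtain ⟨t, ht⟩ := hD.isBounded.isCompact_closure.elim_finite_subcover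
    (fun p : closure D => Metric.ball (p : E d) (r p)) (fun p => Metric.isOpen_ball)
    (fun x hx => mem_iUnion.2 ⟨⟨x, hx⟩, Metric.mem_ball_self (hr _)⟩)
  let e := t.equivFin
  let P : Fin t.card → closure D := fun i => (e.symm i).1
  have hcov : closure D ⊆ ⋃ i, Metric.ball (P i : E d) (r (P i)) := by
    intro x hx
    obtain ⟨p, hp, hxp⟩ := mem_iUnion₂.1 (ht hx)
    refine mem_iUnion.2 ⟨e ⟨p, hp⟩, ?_⟩
    simpa [P] using hxp
  obtain ⟨f, hf⟩ := SmoothPartitionOfUnity.exists_isSubordinate 𝓘(ℝ, E d)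
    (isClosed_closure (s := D)) (fun i => Metric.ball (P i : E d) (r (P i)))
    (fun i => Metric.isOpen_ball) hcov
  -- The denominator `m + 2` keeps `τ` strictly below the cone length already for `m = 0`.
  let τ : Fin t.card → ℕ → ℝ := fun i m => r (P i) / (m + 2)
  have hτ0 : ∀ i m, 0 < τ i m := fun i m => div_pos (hr _) (by positivity)
  have hτr : ∀ i m, τ i m < r (P i) := fun i m =>
    div_lt_self (hr _) (by have : (0 : ℝ) ≤ m := Nat.cast_nonneg m; linarith)
  let b : ∀ i m, ContDiffBump (-(τ i m) • n (P i)) := fun i m =>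
    ⟨τ i m * ε (P i) / 4, τ i m * ε (P i) / 2,
      by have := mul_pos (hτ0 i m) (hε (P i)); positivity,
      by have := mul_pos (hτ0 i m) (hε (P i)); linarith⟩
  refine ⟨{ N := t.card, V := fun i => Metric.ball (P i : E d) (r (P i)), χ := fun i => f i,
            k := fun i m => (b i m).normed volume,
            ρ := fun i m => τ i m * (‖n (P i)‖ + ε (P i)),
            contDiff_χ := fun i => (f i).contMDiff.contDiff, tsupport_χ := hf,
            sum_χ := ?_, contDiff_k := fun i m => (b i m).contDiff_normed (n := ⊤),
            compact_k := fun i m => (b i m).hasCompactSupport_normed,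
            nonneg_k := fun i m x => (b i m).nonneg_normed x,
            integral_k := fun i m => (b i m).integral_normed, tendsto_ρ := ?_, norm_le_ρ := ?_,
            mem_of_sub_mem := ?_ }⟩
  · intro x hx
    have := f.sum_eq_one hx
    rwa [finsum_eq_sum_of_fintype] at this
  · intro i
    have h1 : Tendsto (fun m : ℕ => r (P i) / ((m : ℝ) + 2)) atTop (𝓝 0) :=
      tendsto_const_nhds.div_atTop
        (tendsto_natCast_atTop_atTop.atTop_add tendsto_const_nhds)
    simpa using h1.mul_const (‖n (P i)‖ + ε (P i))
  · intro i m z hz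
    have h1 : z ∈ Metric.ball (-(τ i m) • n (P i)) (τ i m * ε (P i) / 2) := by
      have := (b i m).support_normed_eq (μ := volume)
      rw [← this]; exact hz
    rw [Metric.mem_ball, dist_eq_norm] at h1
    have h2 := mul_pos (hτ0 i m) (hε (P i))
    calc ‖z‖ = ‖(z - -(τ i m) • n (P i)) + -(τ i m) • n (P i)‖ := by congr 1; abel
      _ ≤ ‖z - -(τ i m) • n (P i)‖ + ‖-(τ i m) • n (P i)‖ := norm_add_le _ _
      _ ≤ _ := by
        rw [norm_smul, norm_neg, Real.norm_of_nonneg (hτ0 i m).le]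
        linarith
  · intro i m x hx y hy
    rw [(b i m).tsupport_normed_eq (μ := volume), Metric.mem_closedBall, dist_eq_norm] at hy
    change ‖x - y - -(τ i m) • n (P i)‖ ≤ τ i m * ε (P i) / 2 at hy
    have hτ := hτ0 i m
    have e1 : y = x + τ i m • ((τ i m)⁻¹ • (y - x)) := by
      rw [smul_smul, mul_inv_cancel₀ hτ.ne', one_smul]; abel
    rw [e1]
    refine hcone (P i) x hx _ hτ (hτr i m) _ ?_
    have e2 : (τ i m)⁻¹ • (y - x) - n (P i)
        = -((τ i m)⁻¹ • (x - y - -(τ i m) • n (P i))) := by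
      have e3 : (τ i m)⁻¹ • (-(τ i m) • n (P i)) = -n (P i) := by
        rw [smul_smul, mul_neg, inv_mul_cancel₀ hτ.ne', neg_one_smul]
      rw [smul_sub (τ i m)⁻¹ (x - y), e3]
      module
    rw [e2, norm_neg, norm_smul, norm_inv, Real.norm_of_nonneg hτ.le]
    have h2 := hε (P i)
    calc (τ i m)⁻¹ * ‖x - y - -(τ i m) • n (P i)‖ ≤ (τ i m)⁻¹ * (τ i m * ε (P i) / 2) := by gcongr
      _ = ε (P i) / 2 := by field_simp
      _ < ε (P i) := by linarith

/-! ### Approximation by functions that are smooth up to the boundary -/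


theorem pd_fun_sum {ι : Type*} {s : Finset ι} {f : ι → E d → ℝ} (j : Fin d) {x : E d}
    (h : ∀ i ∈ s, DifferentiableAt ℝ (f i) x) :
    pd j (fun x => ∑ i ∈ s, f i x) x = ∑ i ∈ s, pd j (f i) x := by
  simp only [pd]
  rw [fderiv_fun_sum h]
  simp

theorem pd_mul {f g : E d → ℝ} (j : Fin d) {x : E d} (hf : DifferentiableAt ℝ f x)
    (hg : DifferentiableAt ℝ g x) :
    pd j (fun x => f x * g x) x = pd j f x * g x + f x * pd j g x := by
  simp only [pd]
  rw [fderiv_fun_mul hf hg]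
  simp; ring

theorem pd_add {f g : E d → ℝ} (j : Fin d) {x : E d} (hf : DifferentiableAt ℝ f x)
    (hg : DifferentiableAt ℝ g x) :
    pd j (fun x => f x + g x) x = pd j f x + pd j g x := by
  simp only [pd]
  rw [fderiv_fun_add hf hg]
  simp

theorem pd_congr {f g : E d → ℝ} {D : Set (E d)} (hD : IsOpen D) (h : ∀ x ∈ D, f x = g x)
    (j : Fin d) {x : E d} (hx : x ∈ D) : pd j f x = pd j g x := by
  have : f =ᶠ[𝓝 x] g := by
    filter_upwards [hD.mem_nhds hx] with y hy using h y hy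
  simp only [pd, this.fderiv_eq]

namespace MollifierFamily

variable {D : Set (E d)} (F : MollifierFamily D)

/-- The glued mollification with weights `ζ`. -/
def S (ζ : Fin F.N → E d → ℝ) (u : E d → ℝ) (n : ℕ) (x : E d) : ℝ :=
  ∑ i, ζ i x * conv (D.indicator u) (F.k i n) x

theorem contDiff_S {ζ : Fin F.N → E d → ℝ} (hζ : ∀ i, ContDiff ℝ ∞ (ζ i)) {u : E d → ℝ}
    (hU : LocallyIntegrable (D.indicator u) volume) (n : ℕ) : ContDiff ℝ ∞ (F.S ζ u n) :=
  ContDiff.sum fun i _ => (hζ i).mul (contDiff_conv hU (F.contDiff_k i n) (F.compact_k i n))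

/-- On the support of `ζ i` the kernels look into `D` and the derivative falls on `u`; outside it
the weight is zero. General weights are allowed because differentiating the partition of unity
produces sums of the same form. -/
theorem pd_S (hD : IsOpen D) {ζ : Fin F.N → E d → ℝ} (hζ : ∀ i, ContDiff ℝ ∞ (ζ i))
    (hζV : ∀ i, tsupport (ζ i) ⊆ F.V i) {j : Fin d} {u g : E d → ℝ}
    (hu : HasWeakPartial D j u g) (hU : LocallyIntegrable (D.indicator u) volume) (n : ℕ)
    {x : E d} (hx : x ∈ D) :
    pd j (F.S ζ u n) x = F.S (fun i => pd j (ζ i)) u n x + F.S ζ g n x := by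
  have hc : ∀ i, ContDiff ℝ ∞ (conv (D.indicator u) (F.k i n)) := fun i =>
    contDiff_conv hU (F.contDiff_k i n) (F.compact_k i n)
  have hd1 : ∀ i, DifferentiableAt ℝ (ζ i) x := fun i =>
    ((hζ i).differentiable (by norm_num)).differentiableAt
  have hd2 : ∀ i, DifferentiableAt ℝ (conv (D.indicator u) (F.k i n)) x := fun i =>
    ((hc i).differentiable (by norm_num)).differentiableAt
  have h1 : pd j (F.S ζ u n) x = ∑ i, pd j (fun x => ζ i x * conv (D.indicator u) (F.k i n) x) x :=
    pd_fun_sum j fun i _ => (hd1 i).mul (hd2 i)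
  rw [h1, S, S, ← Finset.sum_add_distrib]
  refine Finset.sum_congr rfl fun i _ => ?_
  rw [pd_mul j (hd1 i) (hd2 i)]
  congr 1
  by_cases hxi : x ∈ tsupport (ζ i)
  · rw [pd_conv_indicator hD hu hU (F.contDiff_k i n) (F.compact_k i n)
      (F.mem_of_sub_mem i n x ⟨subset_closure hx, hζV i hxi⟩)]
  · rw [image_eq_zero_of_notMem_tsupport hxi, zero_mul, zero_mul]

/-- Used with `a = 1` for the partition of unity and with `a = 0` for its derivatives. The latter
sum to zero in `D`, so the terms in which a weight is differentiated vanish in the limit. -/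
theorem tendsto_S (hD : IsOpen D) (hb : Bornology.IsBounded D) {ζ : Fin F.N → E d → ℝ}
    (hζ : ∀ i, Continuous (ζ i)) {a : ℝ} (ha : ∀ x ∈ D, ∑ i, ζ i x = a) {u : E d → ℝ}
    (hu : MemLp u 2 (volume.restrict D)) :
    Tendsto (fun n => eLpNorm (fun x => F.S ζ u n x - a * u x) 2 (volume.restrict D))
      atTop (𝓝 0) := by
  have hU : MemLp (D.indicator u) 2 volume := (memLp_indicator_iff_restrict hD.measurableSet).2 hu
  choose C hC using fun i => hb.isCompact_closure.exists_bound_of_continuousOn (hζ i).continuousOn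
  have hconv : ∀ i n, Continuous (conv (D.indicator u) (F.k i n)) := fun i n =>
    (contDiff_conv (hU.locallyIntegrable (by norm_num)) (F.contDiff_k i n)
      (F.compact_k i n)).continuous
  have hlim : Tendsto (fun n => ∑ i, ENNReal.ofReal (C i) *
      eLpNorm (fun x => conv (D.indicator u) (F.k i n) x - D.indicator u x) 2 volume) atTop
      (𝓝 (∑ i, ENNReal.ofReal (C i) * 0)) :=
    tendsto_finsetSum _ fun i _ => ENNReal.Tendsto.const_mul
      (tendsto_conv hU (fun n => (F.contDiff_k i n).continuous) (F.compact_k i) (F.nonneg_k i)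
        (F.integral_k i) (F.tendsto_ρ i) (F.norm_le_ρ i)) (Or.inr ENNReal.ofReal_ne_top)
  simp only [mul_zero, Finset.sum_const_zero] at hlim
  refine tendsto_of_tendsto_of_tendsto_of_le_of_le tendsto_const_nhds hlim (fun _ => zero_le)
    fun n => ?_
  have h1 : eLpNorm (fun x => F.S ζ u n x - a * u x) 2 (volume.restrict D)
      = eLpNorm (∑ i, fun x => ζ i x * (conv (D.indicator u) (F.k i n) x - D.indicator u x)) 2
        (volume.restrict D) := by
    refine eLpNorm_congr_ae ?_
    filter_upwards [ae_restrict_mem hD.measurableSet] with x hx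
    rw [Finset.sum_apply, S, ← ha x hx, Finset.sum_mul, ← Finset.sum_sub_distrib]
    refine Finset.sum_congr rfl fun i _ => ?_
    rw [indicator_of_mem hx]; ring
  rw [h1]
  refine (eLpNorm_sum_le (fun i _ => ((hζ i).aestronglyMeasurable.mul
    ((hconv i n).aestronglyMeasurable.sub hU.1.restrict))) (by norm_num)).trans ?_
  refine Finset.sum_le_sum fun i _ => ?_
  refine (eLpNorm_le_mul_eLpNorm_of_ae_le_mul
    (g := fun x => conv (D.indicator u) (F.k i n) x - D.indicator u x) (c := C i) ?_ 2).trans ?_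
  · filter_upwards [ae_restrict_mem hD.measurableSet] with x hx
    simp only [Pi.mul_apply, Pi.sub_apply]
    rw [norm_mul]
    gcongr
    exact hC i x (subset_closure hx)
  · gcongr
    exact Measure.restrict_le_self

theorem sum_pd_χ (hD : IsOpen D) (j : Fin d) : ∀ x ∈ D, ∑ i, pd j (F.χ i) x = 0 := by
  intro x hx
  rw [← pd_fun_sum j fun i _ => ((F.contDiff_χ i).differentiable (by norm_num)).differentiableAt,
    pd_congr hD (g := fun _ => 1) (fun y hy => F.sum_χ y (subset_closure hy)) j hx]
  simp [pd]

theorem tsupport_pd_subset (j : Fin d) (f : E d → ℝ) : tsupport (pd j f) ⊆ tsupport f :=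
  tsupport_fderiv_apply_subset ℝ _

theorem locallyIntegrable_indicator (hD : IsOpen D) {u : E d → ℝ}
    (hu : MemLp u 2 (volume.restrict D)) : LocallyIntegrable (D.indicator u) volume :=
  ((memLp_indicator_iff_restrict hD.measurableSet).2 hu).locallyIntegrable (by norm_num)

theorem tendsto_sub_S (hD : IsOpen D) (hb : Bornology.IsBounded D) {u : E d → ℝ}
    (hu : MemLp u 2 (volume.restrict D)) :
    Tendsto (fun n => eLpNorm (fun x => u x - F.S F.χ u n x) 2 (volume.restrict D))
      atTop (𝓝 0) := by
  have h := F.tendsto_S hD hb (fun i => (F.contDiff_χ i).continuous) (a := 1)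
    (fun x hx => F.sum_χ x (subset_closure hx)) hu
  refine h.congr fun n => ?_
  have := eLpNorm_sub_comm (F.S F.χ u n) u 2 (volume.restrict D)
  simp only [one_mul]
  exact this

theorem tendsto_sub_pd_S (hD : IsOpen D) (hb : Bornology.IsBounded D) {u g : E d → ℝ}
    (hu : MemLp u 2 (volume.restrict D)) {j : Fin d} (hg : HasWeakPartial D j u g)
    (hg2 : MemLp g 2 (volume.restrict D)) :
    Tendsto (fun n => eLpNorm (fun x => g x - pd j (F.S F.χ u n) x) 2 (volume.restrict D))
      atTop (𝓝 0) := by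
  have hχc : ∀ i, Continuous (pd j (F.χ i)) := fun i => (contDiff_pd (F.contDiff_χ i) j).continuous
  have h1 := F.tendsto_S hD hb hχc (a := 0) (F.sum_pd_χ hD j) hu
  have h2 := F.tendsto_sub_S hD hb hg2
  have h3 := h2.add h1
  rw [add_zero] at h3
  refine tendsto_of_tendsto_of_tendsto_of_le_of_le tendsto_const_nhds h3 (fun _ => zero_le)
    fun n => ?_
  have hU := locallyIntegrable_indicator hD hu
  have hG := locallyIntegrable_indicator hD hg2
  refine le_trans (le_of_eq ?_) (eLpNorm_sub_le
    (hg2.1.sub (F.contDiff_S F.contDiff_χ hG n).continuous.aestronglyMeasurable)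
    ((F.contDiff_S (fun i => contDiff_pd (F.contDiff_χ i) j) hU n).continuous.aestronglyMeasurable.sub
      (hu.1.const_mul 0)) (by norm_num))
  refine eLpNorm_congr_ae ?_
  filter_upwards [ae_restrict_mem hD.measurableSet] with x hx
  rw [F.pd_S hD F.contDiff_χ F.tsupport_χ hg hU n hx]
  simp only [Pi.sub_apply]
  ring

/-- Apart from the main term, the product rule leaves sums weighted by first or second derivatives
of the partition of unity. These tend to `0` because the weights sum to `0`. -/
theorem tendsto_sub_pd_pd_S (hD : IsOpen D) (hb : Bornology.IsBounded D) {u g q w : E d → ℝ}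
    (hu : MemLp u 2 (volume.restrict D)) {j l : Fin d} (hg : HasWeakPartial D j u g)
    (hg2 : MemLp g 2 (volume.restrict D)) (hq : HasWeakPartial D l u q)
    (hq2 : MemLp q 2 (volume.restrict D)) (hw : HasWeakPartial D l g w)
    (hw2 : MemLp w 2 (volume.restrict D)) :
    Tendsto (fun n => eLpNorm (fun x => w x - pd l (pd j (F.S F.χ u n)) x) 2
      (volume.restrict D)) atTop (𝓝 0) := by
  have hχj : ∀ i, ContDiff ℝ ∞ (pd j (F.χ i)) := fun i => contDiff_pd (F.contDiff_χ i) j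
  have hχlj : ∀ i, ContDiff ℝ ∞ (pd l (pd j (F.χ i))) := fun i => contDiff_pd (hχj i) l
  have hχl : ∀ i, ContDiff ℝ ∞ (pd l (F.χ i)) := fun i => contDiff_pd (F.contDiff_χ i) l
  have hU := locallyIntegrable_indicator hD hu
  have hG := locallyIntegrable_indicator hD hg2
  have hQ := locallyIntegrable_indicator hD hq2
  have hW := locallyIntegrable_indicator hD hw2
  have hs0 : ∀ x ∈ D, ∑ i, pd l (pd j (F.χ i)) x = 0 := by
    intro x hx
    rw [← pd_fun_sum l fun i _ => ((hχj i).differentiable (by norm_num)).differentiableAt,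
      pd_congr hD (g := fun _ => 0) (F.sum_pd_χ hD j) l hx]
    simp [pd]
  have h1 := F.tendsto_S hD hb (fun i => (hχlj i).continuous) (a := 0) hs0 hu
  have h2 := F.tendsto_S hD hb (fun i => (hχj i).continuous) (a := 0) (F.sum_pd_χ hD j) hq2
  have h3 := F.tendsto_sub_pd_S hD hb hg2 hw hw2
  have h4 := h3.add (h1.add h2)
  simp only [add_zero] at h4
  refine tendsto_of_tendsto_of_tendsto_of_le_of_le tendsto_const_nhds h4 (fun _ => zero_le)
    fun n => ?_
  have m1 := (F.contDiff_S hχlj hU n).continuous.aestronglyMeasurable (μ := volume.restrict D)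
  have m2 := (F.contDiff_S hχj hQ n).continuous.aestronglyMeasurable (μ := volume.restrict D)
  have m3 := (contDiff_pd (F.contDiff_S F.contDiff_χ hG n) l).continuous.aestronglyMeasurable
    (μ := volume.restrict D)
  refine le_trans (le_of_eq ?_) ((eLpNorm_sub_le (hw2.1.sub m3)
    ((m1.sub (hu.1.const_mul 0)).add (m2.sub (hq2.1.const_mul 0))) (by norm_num)).trans
    (add_le_add le_rfl (eLpNorm_add_le (m1.sub (hu.1.const_mul 0)) (m2.sub (hq2.1.const_mul 0))
      (by norm_num))))
  refine eLpNorm_congr_ae ?_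
  filter_upwards [ae_restrict_mem hD.measurableSet] with x hx
  rw [pd_congr hD (g := fun x => F.S (fun i => pd j (F.χ i)) u n x + F.S F.χ g n x)
    (fun y hy => F.pd_S hD F.contDiff_χ F.tsupport_χ hg hU n hy) l hx,
    pd_add l ((F.contDiff_S hχj hU n).differentiable (by norm_num)).differentiableAt
      ((F.contDiff_S F.contDiff_χ hG n).differentiable (by norm_num)).differentiableAt]
  have e := F.pd_S hD hχj (fun i => (tsupport_pd_subset j _).trans (F.tsupport_χ i)) hq hU n hx
  change _ - (pd l (F.S (fun i => pd j (F.χ i)) u n) x + pd l (F.S F.χ g n) x) = _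
  rw [e]
  simp only [Pi.sub_apply, Pi.add_apply]
  ring

/-- The bound holds up to the boundary, since at boundary points too the kernels see only values of
`u` in `D`. It yields uniform convergence on `∂D` and identifies the trace of a Lipschitz function.
-/
theorem abs_sub_S_le (hD : IsOpen D) {K : ℝ≥0} {u : E d → ℝ}
    (hu : LipschitzOnWith K u (closure D)) (hu2 : MemLp u 2 (volume.restrict D)) (n : ℕ)
    {x : E d} (hx : x ∈ closure D) :
    |u x - F.S F.χ u n x| ≤ ∑ i, |F.χ i x| * (K * F.ρ i n) := by
  have hU := locallyIntegrable_indicator hD hu2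
  have h1 : u x - F.S F.χ u n x
      = - ∑ i, F.χ i x * (conv (D.indicator u) (F.k i n) x - u x) := by
    have : u x = ∑ i, F.χ i x * u x := by rw [← Finset.sum_mul, F.sum_χ x hx, one_mul]
    simp only [_root_.mul_sub, Finset.sum_sub_distrib, S]
    rw [← this]; ring
  rw [h1, abs_neg]
  refine (Finset.abs_sum_le_sum_abs _ _).trans (Finset.sum_le_sum fun i _ => ?_)
  rw [abs_mul]
  by_cases hxi : x ∈ tsupport (F.χ i)
  · gcongr
    rw [conv_sub_eq hU (F.contDiff_k i n).continuous (F.compact_k i n) (F.integral_k i n)]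
    have hki := (F.contDiff_k i n).continuous.integrable_of_hasCompactSupport (μ := volume)
      (F.compact_k i n)
    have h2 : ∀ z, ‖(D.indicator u (x - z) - u x) * F.k i n z‖ ≤ (K * F.ρ i n) * F.k i n z := by
      intro z
      rw [norm_mul, Real.norm_of_nonneg (F.nonneg_k i n z)]
      by_cases hz : F.k i n z = 0
      · simp [hz]
      · refine mul_le_mul_of_nonneg_right ?_ (F.nonneg_k i n z)
        have hz' : x - z ∈ D := F.mem_of_sub_mem i n x ⟨hx, F.tsupport_χ i hxi⟩ (x - z)
          (by simpa using subset_tsupport _ hz)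
        rw [indicator_of_mem hz', ← dist_eq_norm]
        refine (hu.dist_le_mul _ (subset_closure hz') _ hx).trans ?_
        gcongr
        rw [dist_eq_norm, sub_sub_cancel_left, norm_neg]
        exact F.norm_le_ρ i n z hz
    have h3 := norm_integral_le_of_norm_le (hki.const_mul (K * F.ρ i n)) (ae_of_all _ h2)
    rwa [integral_const_mul, F.integral_k, mul_one] at h3
  · rw [image_eq_zero_of_notMem_tsupport hxi]; simp

end MollifierFamily

/-- Density of smooth functions in `H²`. -/
theorem MemH2.exists_approx {D : Set (E d)} (hD : IsC3Domain D) {u : E d → ℝ} (hu : MemH2 D u) :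
    ∃ φ : ℕ → E d → ℝ, (∀ n, ContDiff ℝ ∞ (φ n)) ∧
      Tendsto (fun n => eLpNorm (fun x => u x - φ n x) 2 (volume.restrict D)) atTop (𝓝 0) ∧
      (∀ j, Tendsto (fun n => eLpNorm (fun x => weakPartial D j u x - pd j (φ n) x) 2
        (volume.restrict D)) atTop (𝓝 0)) ∧
      ∀ j l, Tendsto (fun n => eLpNorm (fun x => weakPartial D l (weakPartial D j u) x
        - pd l (pd j (φ n)) x) 2 (volume.restrict D)) atTop (𝓝 0) := by
  obtain ⟨F⟩ := hD.exists_mollifierFamily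
  have ho := hD.isOpen
  have hb := hD.isBounded
  refine ⟨fun n => F.S F.χ u n,
    F.contDiff_S F.contDiff_χ (MollifierFamily.locallyIntegrable_indicator ho hu.1.1),
    F.tendsto_sub_S ho hb hu.1.1, fun j => F.tendsto_sub_pd_S ho hb hu.1.1
      (hu.1.hasWeakPartial j) (hu.1.memLp_weakPartial ho j), fun j l => ?_⟩
  exact F.tendsto_sub_pd_pd_S ho hb hu.1.1 (hu.1.hasWeakPartial j) (hu.1.memLp_weakPartial ho j)
    (hu.1.hasWeakPartial l) (hu.1.memLp_weakPartial ho l) ((hu.2 j).hasWeakPartial l)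
    ((hu.2 j).memLp_weakPartial ho l)

/-- A Lipschitz function in `H¹` is its own trace. -/
theorem isTrace_of_lipschitzOnWith {m : ℕ} {D : Set (E (m + 1))} (hD : IsC3Domain D) {K : ℝ≥0}
    {w : E (m + 1) → ℝ} (hw : LipschitzOnWith K w (closure D)) (hw1 : MemH1 D w) :
    IsTrace D w w := by
  obtain ⟨F⟩ := hD.exists_mollifierFamily
  have ho := hD.isOpen
  have hb := hD.isBounded
  have hfin : IsFiniteMeasure (surfaceMeasure (frontier D)) :=
    ⟨surfaceMeasure_frontier_lt_top hD⟩
  have hae : ∀ᵐ x ∂(surfaceMeasure (frontier D)), x ∈ closure D := by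
    filter_upwards [ae_restrict_mem isClosed_frontier.measurableSet] with x hx
    exact frontier_subset_closure hx
  have hrest : (surfaceMeasure (frontier D)).restrict (closure D) = surfaceMeasure (frontier D) :=
    Measure.restrict_eq_self_of_ae_mem hae
  have hms : AEStronglyMeasurable w (surfaceMeasure (frontier D)) := by
    rw [← hrest]
    exact hw.continuousOn.aestronglyMeasurable isClosed_closure.measurableSet
  have hS := F.contDiff_S F.contDiff_χ (MollifierFamily.locallyIntegrable_indicator ho hw1.1)
  obtain ⟨C, hC⟩ := hb.isCompact_closure.exists_bound_of_continuousOn hw.continuousOn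
  refine ⟨MemLp.of_bound hms C (hae.mono hC), fun n => F.S F.χ w n, hS, ?_, ?_⟩
  · have h1 := (F.tendsto_sub_S ho hb hw1.1).add (tendsto_finsetSum Finset.univ fun j _ =>
      F.tendsto_sub_pd_S ho hb hw1.1 (hw1.hasWeakPartial j) (hw1.memLp_weakPartial ho j))
    simp only [Finset.sum_const_zero, add_zero] at h1
    refine tendsto_of_tendsto_of_tendsto_of_le_of_le tendsto_const_nhds h1 (fun _ => zero_le)
      fun n => ?_
    refine (h1Norm_le (hw1.sub ho (memH1_of_contDiff hb (hS n)))).trans_eq ?_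
    congr 1
    refine Finset.sum_congr rfl fun j _ => eLpNorm_congr_ae ?_
    exact ((hw1.hasWeakPartial j).sub (hasWeakPartial_of_contDiff D j (hS n))).weakPartial_ae_eq ho
  · choose B hB using fun i =>
      hb.isCompact_closure.exists_bound_of_continuousOn (F.contDiff_χ i).continuous.continuousOn
    have hlim : Tendsto (fun n => ∑ i, B i * (K * |F.ρ i n|)) atTop
        (𝓝 (∑ i, B i * (K * |(0 : ℝ)|))) :=
      tendsto_finsetSum _ fun i _ => ((F.tendsto_ρ i).abs.const_mul _).const_mul _
    simp only [abs_zero, mul_zero, Finset.sum_const_zero] at hlim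
    have hlim2 := ENNReal.Tendsto.const_mul
      (a := surfaceMeasure (frontier D) univ ^ (2 : ℝ≥0∞).toReal⁻¹)
      (ENNReal.tendsto_ofReal hlim) (Or.inr (by finiteness))
    rw [ENNReal.ofReal_zero, mul_zero] at hlim2
    refine tendsto_of_tendsto_of_tendsto_of_le_of_le tendsto_const_nhds hlim2 (fun _ => zero_le)
      fun n => ?_
    refine eLpNorm_le_of_ae_bound (hae.mono fun x hx => ?_)
    refine (F.abs_sub_S_le ho hw hw1.1 n hx).trans (Finset.sum_le_sum fun i _ => ?_)
    have := hB i x hx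
    rw [Real.norm_eq_abs] at this
    calc |F.χ i x| * (K * F.ρ i n) ≤ |F.χ i x| * (K * |F.ρ i n|) := by
          gcongr; exact le_abs_self _
      _ ≤ B i * (K * |F.ρ i n|) := by gcongr

/-! ### Piecewise Lipschitz functions -/


/-- By finiteness, some piece contains points arbitrarily close to the right of a given `x`, and
also `x` itself because it is closed. The lower right slope at `x` is therefore at most `L`, which
suffices for the mean value inequality. -/
theorem le_of_piecewise_lipschitz {ι : Type*} [Finite ι] {f : ℝ → ℝ} {C : ι → Set ℝ} {L : ℝ}
    (hf : ContinuousOn f (Icc 0 1)) (hC : ∀ i, IsClosed (C i)) (hcov : Icc 0 1 ⊆ ⋃ i, C i)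
    (hL : ∀ i, ∀ s ∈ C i ∩ Icc 0 1, ∀ t ∈ C i ∩ Icc 0 1, |f s - f t| ≤ L * |s - t|) :
    f 1 - f 0 ≤ L := by
  have key := image_le_of_liminf_slope_right_le_deriv_boundary (B := fun t => f 0 + L * t)
    (B' := fun _ => L) hf (by simp) (by fun_prop)
    (fun x _ => by
      have := ((hasDerivAt_id x).const_mul L).const_add (f 0)
      simpa using this.hasDerivWithinAt) ?_ (right_mem_Icc.2 zero_le_one)
  · linarith
  · intro x hx r hr
    have hfreq : ∃ i, ∃ᶠ z in 𝓝[>] x, z ∈ C i := by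
      by_contra hcon
      push Not at hcon
      obtain ⟨z, hz, hz1⟩ := ((Filter.eventually_all.2 hcon).and (Ioo_mem_nhdsGT hx.2)).exists
      obtain ⟨i, hi⟩ := mem_iUnion.1 (hcov ⟨hx.1.trans hz1.1.le, hz1.2.le⟩)
      exact hz i hi
    obtain ⟨i, hi⟩ := hfreq
    have hxi : x ∈ C i := by
      refine (hC i).closure_subset (mem_closure_iff_frequently.2 ?_)
      exact hi.filter_mono nhdsWithin_le_nhds
    refine (hi.and_eventually (Ioo_mem_nhdsGT hx.2)).mono fun z hz => ?_
    have h1 := hL i z ⟨hz.1, hx.1.trans hz.2.1.le, hz.2.2.le⟩ x ⟨hxi, hx.1, hx.2.le⟩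
    have h2 : 0 < z - x := sub_pos.2 hz.2.1
    rw [abs_of_pos h2] at h1
    rw [slope_def_field, div_lt_iff₀ h2]
    nlinarith [le_abs_self (f z - f x)]

theorem abs_sub_le_of_piecewise_lipschitz {ι : Type*} [Finite ι] {X : Set (E d)}
    {K : ι → Set (E d)} (hK : ∀ i, IsClosed (K i)) (hcov : X ⊆ ⋃ i, K i) {w : E d → ℝ}
    (hw : ContinuousOn w X) {L : ℝ≥0} (hL : ∀ i, LipschitzOnWith L w (K i)) {x v : E d}
    (hx : ∀ t ∈ Icc (0 : ℝ) 1, x + t • v ∈ X) : |w (x + v) - w x| ≤ L * ‖v‖ := by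
  let γ : ℝ → E d := fun t => x + t • v
  have hγ : Continuous γ := by fun_prop
  have hc : ContinuousOn (fun t => w (γ t)) (Icc 0 1) := hw.comp hγ.continuousOn hx
  have hC : ∀ i, IsClosed (γ ⁻¹' K i) := fun i => (hK i).preimage hγ
  have hcov' : Icc (0 : ℝ) 1 ⊆ ⋃ i, γ ⁻¹' K i := by
    intro t ht
    obtain ⟨i, hi⟩ := mem_iUnion.1 (hcov (hx t ht))
    exact mem_iUnion.2 ⟨i, hi⟩
  have hb : ∀ i, ∀ s ∈ γ ⁻¹' K i ∩ Icc 0 1, ∀ t ∈ γ ⁻¹' K i ∩ Icc 0 1,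
      |w (γ s) - w (γ t)| ≤ (L * ‖v‖) * |s - t| := by
    intro i s hs t ht
    have := (hL i).dist_le_mul _ hs.1 _ ht.1
    rw [Real.dist_eq, dist_eq_norm] at this
    have e : γ s - γ t = (s - t) • v := by simp only [γ]; module
    rw [e, norm_smul, Real.norm_eq_abs] at this
    linarith
  have h1 := le_of_piecewise_lipschitz hc hC hcov' hb
  have h2 := le_of_piecewise_lipschitz (f := fun t => -w (γ t)) (L := L * ‖v‖) hc.neg hC hcov'
    (fun i s hs t ht => by
      rw [neg_sub_neg, abs_sub_comm]
      exact hb i s hs t ht)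
  simp only [γ, one_smul, zero_smul, add_zero] at h1 h2
  rw [abs_le]
  constructor <;> linarith

/-- The closure is not convex, so nearby points `x`, `y` are joined by three segments: inwards along
`τ n`, across, and back. The path has length comparable to `‖y - x‖`, and compactness makes the
local bound global. -/
theorem IsC3Domain.exists_lipschitzOnWith {D : Set (E d)} (hD : IsC3Domain D) {w : E d → ℝ}
    {L : ℝ≥0} (hw : ∀ x v, (∀ t ∈ Icc (0 : ℝ) 1, x + t • v ∈ closure D) →
      |w (x + v) - w x| ≤ L * ‖v‖) : ∃ K : ℝ≥0, LipschitzOnWith K w (closure D) := by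
  refine LocallyLipschitzOn.exists_lipschitzOnWith_of_compact hD.isBounded.isCompact_closure ?_
  intro p hp
  obtain ⟨n, r, ε, hr, hε, hcone⟩ := hD.exists_cone hp
  have hL : (0 : ℝ) ≤ L := L.2
  set ρ := min r (r * ε / 8) with hρ
  have hρ0 : 0 < ρ := by positivity
  refine ⟨L * Real.toNNReal (1 + 4 * ‖n‖ / ε), closure D ∩ Metric.ball p ρ,
    inter_mem_nhdsWithin _ (Metric.ball_mem_nhds p hρ0),
    LipschitzOnWith.of_dist_le_mul fun x hx y hy => ?_⟩
  rcases eq_or_ne x y with rfl | hxy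
  · simp
  have hxyp : 0 < ‖y - x‖ := norm_pos_iff.2 (sub_ne_zero.2 hxy.symm)
  -- With this height the crossing stays in the cone at `x`, since `‖y - x‖ / τ = ε / 2`. The radius
  -- `ρ` ensures `τ < r`.
  set τ := 2 * ‖y - x‖ / ε with hτ
  have hτ0 : 0 < τ := by positivity
  have hxr : x ∈ closure D ∩ Metric.ball p r :=
    ⟨hx.1, Metric.ball_subset_ball (min_le_left _ _) hx.2⟩
  have hyr : y ∈ closure D ∩ Metric.ball p r :=
    ⟨hy.1, Metric.ball_subset_ball (min_le_left _ _) hy.2⟩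
  have hτr : τ < r := by
    have h1 : ‖y - x‖ < 2 * ρ := by
      rw [← dist_eq_norm]
      calc dist y x ≤ dist y p + dist x p := dist_triangle_right _ _ _
        _ < ρ + ρ := add_lt_add hy.2 hx.2
        _ = 2 * ρ := by ring
    have h2 : ρ ≤ r * ε / 8 := min_le_right _ _
    rw [hτ, div_lt_iff₀ hε]
    nlinarith [mul_pos hr hε]
  have hvert : ∀ z ∈ closure D ∩ Metric.ball p r, ∀ t ∈ Icc (0 : ℝ) 1,
      z + t • (τ • n) ∈ closure D := by
    intro z hz t ht
    rcases ht.1.eq_or_lt with rfl | ht0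
    · simpa using hz.1
    · rw [smul_smul]
      exact subset_closure (hcone z hz _ (mul_pos ht0 hτ0) (by nlinarith [ht.2]) n (by simpa))
  have hhor : ∀ t ∈ Icc (0 : ℝ) 1, (x + τ • n) + t • (y - x) ∈ closure D := by
    intro t ht
    have e : (x + τ • n) + t • (y - x) = x + τ • (n + (t / τ) • (y - x)) := by
      rw [smul_add, smul_smul, mul_div_cancel₀ _ hτ0.ne']; abel
    rw [e]
    refine subset_closure (hcone x hxr τ hτ0 hτr _ ?_)
    rw [add_sub_cancel_left, norm_smul, Real.norm_of_nonneg (div_nonneg ht.1 hτ0.le), hτ]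
    have : t / (2 * ‖y - x‖ / ε) * ‖y - x‖ = t * ε / 2 := by field_simp
    rw [this]
    nlinarith [ht.2]
  have h1 := hw x (τ • n) (hvert x hxr)
  have h2 := hw y (τ • n) (hvert y hyr)
  have h3 := hw (x + τ • n) (y - x) hhor
  have e : x + τ • n + (y - x) = y + τ • n := by abel
  rw [e] at h3
  rw [norm_smul, Real.norm_of_nonneg hτ0.le] at h1 h2
  have e2 : (1 + 4 * ‖n‖ / ε) * ‖y - x‖ = ‖y - x‖ + 2 * (τ * ‖n‖) := by
    rw [hτ]; field_simp; ring
  rw [NNReal.coe_mul, Real.coe_toNNReal _ (by positivity), Real.dist_eq, dist_comm, dist_eq_norm,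
    mul_assoc, e2, abs_sub_comm]
  have e3 : w y - w x = -(w (y + τ • n) - w y) + (w (y + τ • n) - w (x + τ • n))
      + (w (x + τ • n) - w x) := by ring
  rw [e3]
  calc _ ≤ |-(w (y + τ • n) - w y)| + |w (y + τ • n) - w (x + τ • n)| + |w (x + τ • n) - w x| :=
        abs_add_three _ _ _
    _ ≤ L * (τ * ‖n‖) + L * ‖y - x‖ + L * (τ * ‖n‖) := by
        rw [abs_neg]; gcongr
    _ = _ := by ring

/-- Lipschitz functions belong to `H¹`, with the classical derivative. -/
theorem memH1_of_lipschitzOnWith {D : Set (E d)} (hD : IsOpen D) (hb : Bornology.IsBounded D)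
    {K : ℝ≥0} {w : E d → ℝ} (hw : LipschitzOnWith K w (closure D)) :
    MemH1 D w ∧ ∀ᵐ x ∂(volume.restrict D), DifferentiableAt ℝ w x ∧
      ∀ i, weakPartial D i w x = pd i w x := by
  -- A Lipschitz extension to the whole space makes Rademacher's theorem and global integration by
  -- parts applicable.
  obtain ⟨g, hg, hwg⟩ := hw.extend_real
  have hwgD : ∀ x ∈ D, w x = g x := fun x hx => hwg (subset_closure hx)
  have hfin : IsFiniteMeasure (volume.restrict D) := ⟨by simpa using hb.measure_lt_top⟩
  have hg2 : MemLp g 2 (volume.restrict D) := memLp_restrict_of_continuous hb hg.continuous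
  have hwg2 : w =ᵐ[volume.restrict D] g := by
    filter_upwards [ae_restrict_mem hD.measurableSet] with x hx using hwgD x hx
  have hw2 : MemLp w 2 (volume.restrict D) := (memLp_congr_ae hwg2).2 hg2
  have hl2 : ∀ i : Fin d, MemLp (fun x => lineDeriv ℝ g x (EuclideanSpace.single i 1)) 2
      (volume.restrict D) := fun i =>
    (hg.memLp_lineDeriv (μ := volume.restrict D) (EuclideanSpace.single i 1)).mono_exponent le_top
  have hweak : ∀ i, HasWeakPartial D i w
      (fun x => lineDeriv ℝ g x (EuclideanSpace.single i 1)) := by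
    intro i
    refine ⟨locallyIntegrableOn_of_locallyIntegrable_restrict (hw2.locallyIntegrable (by norm_num)),
      locallyIntegrableOn_of_locallyIntegrable_restrict ((hl2 i).locallyIntegrable (by norm_num)),
      fun ψ hψ hc hs => ?_⟩
    obtain ⟨B, hB⟩ := hψ.lipschitzWith_of_hasCompactSupport hc (by norm_num)
    have h := hg.integral_lineDeriv_mul_eq (μ := volume) hB hc (EuclideanSpace.single i 1)
    have hd : ∀ x, lineDeriv ℝ ψ x (-EuclideanSpace.single i 1) = -pd i ψ x := by
      intro x
      rw [((hψ.differentiable (by norm_num)).differentiableAt).lineDeriv_eq_fderiv, map_neg, pd]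
    simp only [hd] at h
    rw [setIntegral_eq_integral_of_forall_compl_eq_zero (f := fun x =>
      lineDeriv ℝ g x (EuclideanSpace.single i 1) * ψ x) (fun x hx => by
        rw [image_eq_zero_of_notMem_tsupport fun h => hx (hs h), mul_zero]), h]
    have h0 : ∀ x ∉ D, pd i ψ x = 0 := fun x hx => image_eq_zero_of_notMem_tsupport fun h =>
      hx (hs (MollifierFamily.tsupport_pd_subset i ψ h))
    rw [← setIntegral_eq_integral_of_forall_compl_eq_zero (s := D)
      (f := fun x => -pd i ψ x * g x) (fun x hx => by rw [h0 x hx, neg_zero, zero_mul]),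
      ← integral_neg]
    refine setIntegral_congr_fun hD.measurableSet fun x hx => ?_
    change w x * pd i ψ x = -(-pd i ψ x * g x)
    rw [hwgD x hx]; ring
  refine ⟨⟨hw2, fun i => ⟨_, hweak i, hl2 i⟩⟩, ?_⟩
  have h1 : ∀ᵐ x ∂(volume.restrict D), ∀ i, weakPartial D i w x
      = lineDeriv ℝ g x (EuclideanSpace.single i 1) :=
    ae_all_iff.2 fun i => (hweak i).weakPartial_ae_eq hD
  filter_upwards [h1, ae_restrict_of_ae (hg.ae_differentiableAt (μ := volume)),
    ae_restrict_mem hD.measurableSet] with x hx hdx hxD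
  have hev : w =ᶠ[𝓝 x] g := by
    filter_upwards [hD.mem_nhds hxD] with y hy using hwgD y hy
  refine ⟨hev.differentiableAt_iff.2 hdx, fun i => ?_⟩
  rw [hx i, hdx.lineDeriv_eq_fderiv, pd, hev.fderiv_eq]

/-! ### The Taylor remainder in `L²` on a convex set -/


theorem hasDerivAt_comp_homothety {K : Set (E d)} {F : Type*} [NormedAddCommGroup F]
    [NormedSpace ℝ F] {v : E d → F} (hK : Convex ℝ K) {x p : E d} (hx : x ∈ K) (hp : p ∈ K)
    (hv : DifferentiableOn ℝ v K) {r : ℝ} (hr : r ∈ Ioo (0 : ℝ) 1) :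
    HasDerivAt (fun r : ℝ => v (p + r • (x - p)))
      (fderivWithin ℝ v K (p + r • (x - p)) (x - p)) r := by
  have hmem : ∀ t ∈ Icc (0 : ℝ) 1, p + t • (x - p) ∈ K := fun t ht =>
    hK.add_smul_sub_mem hp hx ht
  have h1 := (hv _ (hmem r (Ioo_subset_Icc_self hr))).hasFDerivWithinAt
  have h2 : HasDerivWithinAt (fun r : ℝ => p + r • (x - p)) (x - p) (Icc 0 1) r := by
    simpa using (((hasDerivAt_id r).smul_const (x - p)).const_add p).hasDerivWithinAt
  exact (h1.comp_hasDerivWithinAt r h2 hmem).hasDerivAt (Icc_mem_nhds hr.1 hr.2)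

/-- The derivative in `r` of `v(p + r(x - p)) - r Dv(p + r(x - p))(x - p)` is `-r D²v(x - p, x -
p)`. Expanding at the variable point `x` and evaluating at the fixed `p` gives the weight `r`, which
damps the singularity near `p`. -/
theorem enorm_taylor_remainder_le {K : Set (E d)} (hK : Convex ℝ K)
    (hKi : (interior K).Nonempty) {v : E d → ℝ} (hv : ContDiffOn ℝ 2 v K) {x p : E d}
    (hx : x ∈ K) (hp : p ∈ K) :
    ‖v p - v x - fderivWithin ℝ v K x (p - x)‖ₑ ≤ ‖x - p‖ₑ ^ 2 *
      ∫⁻ r in Ioo (0 : ℝ) 1, ENNReal.ofReal r *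
        ‖iteratedFDerivWithin ℝ 2 v K (p + r • (x - p))‖ₑ := by
  have hu : UniqueDiffOn ℝ K := uniqueDiffOn_convex hK hKi
  have hV1 : ContDiffOn ℝ 1 (fderivWithin ℝ v K) K := hv.fderivWithin hu (by norm_num)
  have hV2 : ContinuousOn (fderivWithin ℝ (fderivWithin ℝ v K) K) K :=
    hV1.continuousOn_fderivWithin hu le_rfl
  have hmem : ∀ t ∈ Icc (0 : ℝ) 1, p + t • (x - p) ∈ K := fun t ht =>
    hK.add_smul_sub_mem hp hx ht
  have hγ : ContinuousOn (fun t : ℝ => p + t • (x - p)) (Icc 0 1) := by fun_prop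
  set g2 : ℝ → ℝ := fun r =>
    fderivWithin ℝ (fderivWithin ℝ v K) K (p + r • (x - p)) (x - p) (x - p) with hg2
  have hc0 : ContinuousOn (fun r : ℝ => v (p + r • (x - p))) (Icc 0 1) :=
    hv.continuousOn.comp hγ hmem
  have hc1 : ContinuousOn (fun r : ℝ => fderivWithin ℝ v K (p + r • (x - p)) (x - p)) (Icc 0 1) :=
    (hV1.continuousOn.comp hγ hmem).clm_apply continuousOn_const
  have hc2 : ContinuousOn g2 (Icc 0 1) :=
    ((hV2.comp hγ hmem).clm_apply continuousOn_const).clm_apply continuousOn_const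
  have hd : ∀ r ∈ Ioo (0 : ℝ) 1, HasDerivAt (fun r : ℝ => v (p + r • (x - p))
      - r * fderivWithin ℝ v K (p + r • (x - p)) (x - p)) (-(r * g2 r)) r := by
    intro r hr
    have h1 := hasDerivAt_comp_homothety hK hx hp (hv.differentiableOn (by norm_num)) hr
    have h2 := (hasDerivAt_comp_homothety hK hx hp (hV1.differentiableOn (by norm_num)) hr).clm_apply
      (hasDerivAt_const r (x - p))
    refine (h1.sub ((hasDerivAt_id r).mul h2)).congr_deriv ?_
    simp [g2]
  have hint : IntervalIntegrable (fun r => -(r * g2 r)) volume 0 1 :=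
    ContinuousOn.intervalIntegrable (by
      rw [uIcc_of_le zero_le_one]; exact (continuousOn_id.mul hc2).neg)
  have hftc := intervalIntegral.integral_eq_sub_of_hasDerivAt_of_le zero_le_one
    (hc0.sub (continuousOn_id.mul hc1)) hd hint
  simp only [Pi.sub_apply, Pi.mul_apply, one_smul, zero_smul, add_zero, id, one_mul, zero_mul, sub_zero,
    add_sub_cancel, intervalIntegral.integral_neg] at hftc
  have e : v p - v x - fderivWithin ℝ v K x (p - x) = ∫ r in (0 : ℝ)..1, r * g2 r := by
    rw [← neg_sub x p, map_neg]
    linarith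
  rw [e, intervalIntegral.integral_of_le zero_le_one, integral_Ioc_eq_integral_Ioo]
  refine (enorm_integral_le_lintegral_enorm _).trans ?_
  rw [← lintegral_const_mul' _ _ (by finiteness)]
  refine setLIntegral_mono' measurableSet_Ioo fun r hr => ?_
  have hxr := hmem r (Ioo_subset_Icc_self hr)
  have h3 : ‖g2 r‖ₑ ≤ ‖iteratedFDerivWithin ℝ 2 v K (p + r • (x - p))‖ₑ * ‖x - p‖ₑ ^ 2 := by
    have h4 : ‖fderivWithin ℝ (fderivWithin ℝ v K) K (p + r • (x - p))‖
        = ‖iteratedFDerivWithin ℝ 2 v K (p + r • (x - p))‖ := by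
      rw [← norm_iteratedFDerivWithin_one _ (hu _ hxr),
        norm_iteratedFDerivWithin_fderivWithin hu hxr]
    have h5 : ‖g2 r‖ ≤ ‖iteratedFDerivWithin ℝ 2 v K (p + r • (x - p))‖ * ‖x - p‖ ^ 2 := by
      rw [← h4, pow_two, ← mul_assoc]
      exact ContinuousLinearMap.le_opNorm₂ _ _ _
    simpa [← ofReal_norm, ENNReal.ofReal_mul, ENNReal.ofReal_pow] using ENNReal.ofReal_le_ofReal h5
  rw [enorm_mul, Real.enorm_of_nonneg hr.1.le]
  calc _ ≤ ENNReal.ofReal r * (‖iteratedFDerivWithin ℝ 2 v K (p + r • (x - p))‖ₑ * ‖x - p‖ₑ ^ 2) := by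
        gcongr
    _ = _ := by ring

theorem lintegral_rpow_neg_half_lt_top :
    ∫⁻ r in Ioo (0 : ℝ) 1, ENNReal.ofReal r ^ (-(1 / 2) : ℝ) < ⊤ := by
  have h := (intervalIntegral.intervalIntegrable_rpow' (a := 0) (b := 1) (r := -(1 / 2))
    (by norm_num)).1.mono_set Ioo_subset_Ioc_self
  refine lt_of_le_of_lt (setLIntegral_mono' measurableSet_Ioo fun r hr => ?_) h.2
  rw [ENNReal.ofReal_rpow_of_pos hr.1]
  exact Real.ofReal_le_enorm _

/-- For `d ≤ 3` the first order Taylor remainder at any point of a convex set is bounded in `L²`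
by the second derivative. -/
theorem lintegral_taylor_remainder_le (hd : d ≤ 3) {K : Set (E d)} (hK : Convex ℝ K)
    (hKc : IsClosed K) (hKi : (interior K).Nonempty) {v : E d → ℝ} (hv : ContDiffOn ℝ 2 v K)
    {δ : ℝ≥0} (hδ : ∀ x ∈ K, ∀ y ∈ K, ‖x - y‖ₑ ≤ δ) {p : E d} (hp : p ∈ K) :
    ∫⁻ x in K, ‖v p - v x - fderivWithin ℝ v K x (p - x)‖ₑ ^ 2 ≤
      (δ ^ 4 * (∫⁻ r in Ioo (0 : ℝ) 1, ENNReal.ofReal r ^ (-(1 / 2) : ℝ)) ^ 2) *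
        ∫⁻ x in K, ‖iteratedFDerivWithin ℝ 2 v K x‖ₑ ^ 2 := by
  classical
  have hu : UniqueDiffOn ℝ K := uniqueDiffOn_convex hK hKi
  set J := ∫⁻ r in Ioo (0 : ℝ) 1, ENNReal.ofReal r ^ (-(1 / 2) : ℝ) with hJ
  -- Extension by zero turns the inner integrals into integrals over the whole space, where
  -- dilations act simply.
  set H : E d → ℝ≥0∞ := K.piecewise (fun x => ‖iteratedFDerivWithin ℝ 2 v K x‖ₑ) 0 with hH
  have hHm : Measurable H := by
    refine ContinuousOn.measurable_piecewise ?_ continuousOn_const hKc.measurableSet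
    exact (hv.continuousOn_iteratedFDerivWithin le_rfl hu).enorm
  have hHK : ∀ x ∈ K, H x = ‖iteratedFDerivWithin ℝ 2 v K x‖ₑ := fun x hx =>
    piecewise_eq_of_mem _ _ _ hx
  have hHint : ∫⁻ x, H x ^ 2 = ∫⁻ x in K, ‖iteratedFDerivWithin ℝ 2 v K x‖ₑ ^ 2 := by
    rw [← lintegral_indicator hKc.measurableSet]
    refine lintegral_congr fun x => ?_
    by_cases hx : x ∈ K <;> simp [hx, hH]
  have hmem : ∀ x ∈ K, ∀ t ∈ Icc (0 : ℝ) 1, p + t • (x - p) ∈ K := fun x hx t ht =>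
    hK.add_smul_sub_mem hp hx ht
  -- Cauchy–Schwarz with the splitting `r = r^(-1/4) · r^(5/4)`: the square of the first factor is
  -- integrable.
  have hpt : ∀ x ∈ K, ‖v p - v x - fderivWithin ℝ v K x (p - x)‖ₑ ^ 2 ≤
      δ ^ 4 * J * ∫⁻ r in Ioo (0 : ℝ) 1,
        (ENNReal.ofReal r ^ (5 / 4 : ℝ) * H (p + r • (x - p))) ^ 2 := by
    intro x hx
    have h1 := enorm_taylor_remainder_le hK hKi hv hx hp
    have h2 : ∫⁻ r in Ioo (0 : ℝ) 1, ENNReal.ofReal r *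
        ‖iteratedFDerivWithin ℝ 2 v K (p + r • (x - p))‖ₑ
        = ∫⁻ r in Ioo (0 : ℝ) 1, ENNReal.ofReal r ^ (-(1 / 4) : ℝ) *
          (ENNReal.ofReal r ^ (5 / 4 : ℝ) * H (p + r • (x - p))) := by
      refine setLIntegral_congr_fun measurableSet_Ioo fun r hr => ?_
      rw [hHK _ (hmem x hx r (Ioo_subset_Icc_self hr)), ← mul_assoc, ← ENNReal.rpow_add _ _
        (by simpa using hr.1) ENNReal.ofReal_ne_top]
      norm_num
    have h3 := sq_lintegral_mul_le (μ := volume.restrict (Ioo (0 : ℝ) 1))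
      (f := fun r => ENNReal.ofReal r ^ (-(1 / 4) : ℝ))
      (g := fun r => ENNReal.ofReal r ^ (5 / 4 : ℝ) * H (p + r • (x - p)))
      (by fun_prop) (Measurable.aemeasurable (by fun_prop))
    have h4 : ∫⁻ r in Ioo (0 : ℝ) 1, (ENNReal.ofReal r ^ (-(1 / 4) : ℝ)) ^ 2 = J := by
      refine lintegral_congr fun r => ?_
      rw [← ENNReal.rpow_natCast, ← ENNReal.rpow_mul]
      norm_num
    rw [h4] at h3
    rw [h2] at h1
    calc _ ≤ ((δ : ℝ≥0∞) ^ 2 * ∫⁻ r in Ioo (0 : ℝ) 1, ENNReal.ofReal r ^ (-(1 / 4) : ℝ) *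
          (ENNReal.ofReal r ^ (5 / 4 : ℝ) * H (p + r • (x - p)))) ^ 2 := by
          refine pow_le_pow_left₀ zero_le (h1.trans ?_) 2
          gcongr
          exact hδ x hx p hp
      _ = δ ^ 4 * (∫⁻ r in Ioo (0 : ℝ) 1, ENNReal.ofReal r ^ (-(1 / 4) : ℝ) *
          (ENNReal.ofReal r ^ (5 / 4 : ℝ) * H (p + r • (x - p)))) ^ 2 := by ring
      _ ≤ _ := (mul_le_mul_right h3 _).trans_eq (mul_assoc _ _ _).symm
  -- The dilation about `p` costs `r^(-d) ≤ r^(-3)`, which is where `d ≤ 3` enters. Together with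
  -- `r^(5/2)` this leaves `r^(-1/2)`, still integrable at `0`.
  have hscale : ∀ r ∈ Ioo (0 : ℝ) 1, ∫⁻ x, H (p + r • (x - p)) ^ 2
      ≤ ENNReal.ofReal r ^ (-3 : ℝ) * ∫⁻ x, H x ^ 2 := by
    intro r hr
    have h := lintegral_comp_le (μ := (volume : Measure (E d))) (ν := volume)
      (F := fun x => p + r • (x - p)) (s := univ) (c := ENNReal.ofReal r ^ (-3 : ℝ))
      (f := fun x => H x ^ 2) MeasurableSet.univ (Measurable.aemeasurable (by fun_prop)) ?_
      (by fun_prop)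
    · rw [setLIntegral_univ] at h
      exact h.trans (mul_le_mul_right (setLIntegral_le_lintegral _ _) _)
    · intro A _
      have e : (fun x => p + r • (x - p)) '' A = AffineMap.homothety p r '' A := by
        refine image_congr fun x _ => ?_
        simp [AffineMap.homothety_apply, add_comm]
      rw [e, Measure.addHaar_image_homothety, ← mul_assoc, finrank_euclideanSpace_fin,
        abs_of_nonneg (pow_nonneg hr.1.le _), ENNReal.ofReal_pow hr.1.le, ← ENNReal.rpow_natCast,
        ← ENNReal.rpow_add _ _ (by simpa using hr.1) ENNReal.ofReal_ne_top]
      refine le_mul_of_one_le_left zero_le ?_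
      rw [← ENNReal.rpow_zero (x := ENNReal.ofReal r)]
      refine ENNReal.rpow_le_rpow_of_exponent_ge (by simpa using hr.2.le) ?_
      have : (d : ℝ) ≤ 3 := by exact_mod_cast hd
      linarith
  calc _ ≤ ∫⁻ x in K, δ ^ 4 * J * ∫⁻ r in Ioo (0 : ℝ) 1,
        (ENNReal.ofReal r ^ (5 / 4 : ℝ) * H (p + r • (x - p))) ^ 2 :=
        setLIntegral_mono' hKc.measurableSet hpt
    _ ≤ ∫⁻ x, δ ^ 4 * J * ∫⁻ r in Ioo (0 : ℝ) 1,
        (ENNReal.ofReal r ^ (5 / 4 : ℝ) * H (p + r • (x - p))) ^ 2 := setLIntegral_le_lintegral _ _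
    _ = δ ^ 4 * J * ∫⁻ r in Ioo (0 : ℝ) 1, ∫⁻ x,
        (ENNReal.ofReal r ^ (5 / 4 : ℝ) * H (p + r • (x - p))) ^ 2 := by
        rw [lintegral_const_mul' _ _ (ENNReal.mul_ne_top (by finiteness)
          lintegral_rpow_neg_half_lt_top.ne), lintegral_lintegral_swap]
        refine Measurable.aemeasurable ?_
        fun_prop
    _ ≤ δ ^ 4 * J * ∫⁻ r in Ioo (0 : ℝ) 1, ENNReal.ofReal r ^ (-(1 / 2) : ℝ) * ∫⁻ x, H x ^ 2 := by
        refine mul_le_mul_right (setLIntegral_mono' measurableSet_Ioo fun r hr => ?_) _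
        simp only [mul_pow]
        rw [lintegral_const_mul' _ _ (by finiteness)]
        refine (mul_le_mul_right (hscale r hr) _).trans_eq ?_
        rw [← mul_assoc, ← ENNReal.rpow_natCast, ← ENNReal.rpow_mul, ← ENNReal.rpow_add _ _
          (by simpa using hr.1) ENNReal.ofReal_ne_top]
        norm_num
    _ = _ := by
        rw [lintegral_mul_const _ (by fun_prop), hHint]
        ring

/-! ### The reference simplex -/


theorem convex_refSimplex : Convex ℝ (refSimplex d) := convex_convexHull ℝ _

theorem isCompact_refSimplex : IsCompact (refSimplex d) :=
  (Set.finite_range _).isCompact_convexHull (𝕜 := ℝ)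

theorem refVertex_mem_refSimplex (k : Fin (d + 1)) : refVertex d k ∈ refSimplex d :=
  subset_convexHull ℝ _ (mem_range_self k)

theorem zero_mem_refSimplex : (0 : E d) ∈ refSimplex d := refVertex_mem_refSimplex 0

theorem single_mem_refSimplex (i : Fin d) : EuclideanSpace.single i 1 ∈ refSimplex d := by
  simpa [refVertex] using refVertex_mem_refSimplex (d := d) i.succ

theorem refFace_subset (s : Finset (Fin (d + 1))) : refFace s ⊆ refSimplex d :=
  convexHull_mono (image_subset_range _ _)

theorem sum_smul_refVertex_mem {w : Fin (d + 1) → ℝ} (hw : w ∈ stdSimplex ℝ (Fin (d + 1)))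
    (π : Equiv.Perm (Fin (d + 1))) : ∑ k, w k • refVertex d (π k) ∈ refSimplex d :=
  convex_refSimplex.sum_mem (fun k _ => hw.1 k) hw.2 fun _ _ => refVertex_mem_refSimplex _

theorem exists_weights_of_mem_refFace {s : Finset (Fin (d + 1))} {x : E d} (hx : x ∈ refFace s) :
    ∃ w ∈ stdSimplex ℝ (Fin (d + 1)), (∀ k, k ∉ s → w k = 0) ∧ ∑ k, w k • refVertex d k = x := by
  let S : Set (Fin (d + 1) → ℝ) := stdSimplex ℝ (Fin (d + 1)) ∩ {w | ∀ k, k ∉ s → w k = 0}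
  have hS : Convex ℝ S := (convex_stdSimplex ℝ _).inter fun w hw w' hw' a b _ _ _ _ hk => by
    simp [hw _ hk, hw' _ hk]
  have hsub : refFace s ⊆ (Fintype.linearCombination ℝ (refVertex d)) '' S := by
    refine convexHull_min ?_ (hS.linear_image _)
    rintro _ ⟨k, hk, rfl⟩
    refine ⟨Pi.single k 1, ⟨single_mem_stdSimplex ℝ k, fun l hl => ?_⟩, ?_⟩
    · exact Pi.single_eq_of_ne (fun h => hl (by rwa [h])) _
    · simp
  obtain ⟨w, hw, rfl⟩ := hsub hx
  exact ⟨w, hw.1, hw.2, rfl⟩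

theorem interior_refSimplex_nonempty : (interior (refSimplex d)).Nonempty := by
  have hopen : IsOpen {x : E d | (∀ i, 0 < x i) ∧ ∑ i, x i < 1} := by
    refine IsOpen.inter (s := {x : E d | ∀ i, 0 < x i}) ?_ (isOpen_lt (f := fun x : E d => ∑ i, x i) (by fun_prop) continuous_const)
    rw [ofPred_forall]
    exact isOpen_iInter_of_finite fun i =>
      isOpen_lt (g := fun x : E d => x i) continuous_const (by fun_prop)
  have hsub : {x : E d | (∀ i, 0 < x i) ∧ ∑ i, x i < 1} ⊆ refSimplex d := by
    rintro x ⟨hx, hs⟩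
    have hw : (Fin.cons (1 - ∑ i, x i) (fun i => x i) : Fin (d + 1) → ℝ)
        ∈ stdSimplex ℝ (Fin (d + 1)) := by
      refine ⟨fun k => ?_, by simp [Fin.sum_univ_succ]⟩
      refine Fin.cases ?_ (fun i => ?_) k
      · simpa using hs.le
      · simpa using (hx i).le
    have := sum_smul_refVertex_mem hw (Equiv.refl _)
    convert this using 1
    ext j
    simp [Fin.sum_univ_succ, refVertex, Finset.sum_apply, Pi.single_apply]
  refine ⟨WithLp.toLp 2 fun _ => 1 / (d + 1), interior_maximal hsub hopen ⟨fun i => ?_, ?_⟩⟩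
  · simp only; positivity
  · simp only [Finset.sum_const, Finset.card_univ, Fintype.card_fin, nsmul_eq_mul]
    rw [mul_one_div, div_lt_one (by positivity)]
    linarith

theorem uniqueDiffOn_refSimplex : UniqueDiffOn ℝ (refSimplex d) :=
  uniqueDiffOn_convex convex_refSimplex interior_refSimplex_nonempty

theorem volume_refSimplex_pos : 0 < volume (refSimplex d) :=
  (isOpen_interior.measure_pos _ interior_refSimplex_nonempty).trans_le
    (measure_mono interior_subset)

theorem exists_enorm_sub_le_refSimplex (d : ℕ) : ∃ δ : ℝ≥0, 0 < δ ∧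
    ∀ x ∈ refSimplex d, ∀ y ∈ refSimplex d, ‖x - y‖ ≤ δ := by
  refine ⟨Real.toNNReal (Metric.diam (refSimplex d)) + 1, by positivity, fun x hx y hy => ?_⟩
  rw [← dist_eq_norm]
  have h := Metric.dist_le_diam_of_mem isCompact_refSimplex.isBounded hx hy
  have := Real.le_coe_toNNReal (Metric.diam (refSimplex d))
  push_cast
  linarith

theorem volume_refFace {s : Finset (Fin (d + 1))} (hs : s ≠ Finset.univ) :
    volume (refFace s : Set (E d)) = 0 := by
  classical
  rcases s.eq_empty_or_nonempty with rfl | hne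
  · simp [refFace]
  refine measure_mono_null (convexHull_subset_affineSpan _)
    (Measure.addHaar_affineSubspace volume _ fun htop => ?_)
  obtain ⟨n, hn⟩ : ∃ n, s.card = n + 1 := ⟨s.card - 1, by have := hne.card_pos; omega⟩
  have h := finrank_vectorSpan_image_finset_le ℝ (refVertex d) s hn
  rw [Finset.coe_image, ← direction_affineSpan, htop, AffineSubspace.direction_top, finrank_top,
    finrank_euclideanSpace_fin] at h
  have h2 := Finset.card_lt_univ_of_notMem (s := s)
    (Classical.not_forall.1 fun h => hs (Finset.eq_univ_iff_forall.2 h)).choose_spec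
  rw [Fintype.card_fin] at h2
  omega

theorem exists_taylor_remainder_refSimplex (hd : d ≤ 3) : ∃ C : ℝ≥0, ∀ v : E d → ℝ,
    ContDiffOn ℝ 2 v (refSimplex d) → ∀ p ∈ refSimplex d,
      ∫⁻ x in refSimplex d, ‖v p - v x - fderivWithin ℝ v (refSimplex d) x (p - x)‖ₑ ^ 2 ≤
        C * ∫⁻ x in refSimplex d, ‖iteratedFDerivWithin ℝ 2 v (refSimplex d) x‖ₑ ^ 2 := by
  obtain ⟨δ, -, hδ⟩ := exists_enorm_sub_le_refSimplex d
  have hJ := lintegral_rpow_neg_half_lt_top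
  refine ⟨(δ ^ 4 * (∫⁻ r in Ioo (0 : ℝ) 1, ENNReal.ofReal r ^ (-(1 / 2) : ℝ)) ^ 2).toNNReal,
    fun v hv p hp => ?_⟩
  rw [ENNReal.coe_toNNReal (by finiteness)]
  refine lintegral_taylor_remainder_le hd convex_refSimplex isCompact_refSimplex.isClosed
    interior_refSimplex_nonempty hv (fun x hx y hy => ?_) hp
  rw [← ofReal_norm, ← ENNReal.ofReal_coe_nnreal]
  exact ENNReal.ofReal_le_ofReal (hδ x hx y hy)

/-! ### Element maps -/

/-- Scaled bounds for the map from the reference simplex to an element of size `h`. -/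
structure IsElementMap (F : E d → E d) (h Λ : ℝ) : Prop where
  contDiffOn : ContDiffOn ℝ 2 F (refSimplex d)
  norm_sub_le : ∀ x ∈ refSimplex d, ∀ y ∈ refSimplex d, ‖F x - F y‖ ≤ Λ * h * ‖x - y‖
  le_norm_sub : ∀ x ∈ refSimplex d, ∀ y ∈ refSimplex d, h * ‖x - y‖ ≤ Λ * ‖F x - F y‖
  norm_fderiv_le : ∀ x ∈ refSimplex d, ‖fderivWithin ℝ F (refSimplex d) x‖ ≤ Λ * h
  le_norm_fderiv : ∀ x ∈ refSimplex d, ∀ v,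
    h * ‖v‖ ≤ Λ * ‖fderivWithin ℝ F (refSimplex d) x v‖
  norm_iteratedFDeriv_le : ∀ x ∈ refSimplex d,
    ‖iteratedFDerivWithin ℝ 2 F (refSimplex d) x‖ ≤ (Λ * h) ^ 2

/-- The mean value inequality for `F ∘ B⁻¹ - id` on the convex set `B K̂`. -/
theorem norm_sub_sub_le_of_fderivWithin {F : E d → E d} {B : E d ≃L[ℝ] E d} {c : ℝ}
    (hF : DifferentiableOn ℝ F (refSimplex d))
    (hB : ∀ x ∈ refSimplex d, ‖(fderivWithin ℝ F (refSimplex d) x - (B : E d →L[ℝ] E d)).comp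
        (B.symm : E d →L[ℝ] E d)‖ ≤ c) {x y : E d} (hx : x ∈ refSimplex d)
    (hy : y ∈ refSimplex d) : ‖F y - F x - B (y - x)‖ ≤ c * ‖B (y - x)‖ := by
  have hmaps : MapsTo B.symm (B '' refSimplex d) (refSimplex d) := by
    rintro _ ⟨z, hz, rfl⟩
    simpa using hz
  have h := Convex.norm_image_sub_le_of_norm_hasFDerivWithin_le' (𝕜 := ℝ)
    (f := F ∘ B.symm) (s := B '' refSimplex d) (φ := ContinuousLinearMap.id ℝ (E d)) (C := c)
    (f' := fun z => (fderivWithin ℝ F (refSimplex d) (B.symm z)).comp (B.symm : E d →L[ℝ] E d))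
    (fun z hz => (hF _ (hmaps hz)).hasFDerivWithinAt.comp z B.symm.hasFDerivWithinAt hmaps)
    (fun z hz => ?_) (convex_refSimplex.linear_image (B : E d →ₗ[ℝ] E d))
    (mem_image_of_mem B hx) (mem_image_of_mem B hy)
  · simpa using h
  · refine le_trans (le_of_eq ?_) (hB _ (hmaps hz))
    congr 1
    ext1 v
    simp

/-- Since `c < 1`, increments and derivatives of `F` are comparable with those of `B`, so two-sided
bounds for `B` suffice. The upper one comes from the diameter of the element, the lower one from the
inscribed ball. -/
theorem exists_isElementMap (d : ℕ) {κ c : ℝ} (c₂ : ℝ) (hκ : 0 < κ) (hc : c < 1) :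
    ∃ Λ : ℝ, 0 < Λ ∧ ∀ (F : E d → E d) (h : ℝ) (B : E d ≃L[ℝ] E d) (z : E d), 0 < h →
      ContDiffOn ℝ 2 F (refSimplex d) →
      (∀ x ∈ refSimplex d, ∀ y ∈ refSimplex d, ‖F x - F y‖ ≤ h) →
      (∀ x ∈ refSimplex d, ‖(fderivWithin ℝ F (refSimplex d) x - (B : E d →L[ℝ] E d)).comp
        (B.symm : E d →L[ℝ] E d)‖ ≤ c ∧
        ‖iteratedFDerivWithin ℝ 2 F (refSimplex d) x‖ ≤ c₂ * ‖(B : E d →L[ℝ] E d)‖ ^ 2) →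
      Metric.closedBall z (h / κ) ⊆ B '' refSimplex d → IsElementMap F h Λ := by
  obtain ⟨δ, hδ0, hδ⟩ := exists_enorm_sub_le_refSimplex d
  obtain ⟨z₀, hz₀⟩ := interior_refSimplex_nonempty (d := d)
  obtain ⟨ρ, hρ, hball⟩ := Metric.nhds_basis_closedBall.mem_iff.1 (mem_interior_iff_mem_nhds.1 hz₀)
  have hc' : 0 < 1 - c := sub_pos.2 hc
  -- `‖B‖ ≤ b h`: the reference simplex contains a ball of radius `ρ`, and its image under `F` has
  -- diameter at most `h`.
  set b := 1 / ((1 - c) * ρ) with hb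
  have hb0 : 0 < b := by positivity
  have hδ' : (0 : ℝ) < δ := hδ0
  -- `‖B⁻¹‖ ≤ δ κ / h`: points of `B K̂` at distance `h / κ` have preimages at distance at most `δ`.
  -- The factor `1 - c` passes from `B` to `F`.
  set e := δ * κ / (1 - c) with he
  have he0 : 0 < e := by positivity
  refine ⟨(2 + |c₂|) * b + e, by positivity, fun F h B z hh hF hdiam hB hz => ?_⟩
  have hc0 : 0 ≤ c := (norm_nonneg _).trans (hB 0 zero_mem_refSimplex).1
  have hsub : ∀ x ∈ refSimplex d, ∀ y ∈ refSimplex d,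
      ‖F x - F y - B (x - y)‖ ≤ c * ‖B (x - y)‖ := fun x hx y hy =>
    norm_sub_sub_le_of_fderivWithin (hF.differentiableOn (by norm_num)) (fun x hx => (hB x hx).1)
      hy hx
  have hder : ∀ x ∈ refSimplex d, ∀ v,
      ‖fderivWithin ℝ F (refSimplex d) x v - B v‖ ≤ c * ‖B v‖ := by
    intro x hx v
    have := ContinuousLinearMap.le_of_opNorm_le _ (hB x hx).1 (B v)
    simpa using this
  have tri1 : ∀ {p q : E d}, ‖p - q‖ ≤ c * ‖q‖ → ‖p‖ ≤ 2 * ‖q‖ := by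
    intro p q hpq
    have := norm_le_norm_add_norm_sub' p q
    nlinarith [norm_nonneg q]
  have tri2 : ∀ {p q : E d}, ‖p - q‖ ≤ c * ‖q‖ → (1 - c) * ‖q‖ ≤ ‖p‖ := by
    intro p q hpq
    have := norm_le_norm_add_norm_sub p q
    linarith
  have hBle : ∀ v, ‖B v‖ ≤ b * h * ‖v‖ := by
    intro v
    rcases eq_or_ne v 0 with rfl | hv
    · simp
    have hv0 : 0 < ‖v‖ := norm_pos_iff.2 hv
    have hmem : z₀ + (ρ / ‖v‖) • v ∈ refSimplex d := hball (by
      rw [mem_closedBall_iff_norm, add_sub_cancel_left, norm_smul, Real.norm_of_nonneg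
        (by positivity), div_mul_cancel₀ _ hv0.ne'])
    have h1 := tri2 (hsub _ hmem _ (interior_subset hz₀))
    rw [add_sub_cancel_left, map_smul, norm_smul, Real.norm_of_nonneg (by positivity)] at h1
    have h2 := h1.trans (hdiam _ hmem _ (interior_subset hz₀))
    rw [hb]
    have h3 : (1 - c) * (ρ / ‖v‖ * ‖B v‖) = ((1 - c) * ρ) * ‖B v‖ / ‖v‖ := by ring
    rw [h3, div_le_iff₀ hv0] at h2
    rw [mul_assoc, one_div_mul_eq_div, le_div_iff₀ (by positivity)]
    linarith
  have hBge : ∀ v, h * ‖v‖ ≤ δ * κ * ‖B v‖ := by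
    intro v
    rcases eq_or_ne v 0 with rfl | hv
    · simp
    have hv0 : 0 < ‖B v‖ := norm_pos_iff.2 (by simpa using hv)
    obtain ⟨x, hx, hxe⟩ := hz (show z + (h / κ / ‖B v‖) • B v ∈ Metric.closedBall z (h / κ) by
      rw [mem_closedBall_iff_norm, add_sub_cancel_left, norm_smul, Real.norm_of_nonneg
        (by positivity), div_mul_cancel₀ _ hv0.ne'])
    obtain ⟨y, hy, hye⟩ := hz (Metric.mem_closedBall_self (by positivity : 0 ≤ h / κ))
    have h1 : x - y = (h / κ / ‖B v‖) • v := by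
      apply B.injective
      rw [map_sub, hxe, hye, map_smul, add_sub_cancel_left]
    have h2 := hδ x hx y hy
    rw [h1, norm_smul, Real.norm_of_nonneg (by positivity)] at h2
    have h3 : h / κ / ‖B v‖ * ‖v‖ = h * ‖v‖ / (κ * ‖B v‖) := by
      field_simp
    rw [h3, div_le_iff₀ (by positivity)] at h2
    linarith
  have hge : ∀ {p : E d} {v : E d}, ‖p - B v‖ ≤ c * ‖B v‖ →
      h * ‖v‖ ≤ ((2 + |c₂|) * b + e) * ‖p‖ := by
    intro p v hp
    have h1 : ‖B v‖ ≤ ‖p‖ / (1 - c) := by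
      rw [le_div_iff₀ hc']; linarith [tri2 hp]
    calc h * ‖v‖ ≤ δ * κ * ‖B v‖ := hBge v
      _ ≤ δ * κ * (‖p‖ / (1 - c)) := by gcongr
      _ = e * ‖p‖ := by rw [he]; ring
      _ ≤ _ := by gcongr; linarith [show 0 ≤ (2 + |c₂|) * b by positivity]
  have hle : ∀ {p : E d} {v : E d}, ‖p - B v‖ ≤ c * ‖B v‖ →
      ‖p‖ ≤ ((2 + |c₂|) * b + e) * h * ‖v‖ := by
    intro p v hp
    calc ‖p‖ ≤ 2 * ‖B v‖ := tri1 hp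
      _ ≤ 2 * (b * h * ‖v‖) := by gcongr; exact hBle v
      _ = (2 * b) * h * ‖v‖ := by ring
      _ ≤ _ := by
        gcongr
        nlinarith [abs_nonneg c₂]
  refine ⟨hF, fun x hx y hy => hle (hsub x hx y hy), fun x hx y hy => hge (hsub x hx y hy),
    fun x hx => ContinuousLinearMap.opNorm_le_bound _ (by positivity) fun v => hle (hder x hx v),
    fun x hx v => hge (hder x hx v), fun x hx => (hB x hx).2.trans ?_⟩
  have hBn : ‖(B : E d →L[ℝ] E d)‖ ≤ b * h :=
    ContinuousLinearMap.opNorm_le_bound _ (by positivity) hBle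
  calc c₂ * ‖(B : E d →L[ℝ] E d)‖ ^ 2 ≤ |c₂| * (b * h) ^ 2 := by
        gcongr; exact le_abs_self _
    _ ≤ (2 + |c₂|) ^ 2 * (b * h) ^ 2 := by
        gcongr; nlinarith [abs_nonneg c₂]
    _ = ((2 + |c₂|) * b * h) ^ 2 := by ring
    _ ≤ _ := by gcongr; linarith

/-! ### Estimates on one element -/


/-- The sum of the absolute values of all partial derivatives of order at most two. -/
def derivSum (φ : E d → ℝ) (x : E d) : ℝ :=
  |φ x| + ∑ i, |pd i φ x| + ∑ i, ∑ j, |pd j (pd i φ) x|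

theorem derivSum_nonneg (φ : E d → ℝ) (x : E d) : 0 ≤ derivSum φ x := by
  unfold derivSum; positivity

theorem continuous_derivSum {φ : E d → ℝ} (hφ : ContDiff ℝ ∞ φ) : Continuous (derivSum φ) := by
  have h0 := hφ.continuous
  have h1 : ∀ i, Continuous (pd i φ) := fun i => (contDiff_pd hφ i).continuous
  have h2 : ∀ i j, Continuous (pd j (pd i φ)) := fun i j =>
    (contDiff_pd (contDiff_pd hφ i) j).continuous
  unfold derivSum
  fun_prop

theorem norm_fderiv_le_derivSum (φ : E d → ℝ) (x : E d) : ‖fderiv ℝ φ x‖ ≤ derivSum φ x := by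
  have h := norm_le_sum_apply_single (fderiv ℝ φ x)
  have h2 : ∑ i, ‖fderiv ℝ φ x (EuclideanSpace.single i 1)‖ = ∑ i, |pd i φ x| := rfl
  unfold derivSum
  have h3 : 0 ≤ ∑ i, ∑ j, |pd j (pd i φ) x| := by positivity
  linarith [abs_nonneg (φ x)]

theorem norm_iteratedFDeriv_le_derivSum {φ : E d → ℝ} (hφ : ContDiff ℝ ∞ φ) {k : ℕ} (hk : k ≤ 2)
    (x : E d) : ‖iteratedFDeriv ℝ k φ x‖ ≤ derivSum φ x := by
  have hf : DifferentiableAt ℝ (fderiv ℝ φ) x :=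
    ((hφ.fderiv_right (m := ∞) (by norm_cast)).differentiable (by norm_num)).differentiableAt
  interval_cases k
  · rw [norm_iteratedFDeriv_zero, Real.norm_eq_abs]
    unfold derivSum
    have h2 : 0 ≤ ∑ i, |pd i φ x| := by positivity
    have h3 : 0 ≤ ∑ i, ∑ j, |pd j (pd i φ) x| := by positivity
    linarith
  · rw [← norm_iteratedFDeriv_fderiv, norm_iteratedFDeriv_zero]
    exact norm_fderiv_le_derivSum φ x
  · rw [← norm_iteratedFDeriv_fderiv, ← norm_iteratedFDeriv_fderiv, norm_iteratedFDeriv_zero]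
    refine (norm_le_sum_apply_single _).trans ?_
    have h1 : ∀ j, ‖fderiv ℝ (fderiv ℝ φ) x (EuclideanSpace.single j 1)‖
        ≤ ∑ i, |pd j (pd i φ) x| := by
      intro j
      refine (norm_le_sum_apply_single _).trans (Finset.sum_le_sum fun i _ => le_of_eq ?_)
      rw [Real.norm_eq_abs]
      congr 1
      have : pd i φ = fun y => fderiv ℝ φ y (EuclideanSpace.single i 1) := rfl
      rw [pd, this, fderiv_clm_apply hf (by fun_prop)]
      simp
    refine (Finset.sum_le_sum fun j _ => h1 j).trans ?_
    rw [Finset.sum_comm]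
    unfold derivSum
    have h2 : 0 ≤ ∑ i, |pd i φ x| := by positivity
    linarith [abs_nonneg (φ x)]

/-- The linear part of the affine function on the reference simplex with vertex values `U`. -/
def interpLin (U : E d → ℝ) : E d →L[ℝ] ℝ :=
  ∑ i, (U (EuclideanSpace.single i 1) - U 0) • EuclideanSpace.proj i

theorem interpLin_single (U : E d → ℝ) (i : Fin d) :
    interpLin U (EuclideanSpace.single i 1) = U (EuclideanSpace.single i 1) - U 0 := by
  simp [interpLin]

/-- In barycentric coordinates the interpolant depends only on weights and vertex values. The
permutation accommodates the relabelling of vertices across a common face. -/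
theorem interpLin_sum (U : E d → ℝ) {w : Fin (d + 1) → ℝ} (hw : ∑ k, w k = 1)
    (π : Equiv.Perm (Fin (d + 1))) :
    U 0 + interpLin U (∑ k, w k • refVertex d (π k)) = ∑ k, w k * U (refVertex d (π k)) := by
  have h : ∀ k, interpLin U (refVertex d k) = U (refVertex d k) - U 0 := by
    intro k
    refine Fin.cases ?_ (fun i => ?_) k
    · simp [refVertex]
    · simp [refVertex, interpLin_single]
  simp only [map_sum, map_smul, h, smul_eq_mul, mul_sub, Finset.sum_sub_distrib, ← Finset.sum_mul,
    hw]
  ring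

namespace IsElementMap

variable {F : E d → E d} {h Λ : ℝ}

theorem lipschitzOnWith (hF : IsElementMap F h Λ) (hh : 0 < h) (hΛ : 0 < Λ) :
    LipschitzOnWith (Λ * h).toNNReal F (refSimplex d) :=
  LipschitzOnWith.of_dist_le_mul fun x hx y hy => by
    rw [dist_eq_norm, dist_eq_norm, Real.coe_toNNReal _ (by positivity)]
    exact hF.norm_sub_le x hx y hy

theorem injOn (hF : IsElementMap F h Λ) (hh : 0 < h) : InjOn F (refSimplex d) := by
  intro x hx y hy hxy
  have := hF.le_norm_sub x hx y hy
  rw [hxy, sub_self, norm_zero, mul_zero] at this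
  have h0 : ‖x - y‖ ≤ 0 := by
    by_contra hcon
    nlinarith
  exact sub_eq_zero.1 (norm_le_zero_iff.1 h0)

theorem lintegral_image_le (hF : IsElementMap F h Λ) (hh : 0 < h) (hΛ : 0 < Λ)
    {f : E d → ℝ≥0∞} (hf : Measurable f) :
    ∫⁻ y in F '' refSimplex d, f y ≤ ENNReal.ofReal (Λ * h) ^ d *
      ∫⁻ x in refSimplex d, f (F x) := by
  refine RobinFE.lintegral_image_le isCompact_refSimplex.measurableSet
    (hF.contDiffOn.continuousOn.aemeasurable isCompact_refSimplex.measurableSet) (fun A hA => ?_) hf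
  have := euclideanHausdorffMeasure_image_le ((hF.lipschitzOnWith hh hΛ).mono hA) d
  simpa [EuclideanSpace.euclideanHausdorffMeasure_eq_volume, ENNReal.ofReal] using this

theorem lintegral_comp_le (hF : IsElementMap F h Λ) (hh : 0 < h) (hΛ : 0 < Λ)
    {f : E d → ℝ≥0∞} (hf : Measurable f) :
    ∫⁻ x in refSimplex d, f (F x) ≤ ENNReal.ofReal (Λ / h) ^ d *
      ∫⁻ y in F '' refSimplex d, f y := by
  refine RobinFE.lintegral_comp_le isCompact_refSimplex.measurableSet
    (hF.contDiffOn.continuousOn.aemeasurable isCompact_refSimplex.measurableSet) (fun A hA => ?_) hf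
  have := euclideanHausdorffMeasure_le_image (F := F) (s := A) (K := (Λ / h).toNNReal)
    (fun x hx y hy => ?_) d
  · simpa [EuclideanSpace.euclideanHausdorffMeasure_eq_volume, ENNReal.ofReal] using this
  · rw [Real.coe_toNNReal _ (by positivity), dist_eq_norm, dist_eq_norm, div_mul_eq_mul_div,
      le_div_iff₀ hh, mul_comm]
    exact hF.le_norm_sub x (hA hx) y (hA hy)

/-- This is the source of the powers of `h`. As `F` is not affine, lower order derivatives of `φ`
also enter, but they come with `D²F`, which is again of order `h²`. -/
theorem norm_iteratedFDerivWithin_comp_le (hF : IsElementMap F h Λ) {φ : E d → ℝ}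
    (hφ : ContDiff ℝ ∞ φ) {x : E d} (hx : x ∈ refSimplex d) :
    ‖iteratedFDerivWithin ℝ 2 (φ ∘ F) (refSimplex d) x‖ ≤ 2 * derivSum φ (F x) * (Λ * h) ^ 2 := by
  have := _root_.norm_iteratedFDerivWithin_comp_le (𝕜 := ℝ) (n := 2) (N := 2) (t := univ) (g := φ)
    (f := F) (s := refSimplex d) (x := x) (C := derivSum φ (F x)) (D := Λ * h)
    (hφ.of_le (by norm_cast)).contDiffOn hF.contDiffOn le_rfl uniqueDiffOn_univ
    uniqueDiffOn_refSimplex (mapsTo_univ _ _) hx (fun i hi => ?_) (fun i hi hi2 => ?_)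
  · simpa using this
  · rw [iteratedFDerivWithin_univ]
    exact norm_iteratedFDeriv_le_derivSum hφ hi _
  · interval_cases i
    · rw [norm_iteratedFDerivWithin_one _ (uniqueDiffOn_refSimplex _ hx), pow_one]
      exact hF.norm_fderiv_le x hx
    · exact hF.norm_iteratedFDeriv_le x hx

theorem lintegral_iteratedFDerivWithin_comp_le (hF : IsElementMap F h Λ) (hh : 0 < h) (hΛ : 0 < Λ)
    {φ : E d → ℝ} (hφ : ContDiff ℝ ∞ φ) :
    ∫⁻ x in refSimplex d, ‖iteratedFDerivWithin ℝ 2 (φ ∘ F) (refSimplex d) x‖ₑ ^ 2 ≤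
      ENNReal.ofReal (4 * (Λ * h) ^ 4 * (Λ / h) ^ d) *
        ∫⁻ y in F '' refSimplex d, ‖derivSum φ y‖ₑ ^ 2 := by
  have hm := (continuous_derivSum hφ).measurable
  calc _ ≤ ∫⁻ x in refSimplex d, ENNReal.ofReal (4 * (Λ * h) ^ 4) * ‖derivSum φ (F x)‖ₑ ^ 2 := by
        refine setLIntegral_mono' isCompact_refSimplex.measurableSet fun x hx => ?_
        rw [Real.enorm_of_nonneg (derivSum_nonneg _ _), ← ofReal_norm, ← ENNReal.ofReal_pow
          (norm_nonneg _), ← ENNReal.ofReal_pow (derivSum_nonneg _ _), ← ENNReal.ofReal_mul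
          (by positivity)]
        refine ENNReal.ofReal_le_ofReal ?_
        refine (pow_le_pow_left₀ (norm_nonneg _)
          (hF.norm_iteratedFDerivWithin_comp_le hφ hx) 2).trans_eq (by ring)
    _ = ENNReal.ofReal (4 * (Λ * h) ^ 4) * ∫⁻ x in refSimplex d, ‖derivSum φ (F x)‖ₑ ^ 2 :=
        lintegral_const_mul' _ _ ENNReal.ofReal_ne_top
    _ ≤ ENNReal.ofReal (4 * (Λ * h) ^ 4) * (ENNReal.ofReal (Λ / h) ^ d *
          ∫⁻ y in F '' refSimplex d, ‖derivSum φ y‖ₑ ^ 2) := by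
        gcongr
        exact hF.lintegral_comp_le hh hΛ (f := fun y => ‖derivSum φ y‖ₑ ^ 2) (by fun_prop)
    _ = _ := by
        rw [← mul_assoc, ← ENNReal.ofReal_pow (by positivity), ← ENNReal.ofReal_mul (by positivity)]

end IsElementMap

namespace IsElementMap

variable {F : E d → E d} {h Λ : ℝ}

theorem norm_le_norm_comp_fderiv (hF : IsElementMap F h Λ) (hh : 0 < h) (hΛ : 0 < Λ) {x : E d}
    (hx : x ∈ refSimplex d) (T : E d →L[ℝ] ℝ) :
    ‖T‖ ≤ Λ / h * ‖T.comp (fderivWithin ℝ F (refSimplex d) x)‖ := by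
  set A := fderivWithin ℝ F (refSimplex d) x
  have hinj : Function.Injective A := by
    refine (injective_iff_map_eq_zero A).2 fun v hv => ?_
    have := hF.le_norm_fderiv x hx v
    rw [hv, norm_zero, mul_zero] at this
    have h0 : ‖v‖ ≤ 0 := by
      by_contra hcon
      nlinarith
    exact norm_le_zero_iff.1 h0
  have hsurj : Function.Surjective A := LinearMap.injective_iff_surjective.1 hinj
  refine T.opNorm_le_bound (by positivity) fun u => ?_
  obtain ⟨v, rfl⟩ := hsurj u
  have h1 : ‖v‖ ≤ Λ / h * ‖A v‖ := by
    rw [div_mul_eq_mul_div, le_div_iff₀ hh, mul_comm]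
    exact hF.le_norm_fderiv x hx v
  calc ‖T (A v)‖ = ‖T.comp A v‖ := rfl
    _ ≤ ‖T.comp A‖ * ‖v‖ := ContinuousLinearMap.le_opNorm _ _
    _ ≤ ‖T.comp A‖ * (Λ / h * ‖A v‖) := by gcongr
    _ = _ := by ring

theorem fderivWithin_comp (hF : IsElementMap F h Λ) {φ : E d → ℝ} {x : E d}
    (hx : x ∈ refSimplex d) (hφ : DifferentiableAt ℝ φ (F x)) :
    fderivWithin ℝ (φ ∘ F) (refSimplex d) x
      = (fderiv ℝ φ (F x)).comp (fderivWithin ℝ F (refSimplex d) x) :=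
  fderiv_comp_fderivWithin x hφ (hF.contDiffOn.differentiableOn (by norm_num) x hx)
    (uniqueDiffOn_refSimplex x hx)

theorem fderivWithin_interp {w : E d → ℝ} {U : E d → ℝ}
    (hw : ∀ x ∈ refSimplex d, w (F x) = U 0 + interpLin U x) {x : E d} (hx : x ∈ refSimplex d) :
    fderivWithin ℝ (w ∘ F) (refSimplex d) x = interpLin U := by
  have h1 : HasFDerivWithinAt (fun x => U 0 + interpLin U x) (interpLin U) (refSimplex d) x :=
    ((interpLin U).hasFDerivAt.const_add (U 0)).hasFDerivWithinAt
  exact (h1.congr hw (hw x hx)).fderivWithin (uniqueDiffOn_refSimplex x hx)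

/-- Applied to `eᵢ`, the interpolant's gradient minus the derivative of `φ ∘ F` at `x` equals the
difference of the Taylor remainders at the vertices `eᵢ` and `0`, up to the perturbation `ε` of the
nodal values. Undoing the chain rule costs `Λ / h`. -/
theorem sq_norm_fderiv_interp_sub_le (hF : IsElementMap F h Λ) (hh : 0 < h) (hΛ : 0 < Λ)
    {φ w U : E d → ℝ} (hφ : ContDiff ℝ ∞ φ) {ε : ℝ}
    (hU : ∀ k, |U (refVertex d k) - φ (F (refVertex d k))| ≤ ε)
    (hw : ∀ x ∈ refSimplex d, w (F x) = U 0 + interpLin U x) {x : E d} (hx : x ∈ refSimplex d)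
    (hwx : DifferentiableAt ℝ w (F x)) {R : E d → ℝ}
    (hR : ∀ p, R p = (φ ∘ F) p - (φ ∘ F) x - fderivWithin ℝ (φ ∘ F) (refSimplex d) x (p - x)) :
    ‖fderiv ℝ w (F x) - fderiv ℝ φ (F x)‖ ^ 2 ≤ (Λ / h) ^ 2 *
      (d * ∑ i : Fin d, (3 * R (EuclideanSpace.single i 1) ^ 2 + 3 * R 0 ^ 2 + 12 * ε ^ 2)) := by
  have hφd : DifferentiableAt ℝ φ (F x) := (hφ.differentiable (by norm_num)).differentiableAt
  set S := interpLin U - fderivWithin ℝ (φ ∘ F) (refSimplex d) x with hS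
  have h1 : ‖fderiv ℝ w (F x) - fderiv ℝ φ (F x)‖ ≤ Λ / h * ‖S‖ := by
    refine (hF.norm_le_norm_comp_fderiv hh hΛ hx _).trans_eq ?_
    rw [ContinuousLinearMap.sub_comp, ← hF.fderivWithin_comp hx hwx, ← hF.fderivWithin_comp hx hφd,
      fderivWithin_interp hw hx]
  have hi : ∀ i, ‖S (EuclideanSpace.single i 1)‖
      ≤ |R (EuclideanSpace.single i 1)| + |R 0| + 2 * ε := by
    intro i
    have e : S (EuclideanSpace.single i 1) = R (EuclideanSpace.single i 1) - R 0
        + (U (EuclideanSpace.single i 1) - φ (F (EuclideanSpace.single i 1)))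
        - (U 0 - φ (F 0)) := by
      rw [hR, hR, hS, _root_.sub_apply, interpLin_single, map_sub, map_sub, map_zero]
      simp only [Function.comp]
      ring
    have hi0 := hU 0
    have hi1 := hU i.succ
    simp only [refVertex, Fin.cons_zero, Fin.cons_succ] at hi0 hi1
    rw [e, Real.norm_eq_abs]
    refine (abs_sub _ _).trans ?_
    have h2 := abs_add_le (R (EuclideanSpace.single i 1) - R 0)
      (U (EuclideanSpace.single i 1) - φ (F (EuclideanSpace.single i 1)))
    have h3 := abs_sub (R (EuclideanSpace.single i 1)) (R 0)
    linarith
  have hsum : ‖S‖ ≤ ∑ i : Fin d, (|R (EuclideanSpace.single i 1)| + |R 0| + 2 * ε) :=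
    (norm_le_sum_apply_single S).trans (Finset.sum_le_sum fun i _ => hi i)
  have hsq := pow_le_pow_left₀ (norm_nonneg _) hsum 2
  have hcs := sq_sum_le_card_mul_sum_sq (s := Finset.univ)
    (f := fun i : Fin d => |R (EuclideanSpace.single i 1)| + |R 0| + 2 * ε)
  rw [Finset.card_univ, Fintype.card_fin] at hcs
  calc _ ≤ (Λ / h * ‖S‖) ^ 2 := pow_le_pow_left₀ (norm_nonneg _) h1 2
    _ = (Λ / h) ^ 2 * ‖S‖ ^ 2 := by ring
    _ ≤ _ := by
      gcongr
      refine (hsq.trans hcs).trans ?_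
      gcongr with i
      rw [← sq_abs (R (EuclideanSpace.single i 1)), ← sq_abs (R 0)]
      nlinarith [sq_nonneg (|R (EuclideanSpace.single i 1)| - |R 0|),
        sq_nonneg (|R (EuclideanSpace.single i 1)| - 2 * ε), sq_nonneg (|R 0| - 2 * ε)]

/-- The powers of `h` are `h^d` and `h^(-d)` from the two transports of integrals, `h^(-2)` from the
gradient and `h^4` from the squared second derivative, in total `h^2`. Only `C` has to be uniform;
`C'` may depend on the element because `ε` tends to `0` on a fixed mesh. The indicator discards
points where `w` has no classical derivative. -/
theorem exists_lintegral_fderiv_interp_sub_le (hd : d ≤ 3) (hΛ : 0 < Λ) : ∃ C : ℝ≥0,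
    ∀ (F : E d → E d) (h : ℝ), 0 < h → IsElementMap F h Λ → ∃ C' : ℝ≥0,
      ∀ (φ w U : E d → ℝ) (ε : ℝ≥0), ContDiff ℝ ∞ φ →
        (∀ k, |U (refVertex d k) - φ (F (refVertex d k))| ≤ ε) →
        (∀ x ∈ refSimplex d, w (F x) = U 0 + interpLin U x) →
        ∫⁻ y in F '' refSimplex d, {y | DifferentiableAt ℝ w y}.indicator
            (fun y => ‖fderiv ℝ w y - fderiv ℝ φ y‖ₑ ^ 2) y
          ≤ C * ENNReal.ofReal h ^ 2 * (∫⁻ y in F '' refSimplex d, ‖derivSum φ y‖ₑ ^ 2)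
            + C' * ε ^ 2 := by
  obtain ⟨C₀, hC₀⟩ := exists_taylor_remainder_refSimplex hd
  refine ⟨(24 * d ^ 2 * Λ ^ (2 * d + 6)).toNNReal * C₀, fun F h hh hF =>
    ⟨((Λ * h) ^ d * (Λ / h) ^ 2 * d ^ 2 * 12).toNNReal * (volume (refSimplex d)).toNNReal,
    fun φ w U ε hφ hU hw => ?_⟩⟩
  have hK := isCompact_refSimplex (d := d)
  have hm : Measurable ({y | DifferentiableAt ℝ w y}.indicator
      (fun y => ‖fderiv ℝ w y - fderiv ℝ φ y‖ₑ ^ 2)) := by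
    refine Measurable.indicator ?_ (measurableSet_of_differentiableAt ℝ w)
    exact (((measurable_fderiv ℝ w).sub (measurable_fderiv ℝ φ)).enorm).pow_const 2
  set V := φ ∘ F with hV
  have hV2 : ContDiffOn ℝ 2 V (refSimplex d) :=
    (hφ.of_le (by norm_cast) : ContDiff ℝ 2 φ).comp_contDiffOn hF.contDiffOn
  have hV1c : ContinuousOn (fderivWithin ℝ V (refSimplex d)) (refSimplex d) :=
    hV2.continuousOn_fderivWithin uniqueDiffOn_refSimplex (by norm_num)
  let R : E d → E d → ℝ := fun x p => V p - V x - fderivWithin ℝ V (refSimplex d) x (p - x)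
  have hRm : ∀ p, AEMeasurable (fun x => ‖R x p‖ₑ ^ 2) (volume.restrict (refSimplex d)) := by
    intro p
    have : ContinuousOn (fun x => R x p) (refSimplex d) :=
      (continuousOn_const.sub hV2.continuousOn).sub
        (hV1c.clm_apply (continuousOn_const.sub continuousOn_id))
    exact (this.aemeasurable hK.measurableSet).enorm.pow_const 2
  set I := ∫⁻ x in refSimplex d, ‖iteratedFDerivWithin ℝ 2 V (refSimplex d) x‖ₑ ^ 2 with hI
  have hRI : ∀ p ∈ refSimplex d, ∫⁻ x in refSimplex d, ‖R x p‖ₑ ^ 2 ≤ C₀ * I := fun p hp =>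
    hC₀ V hV2 p hp
  have hpt : ∀ x ∈ refSimplex d, {y | DifferentiableAt ℝ w y}.indicator
      (fun y => ‖fderiv ℝ w y - fderiv ℝ φ y‖ₑ ^ 2) (F x) ≤ ENNReal.ofReal ((Λ / h) ^ 2 * d) *
        ∑ i : Fin d, (3 * ‖R x (EuclideanSpace.single i 1)‖ₑ ^ 2 + 3 * ‖R x 0‖ₑ ^ 2
          + 12 * ε ^ 2) := by
    intro x hx
    refine indicator_apply_le' (fun hwx => ?_) fun _ => zero_le
    have := hF.sq_norm_fderiv_interp_sub_le hh hΛ hφ hU hw hx hwx (R := R x) (fun p => rfl)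
    rw [← ofReal_norm, ← ENNReal.ofReal_pow (norm_nonneg _)]
    refine (ENNReal.ofReal_le_ofReal this).trans_eq ?_
    rw [← mul_assoc, ENNReal.ofReal_mul (by positivity), ENNReal.ofReal_sum_of_nonneg
      (fun i _ => by positivity)]
    congr 1
    refine Finset.sum_congr rfl fun i _ => ?_
    rw [ENNReal.ofReal_add (by positivity) (by positivity), ENNReal.ofReal_add (by positivity)
      (by positivity), ENNReal.ofReal_mul (by norm_num), ENNReal.ofReal_mul (by norm_num),
      ENNReal.ofReal_mul (by norm_num), ENNReal.ofReal_pow (NNReal.coe_nonneg ε), ENNReal.ofReal_coe_nnreal]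
    simp only [Real.enorm_eq_ofReal_abs, ← ENNReal.ofReal_pow (abs_nonneg _), sq_abs]
    simp
  have hint : ∫⁻ x in refSimplex d, {y | DifferentiableAt ℝ w y}.indicator
      (fun y => ‖fderiv ℝ w y - fderiv ℝ φ y‖ₑ ^ 2) (F x) ≤ ENNReal.ofReal ((Λ / h) ^ 2 * d) *
        (d * (6 * C₀ * I + 12 * volume (refSimplex d) * ε ^ 2)) := by
    refine (setLIntegral_mono' hK.measurableSet hpt).trans ?_
    have hmeas : ∀ i : Fin d, AEMeasurable (fun x => 3 * ‖R x (EuclideanSpace.single i 1)‖ₑ ^ 2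
        + 3 * ‖R x 0‖ₑ ^ 2 + 12 * (ε : ℝ≥0∞) ^ 2) (volume.restrict (refSimplex d)) := fun i =>
      (((hRm _).const_mul _).add ((hRm _).const_mul _)).add aemeasurable_const
    rw [lintegral_const_mul' _ _ ENNReal.ofReal_ne_top, lintegral_finsetSum' _ fun i _ => hmeas i]
    gcongr
    calc _ ≤ ∑ i : Fin d, (6 * C₀ * I + 12 * volume (refSimplex d) * ε ^ 2) := by
          refine Finset.sum_le_sum fun i _ => ?_
          rw [lintegral_add_right _ measurable_const, lintegral_add_left' ((hRm _).const_mul _),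
            lintegral_const_mul' _ _ (by finiteness), lintegral_const_mul' _ _ (by finiteness),
            setLIntegral_const]
          calc _ ≤ 3 * (C₀ * I) + 3 * (C₀ * I) + 12 * ε ^ 2 * volume (refSimplex d) := by
                gcongr
                · exact hRI _ (single_mem_refSimplex i)
                · exact hRI _ zero_mem_refSimplex
            _ = _ := by ring
      _ = _ := by rw [Finset.sum_const, Finset.card_univ, Fintype.card_fin, nsmul_eq_mul]
  have hI2 := hF.lintegral_iteratedFDerivWithin_comp_le hh hΛ hφ
  rw [← hV, ← hI] at hI2
  set N := ∫⁻ y in F '' refSimplex d, ‖derivSum φ y‖ₑ ^ 2 with hN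
  have hvol : ((volume (refSimplex d)).toNNReal : ℝ≥0∞) = volume (refSimplex d) :=
    ENNReal.coe_toNNReal hK.measure_lt_top.ne
  calc _ ≤ ENNReal.ofReal (Λ * h) ^ d * (ENNReal.ofReal ((Λ / h) ^ 2 * d) *
        (d * (6 * C₀ * (ENNReal.ofReal (4 * (Λ * h) ^ 4 * (Λ / h) ^ d) * N)
          + 12 * volume (refSimplex d) * ε ^ 2))) := by
        refine (hF.lintegral_image_le hh hΛ hm).trans ?_
        gcongr
        refine hint.trans ?_
        gcongr
    _ = ENNReal.ofReal ((Λ * h) ^ d * ((Λ / h) ^ 2 * d) * (d * 6) * (4 * (Λ * h) ^ 4 * (Λ / h) ^ d))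
          * C₀ * N + ENNReal.ofReal ((Λ * h) ^ d * ((Λ / h) ^ 2 * d) * d * 12)
          * volume (refSimplex d) * ε ^ 2 := by
        have e6 : ENNReal.ofReal ((d : ℝ) * 6) = d * 6 := by
          rw [ENNReal.ofReal_mul (by positivity), ENNReal.ofReal_natCast, ENNReal.ofReal_ofNat]
        have e1 : ENNReal.ofReal ((Λ * h) ^ d * ((Λ / h) ^ 2 * d))
            = ENNReal.ofReal (Λ * h) ^ d * ENNReal.ofReal ((Λ / h) ^ 2 * d) := by
          rw [ENNReal.ofReal_mul (by positivity), ENNReal.ofReal_pow (by positivity)]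
        have e2 : ENNReal.ofReal ((Λ * h) ^ d * ((Λ / h) ^ 2 * d) * (d * 6)
            * (4 * (Λ * h) ^ 4 * (Λ / h) ^ d)) = ENNReal.ofReal (Λ * h) ^ d
            * ENNReal.ofReal ((Λ / h) ^ 2 * d) * (d * 6)
            * ENNReal.ofReal (4 * (Λ * h) ^ 4 * (Λ / h) ^ d) := by
          rw [ENNReal.ofReal_mul (by positivity), ENNReal.ofReal_mul (by positivity), e1, e6]
        have e3 : ENNReal.ofReal ((Λ * h) ^ d * ((Λ / h) ^ 2 * d) * d * 12)
            = ENNReal.ofReal (Λ * h) ^ d * ENNReal.ofReal ((Λ / h) ^ 2 * d) * d * 12 := by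
          rw [ENNReal.ofReal_mul (by positivity), ENNReal.ofReal_mul (by positivity), e1,
            ENNReal.ofReal_natCast, ENNReal.ofReal_ofNat]
        rw [e2, e3]
        ring
    _ = _ := by
        push_cast
        rw [hvol, ← ENNReal.ofReal, ← ENNReal.ofReal, ← ENNReal.ofReal_pow hh.le]
        congr 2
        · rw [mul_right_comm (ENNReal.ofReal _), ← ENNReal.ofReal_mul (by positivity)]
          congr 2
          rw [div_pow, mul_pow, div_pow, mul_pow]
          field_simp
          ring
        · congr 2
          ring

/-- The Sobolev embedding of `H²` into bounded functions: `φ (F p)` is the Taylor polynomial at `x`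
plus the remainder, integrated over all `x` in the reference simplex. -/
theorem exists_enorm_sq_le (hd : d ≤ 3) (hh : 0 < h) (hΛ : 0 < Λ) (hF : IsElementMap F h Λ) :
    ∃ C : ℝ≥0, ∀ φ : E d → ℝ, ContDiff ℝ ∞ φ → ∀ y ∈ F '' refSimplex d,
      ‖φ y‖ₑ ^ 2 ≤ C * ∫⁻ y in F '' refSimplex d, ‖derivSum φ y‖ₑ ^ 2 := by
  obtain ⟨C₀, hC₀⟩ := exists_taylor_remainder_refSimplex hd
  obtain ⟨δ, hδ0, hδ⟩ := exists_enorm_sub_le_refSimplex d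
  have hK := isCompact_refSimplex (d := d)
  have hvol := volume_refSimplex_pos (d := d)
  have hvol' : volume (refSimplex d) ≠ ⊤ := hK.measure_lt_top.ne
  obtain ⟨c, hc⟩ : ∃ c, c = 3 * (1 + (Λ * h * δ) ^ 2) := ⟨_, rfl⟩
  have hc0 : 0 ≤ c := by rw [hc]; positivity
  set D : ℝ≥0∞ := ENNReal.ofReal c * ENNReal.ofReal (Λ / h) ^ d
    + 3 * (C₀ * ENNReal.ofReal (4 * (Λ * h) ^ 4 * (Λ / h) ^ d)) with hD
  have hDtop : D ≠ ⊤ := by finiteness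
  refine ⟨(D / volume (refSimplex d)).toNNReal, ?_⟩
  rintro φ hφ _ ⟨p, hp, rfl⟩
  set N := ∫⁻ y in F '' refSimplex d, ‖derivSum φ y‖ₑ ^ 2 with hN
  rw [ENNReal.coe_toNNReal (ENNReal.div_ne_top hDtop hvol.ne'), ← ENNReal.mul_div_right_comm,
    ENNReal.le_div_iff_mul_le (Or.inl hvol.ne') (Or.inl hvol')]
  set V := φ ∘ F with hV
  have hV2 : ContDiffOn ℝ 2 V (refSimplex d) :=
    (hφ.of_le (by norm_cast) : ContDiff ℝ 2 φ).comp_contDiffOn hF.contDiffOn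
  let R : E d → ℝ := fun x => V p - V x - fderivWithin ℝ V (refSimplex d) x (p - x)
  have hpt : ∀ x ∈ refSimplex d, ‖φ (F p)‖ₑ ^ 2
      ≤ ENNReal.ofReal c * ‖derivSum φ (F x)‖ₑ ^ 2 + 3 * ‖R x‖ₑ ^ 2 := by
    intro x hx
    have hφd : DifferentiableAt ℝ φ (F x) := (hφ.differentiable (by norm_num)).differentiableAt
    have hN0 := derivSum_nonneg φ (F x)
    have h1 : ‖fderivWithin ℝ V (refSimplex d) x (p - x)‖ ≤ derivSum φ (F x) * (Λ * h * δ) := by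
      rw [hF.fderivWithin_comp hx hφd]
      calc _ ≤ ‖fderiv ℝ φ (F x)‖ * ‖fderivWithin ℝ F (refSimplex d) x (p - x)‖ :=
            ContinuousLinearMap.le_opNorm _ _
        _ ≤ derivSum φ (F x) * (Λ * h * δ) := by
            gcongr
            · exact norm_fderiv_le_derivSum φ _
            · exact ContinuousLinearMap.le_of_opNorm_le_of_le _ (hF.norm_fderiv_le x hx)
                (hδ p hp x hx)
    have h2 : |V x| ≤ derivSum φ (F x) := by
      change |φ (F x)| ≤ _
      simpa using norm_iteratedFDeriv_le_derivSum hφ (k := 0) (by norm_num) (F x)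
    have h3 : |φ (F p)| ≤ derivSum φ (F x) + derivSum φ (F x) * (Λ * h * δ) + |R x| := by
      have e : φ (F p) = V x + fderivWithin ℝ V (refSimplex d) x (p - x) + R x := by
        simp only [R, hV, Function.comp]; ring
      rw [e]
      exact (abs_add_three _ _ _).trans (add_le_add_left (add_le_add h2 h1) _)
    have h4 : φ (F p) ^ 2 ≤ c * derivSum φ (F x) ^ 2 + 3 * R x ^ 2 := by
      rw [← sq_abs (φ (F p)), ← sq_abs (R x)]
      refine (pow_le_pow_left₀ (abs_nonneg _) h3 2).trans ?_
      set a := derivSum φ (F x)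
      rw [hc]
      nlinarith [sq_nonneg (a - a * (Λ * h * δ)), sq_nonneg (a - |R x|),
        sq_nonneg (a * (Λ * h * δ) - |R x|)]
    have h5 := ENNReal.ofReal_le_ofReal h4
    rw [ENNReal.ofReal_add (by positivity) (by positivity), ENNReal.ofReal_mul (by positivity),
      ENNReal.ofReal_mul (by norm_num), ENNReal.ofReal_ofNat] at h5
    simpa only [Real.enorm_eq_ofReal_abs, ← ENNReal.ofReal_pow (abs_nonneg _), sq_abs] using h5
  have hNm : Measurable fun y => ‖derivSum φ y‖ₑ ^ 2 :=
    (continuous_derivSum hφ).measurable.enorm.pow_const 2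
  have hNF : AEMeasurable (fun x => ‖derivSum φ (F x)‖ₑ ^ 2) (volume.restrict (refSimplex d)) :=
    hNm.comp_aemeasurable (hF.contDiffOn.continuousOn.aemeasurable hK.measurableSet)
  calc ‖φ (F p)‖ₑ ^ 2 * volume (refSimplex d) = ∫⁻ _ in refSimplex d, ‖φ (F p)‖ₑ ^ 2 := by
        rw [setLIntegral_const]
    _ ≤ ∫⁻ x in refSimplex d, (ENNReal.ofReal c * ‖derivSum φ (F x)‖ₑ ^ 2 + 3 * ‖R x‖ₑ ^ 2) :=
        setLIntegral_mono' hK.measurableSet hpt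
    _ = ENNReal.ofReal c * (∫⁻ x in refSimplex d, ‖derivSum φ (F x)‖ₑ ^ 2)
          + 3 * ∫⁻ x in refSimplex d, ‖R x‖ₑ ^ 2 := by
        rw [lintegral_add_left' (hNF.const_mul _), lintegral_const_mul' _ _ ENNReal.ofReal_ne_top,
          lintegral_const_mul' _ _ (by finiteness)]
    _ ≤ ENNReal.ofReal c * (ENNReal.ofReal (Λ / h) ^ d * N)
          + 3 * (C₀ * (ENNReal.ofReal (4 * (Λ * h) ^ 4 * (Λ / h) ^ d) * N)) := by
        gcongr
        · exact hF.lintegral_comp_le hh hΛ hNm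
        · refine (hC₀ V hV2 p hp).trans ?_
          gcongr
          exact hF.lintegral_iteratedFDerivWithin_comp_le hh hΛ hφ
    _ = D * N := by rw [hD]; ring

end IsElementMap

/-! ### Interpolation on a curved triangulation -/

namespace CurvedTriangulation

variable {Ω : Set (E d)}

theorem isCompact_element (T : CurvedTriangulation Ω) (i : Fin T.card) :
    IsCompact (T.map i '' refSimplex d) :=
  isCompact_refSimplex.image_of_continuousOn (T.contDiffOn i).continuousOn

theorem diam_le_meshSize (T : CurvedTriangulation Ω) (i : Fin T.card) :
    Metric.diam (T.map i '' refSimplex d) ≤ T.meshSize :=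
  le_ciSup (f := fun i => Metric.diam (T.map i '' refSimplex d)) (finite_range _).bddAbove i

theorem meshSize_pos (T : CurvedTriangulation Ω) (hd : 0 < d) (hΩ : Ω.Nonempty) :
    0 < T.meshSize := by
  obtain ⟨x, hx⟩ := hΩ
  have hx' := subset_closure hx
  rw [← T.iUnion_eq] at hx'
  obtain ⟨i, -⟩ := mem_iUnion.1 hx'
  refine lt_of_lt_of_le ?_ (T.diam_le_meshSize i)
  have hne : T.map i 0 ≠ T.map i (EuclideanSpace.single ⟨0, hd⟩ 1) := by
    intro h
    have := T.injOn i zero_mem_refSimplex (single_mem_refSimplex _) h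
    have h2 := congrArg (fun v : E d => v ⟨0, hd⟩) this
    simp at h2
  exact (dist_pos.2 hne).trans_le (Metric.dist_le_diam_of_mem (T.isCompact_element i).isBounded
    (mem_image_of_mem _ zero_mem_refSimplex) (mem_image_of_mem _ (single_mem_refSimplex _)))

theorem exists_isElementMap (hd : 0 < d) (hΩ : Ω.Nonempty) {κ c : ℝ} (c₂ : ℝ) (hκ : 0 < κ)
    (hc : c < 1) : ∃ Λ : ℝ, 0 < Λ ∧ ∀ T : CurvedTriangulation Ω, T.IsQuasiUniform κ c c₂ →
      ∀ i, IsElementMap (T.map i) T.meshSize Λ := by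
  obtain ⟨Λ, hΛ, h⟩ := RobinFE.exists_isElementMap d c₂ hκ hc
  refine ⟨Λ, hΛ, fun T hT i => ?_⟩
  obtain ⟨B, hB, z, hz⟩ := hT i
  refine h _ _ B z (T.meshSize_pos hd hΩ) (T.contDiffOn i) (fun x hx y hy => ?_) hB hz
  rw [← dist_eq_norm]
  exact (Metric.dist_le_diam_of_mem (T.isCompact_element i).isBounded
    (mem_image_of_mem _ hx) (mem_image_of_mem _ hy)).trans (T.diam_le_meshSize i)

variable {T : CurvedTriangulation Ω} {h Λ : ℝ}

theorem volume_map_refFace (hh : 0 < h) (hΛ : 0 < Λ) {i : Fin T.card}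
    (hT : IsElementMap (T.map i) h Λ) {s : Finset (Fin (d + 1))} (hs : s ≠ Finset.univ) :
    volume (T.map i '' refFace s) = 0 := by
  have := euclideanHausdorffMeasure_image_le ((hT.lipschitzOnWith hh hΛ).mono (refFace_subset s)) d
  simpa [EuclideanSpace.euclideanHausdorffMeasure_eq_volume, volume_refFace hs] using this

theorem volume_frontier (hh : 0 < h) (hΛ : 0 < Λ) (hT : ∀ i, IsElementMap (T.map i) h Λ) :
    volume (frontier Ω) = 0 := by
  classical
  have hsub : frontier Ω ⊆ ⋃ i, ⋃ s ∈ {s : Finset (Fin (d + 1)) | s.card = d},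
      T.map i '' refFace s := by
    intro x hx
    obtain ⟨i, s, hs, hxs, -⟩ := T.frontier_eq x hx
    exact mem_iUnion.2 ⟨i, mem_biUnion hs hxs⟩
  refine measure_mono_null hsub (measure_iUnion_null fun i =>
    (measure_biUnion_null_iff (toFinite _).countable).2 fun s hs => ?_)
  refine volume_map_refFace hh hΛ (hT i) fun h => ?_
  have hs' : s.card = d := hs
  rw [h, Finset.card_univ, Fintype.card_fin] at hs'
  omega

/-- Elements overlap in images of proper faces and the boundary is covered by images of facets;
Lipschitz maps send these null sets to null sets. -/
theorem lintegral_eq_sum (hΩ : IsOpen Ω) (hh : 0 < h) (hΛ : 0 < Λ)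
    (hT : ∀ i, IsElementMap (T.map i) h Λ) (f : E d → ℝ≥0∞) :
    ∫⁻ x in Ω, f x = ∑ i, ∫⁻ x in T.map i '' refSimplex d, f x := by
  have h1 : (Ω : Set (E d)) =ᵐ[volume] closure Ω := by
    refine subset_closure.eventuallyLE.antisymm (ae_le_set.2 ?_)
    rw [← hΩ.frontier_eq]
    exact volume_frontier hh hΛ hT
  rw [setLIntegral_congr h1, ← T.iUnion_eq, lintegral_iUnion₀
    (fun i => (T.isCompact_element i).measurableSet.nullMeasurableSet) ?_, tsum_fintype]
  intro i j hij
  obtain ⟨s, π, hs, hinter, -⟩ := T.conforming i j hij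
  rw [Function.onFun, AEDisjoint, hinter]
  exact volume_map_refFace hh hΛ (hT i) hs

/-- The elementwise definitions agree on overlaps: a common point has the same barycentric weights
in both elements, up to the relabelling, and the vertices carrying weight are the same points. -/
theorem exists_interpolant (T : CurvedTriangulation Ω) (U : E d → ℝ) : ∃ w : E d → ℝ,
    ∀ i, ∀ x ∈ refSimplex d, w (T.map i x) = (U ∘ T.map i) 0 + interpLin (U ∘ T.map i) x := by
  classical
  have hwd : ∀ i, ∀ x ∈ refSimplex d, ∀ j, ∀ x' ∈ refSimplex d, T.map i x = T.map j x' →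
      (U ∘ T.map i) 0 + interpLin (U ∘ T.map i) x
        = (U ∘ T.map j) 0 + interpLin (U ∘ T.map j) x' := by
    intro i x hx j x' hx' he
    rcases eq_or_ne i j with rfl | hij
    · rw [T.injOn i hx hx' he]
    obtain ⟨s, π, hs, hinter, hπ⟩ := T.conforming i j hij
    have hmem : T.map i x ∈ T.map i '' refSimplex d ∩ T.map j '' refSimplex d :=
      ⟨mem_image_of_mem _ hx, he ▸ mem_image_of_mem _ hx'⟩
    rw [hinter] at hmem
    obtain ⟨x₁, hx₁, hx₁e⟩ := hmem
    obtain rfl := T.injOn i (refFace_subset s hx₁) hx hx₁e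
    obtain ⟨w, hw, hws, rfl⟩ := exists_weights_of_mem_refFace hx₁
    have h1 := hπ w hw hws
    obtain rfl := T.injOn j (sum_smul_refVertex_mem hw π) hx' (h1.trans he)
    have h2 := interpLin_sum (U ∘ T.map i) hw.2 (Equiv.refl _)
    have h3 := interpLin_sum (U ∘ T.map j) hw.2 π
    rw [h3]
    refine h2.trans (Finset.sum_congr rfl fun k _ => ?_)
    by_cases hk : k ∈ s
    -- Conformity with all the weight on vertex `k` says that the two elements map the corresponding
    -- vertices to the same point.
    · have h4 := hπ (Pi.single k 1) (single_mem_stdSimplex ℝ k) fun l hl =>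
        Pi.single_eq_of_ne (fun h => hl (by rwa [h])) _
      simp only [Pi.single_apply, ite_smul, one_smul, zero_smul, Finset.sum_ite_eq',
        Finset.mem_univ, if_true] at h4
      simp [h4]
    · simp [hws k hk]
  let P : E d → (Fin T.card × E d) → Prop := fun y q => q.2 ∈ refSimplex d ∧ T.map q.1 q.2 = y
  refine ⟨fun y => if hy : ∃ q, P y q then (U ∘ T.map hy.choose.1) 0
    + interpLin (U ∘ T.map hy.choose.1) hy.choose.2 else 0, fun i x hx => ?_⟩
  have hy : ∃ q, P (T.map i x) q := ⟨(i, x), hx, rfl⟩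
  simp only [dif_pos hy]
  exact hwd _ _ hy.choose_spec.1 _ _ hx hy.choose_spec.2

/-- A qualitative fact, with a constant that depends on the mesh: it places the interpolant in `H¹`
and identifies its trace. -/
theorem exists_lipschitzOnWith (hΩ : IsC3Domain Ω) (hh : 0 < h)
    (hΛ : 0 < Λ) (hT : ∀ i, IsElementMap (T.map i) h Λ) {U w : E d → ℝ}
    (hw : ∀ i, ∀ x ∈ refSimplex d, w (T.map i x)
      = (U ∘ T.map i) 0 + interpLin (U ∘ T.map i) x) :
    ∃ K : ℝ≥0, LipschitzOnWith K w (closure Ω) := by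
  have hL : ∀ i, LipschitzOnWith (∑ i, ‖interpLin (U ∘ T.map i)‖₊ * (Λ / h).toNNReal) w
      (T.map i '' refSimplex d) := by
    intro i
    refine LipschitzOnWith.of_dist_le_mul ?_
    rintro _ ⟨x, hx, rfl⟩ _ ⟨y, hy, rfl⟩
    have h1 : ‖x - y‖ ≤ Λ / h * ‖T.map i x - T.map i y‖ := by
      rw [div_mul_eq_mul_div, le_div_iff₀ hh, mul_comm]
      exact (hT i).le_norm_sub x hx y hy
    have h2 : ‖interpLin (U ∘ T.map i)‖₊ * (Λ / h).toNNReal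
        ≤ ∑ i, ‖interpLin (U ∘ T.map i)‖₊ * (Λ / h).toNNReal :=
      Finset.single_le_sum (f := fun i => ‖interpLin (U ∘ T.map i)‖₊ * (Λ / h).toNNReal)
        (fun _ _ => zero_le) (Finset.mem_univ i)
    rw [hw i x hx, hw i y hy, dist_add_left, dist_eq_norm, dist_eq_norm, ← map_sub]
    calc _ ≤ ‖interpLin (U ∘ T.map i)‖ * ‖x - y‖ := ContinuousLinearMap.le_opNorm _ _
      _ ≤ ‖interpLin (U ∘ T.map i)‖ * (Λ / h * ‖T.map i x - T.map i y‖) := by gcongr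
      _ = ((‖interpLin (U ∘ T.map i)‖₊ * (Λ / h).toNNReal : ℝ≥0) : ℝ)
            * ‖T.map i x - T.map i y‖ := by
          rw [NNReal.coe_mul, Real.coe_toNNReal _ (by positivity), coe_nnnorm, mul_assoc]
      _ ≤ _ := by gcongr
  have hcl : ∀ i, IsClosed (T.map i '' refSimplex d) := fun i => (T.isCompact_element i).isClosed
  have hcont : ContinuousOn w (closure Ω) := by
    rw [← T.iUnion_eq]
    exact (locallyFinite_of_finite _).continuousOn_iUnion hcl fun i => (hL i).continuousOn
  exact hΩ.exists_lipschitzOnWith fun x v hx =>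
    abs_sub_le_of_piecewise_lipschitz hcl T.iUnion_eq.superset hcont hL hx

/-- A boundary facet is connected and covered by the disjoint closed sets `Γ` and `Γ₀`, so it lies
in `Γ₀` as soon as it meets it. All its vertex values are then zero. -/
theorem interpolant_eq_zero {Γ Γ₀ : Set (E d)} (hΓ : IsClosed Γ) (hΓ₀ : IsClosed Γ₀)
    (hdisj : Disjoint Γ Γ₀) (hfr : frontier Ω = Γ ∪ Γ₀) {U w : E d → ℝ}
    (hw : ∀ i, ∀ x ∈ refSimplex d, w (T.map i x)
      = (U ∘ T.map i) 0 + interpLin (U ∘ T.map i) x) (hU : ∀ x ∈ Γ₀, U x = 0) {x : E d}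
    (hx : x ∈ Γ₀) : w x = 0 := by
  obtain ⟨i, s, hs, hxs, hsub⟩ := T.frontier_eq x (hfr ▸ Or.inr hx)
  have hconn : IsPreconnected (T.map i '' refFace s) :=
    (convex_convexHull ℝ _).isPreconnected.image _
      ((T.contDiffOn i).continuousOn.mono (refFace_subset s))
  have hΓ₀s : T.map i '' refFace s ⊆ Γ₀ := by
    rcases isPreconnected_iff_subset_of_disjoint_closed.1 hconn Γ Γ₀ hΓ hΓ₀ (hfr ▸ hsub)
      (by rw [hdisj.inter_eq, inter_empty]) with h | h
    · exact absurd hx (Set.disjoint_left.1 hdisj (h hxs))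
    · exact h
  obtain ⟨z, hz, rfl⟩ := hxs
  obtain ⟨wt, hwt, hws, rfl⟩ := exists_weights_of_mem_refFace hz
  rw [hw i _ (refFace_subset s hz)]
  have h2 := interpLin_sum (U ∘ T.map i) hwt.2 (Equiv.refl _)
  refine h2.trans (Finset.sum_eq_zero fun k _ => ?_)
  by_cases hk : k ∈ s
  · have : U (T.map i (refVertex d k)) = 0 :=
      hU _ (hΓ₀s (mem_image_of_mem _ (subset_convexHull ℝ _ (mem_image_of_mem _ hk))))
    simp [this]
  · simp [hws k hk]

theorem memV_interpolant {U w : E d → ℝ} (hcont : ContinuousOn w (closure Ω))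
    (hw : ∀ i, ∀ x ∈ refSimplex d, w (T.map i x)
      = (U ∘ T.map i) 0 + interpLin (U ∘ T.map i) x) : T.MemV w :=
  ⟨hcont, fun i => ⟨(interpLin (U ∘ T.map i)).toLinearMap.toAffineMap
    + AffineMap.const ℝ (E d) ((U ∘ T.map i) 0), fun x hx => by simp [hw i x hx, add_comm]⟩⟩

end CurvedTriangulation

/-! ### The interpolation error -/


theorem eLpNorm_derivSum_le {Ω : Set (E d)} {φ : E d → ℝ} (hφ : ContDiff ℝ ∞ φ) :
    eLpNorm (derivSum φ) 2 (volume.restrict Ω) ≤ eLpNorm φ 2 (volume.restrict Ω)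
      + ∑ i, eLpNorm (pd i φ) 2 (volume.restrict Ω)
      + ∑ i, ∑ j, eLpNorm (pd j (pd i φ)) 2 (volume.restrict Ω) := by
  have h1 : ∀ i, Continuous (pd i φ) := fun i => (contDiff_pd hφ i).continuous
  have h2 : ∀ i j, Continuous (pd j (pd i φ)) := fun i j =>
    (contDiff_pd (contDiff_pd hφ i) j).continuous
  have e : derivSum φ = (fun x => ‖φ x‖) + (∑ i, fun x => ‖pd i φ x‖)
      + ∑ i, ∑ j, fun x => ‖pd j (pd i φ) x‖ := by
    ext x
    simp [derivSum]
  have hc0 : AEStronglyMeasurable (fun x => ‖φ x‖) (volume.restrict Ω) :=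
    hφ.continuous.norm.aestronglyMeasurable
  have hc1 : ∀ i, AEStronglyMeasurable (fun x => ‖pd i φ x‖) (volume.restrict Ω) :=
    fun i => (h1 i).norm.aestronglyMeasurable
  have hc2 : ∀ i j, AEStronglyMeasurable (fun x => ‖pd j (pd i φ) x‖) (volume.restrict Ω) :=
    fun i j => (h2 i j).norm.aestronglyMeasurable
  have hs1 : AEStronglyMeasurable (∑ i, fun x => ‖pd i φ x‖) (volume.restrict Ω) :=
    Finset.aestronglyMeasurable_sum _ fun i _ => hc1 i
  have hs2 : ∀ i, AEStronglyMeasurable (∑ j, fun x => ‖pd j (pd i φ) x‖) (volume.restrict Ω) :=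
    fun i => Finset.aestronglyMeasurable_sum _ fun j _ => hc2 i j
  rw [e]
  refine (eLpNorm_add_le (hc0.add hs1) (Finset.aestronglyMeasurable_sum _ fun i _ => hs2 i)
    (by norm_num)).trans ?_
  refine add_le_add ((eLpNorm_add_le hc0 hs1 (by norm_num)).trans (add_le_add ?_ ?_)) ?_
  · rw [eLpNorm_norm]
  · refine (eLpNorm_sum_le (fun i _ => hc1 i) (by norm_num)).trans ?_
    simp only [eLpNorm_norm]
    exact le_rfl
  · refine (eLpNorm_sum_le (fun i _ => hs2 i) (by norm_num)).trans ?_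
    refine Finset.sum_le_sum fun i _ => ?_
    refine (eLpNorm_sum_le (fun j _ => hc2 i j) (by norm_num)).trans ?_
    simp only [eLpNorm_norm]
    exact le_rfl

theorem eLpNorm_le_h2Norm (Ω : Set (E d)) (u : E d → ℝ) :
    eLpNorm u 2 (volume.restrict Ω) + ∑ i, eLpNorm (weakPartial Ω i u) 2 (volume.restrict Ω)
      + ∑ i, ∑ j, eLpNorm (weakPartial Ω j (weakPartial Ω i u)) 2 (volume.restrict Ω)
      ≤ (1 + d + d * d) * h2Norm Ω u := by
  rw [h2Norm]
  split_ifs with hu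
  · set a := eLpNorm u 2 (volume.restrict Ω)
    set b := fun i => eLpNorm (weakPartial Ω i u) 2 (volume.restrict Ω)
    set c := fun i j => eLpNorm (weakPartial Ω j (weakPartial Ω i u)) 2 (volume.restrict Ω)
    set N := (a ^ 2 + ∑ i, b i ^ 2 + ∑ i, ∑ j, c i j ^ 2) ^ (1 / 2 : ℝ) with hN
    have ha : a ≤ N := le_rpow_half_of_sq_le (le_add_right le_self_add)
    have hb : ∀ i, b i ≤ N := fun i => le_rpow_half_of_sq_le (le_add_right (le_add_left
      (Finset.single_le_sum (f := fun i => b i ^ 2) (fun _ _ => zero_le) (Finset.mem_univ i))))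
    have hc : ∀ i j, c i j ≤ N := fun i j => le_rpow_half_of_sq_le (le_add_left
      ((Finset.single_le_sum (f := fun j => c i j ^ 2) (fun _ _ => zero_le)
        (Finset.mem_univ j)).trans (Finset.single_le_sum (f := fun i => ∑ j, c i j ^ 2)
          (fun _ _ => zero_le) (Finset.mem_univ i))))
    calc a + ∑ i, b i + ∑ i, ∑ j, c i j ≤ N + ∑ _i : Fin d, N + ∑ _i : Fin d, ∑ _j : Fin d, N := by
          gcongr with i _ i _ j _
          · exact hb i
          · exact hc i j
      _ = _ := by simp; ring
  · rw [ENNReal.mul_top (by simp)]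
    exact le_top

namespace CurvedTriangulation

variable {Ω : Set (E d)} {T : CurvedTriangulation Ω} {h Λ : ℝ}

theorem exists_enorm_le (hd : d ≤ 3) (hΩ : IsOpen Ω) (hh : 0 < h) (hΛ : 0 < Λ)
    (hT : ∀ i, IsElementMap (T.map i) h Λ) : ∃ C : ℝ≥0, ∀ φ : E d → ℝ, ContDiff ℝ ∞ φ →
      ∀ y ∈ closure Ω, ‖φ y‖ₑ ≤ C * eLpNorm (derivSum φ) 2 (volume.restrict Ω) := by
  choose C hC using fun i => IsElementMap.exists_enorm_sq_le hd hh hΛ (hT i)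
  refine ⟨1 + ∑ i, C i, fun φ hφ y hy => ?_⟩
  rw [← T.iUnion_eq] at hy
  obtain ⟨i, hi⟩ := mem_iUnion.1 hy
  rw [← ENNReal.pow_le_pow_left_iff two_ne_zero, mul_pow, eLpNorm_two_sq,
    lintegral_eq_sum hΩ hh hΛ hT]
  have h1 : C i ≤ (1 + ∑ i, C i) ^ 2 := by
    have : C i ≤ ∑ i, C i := Finset.single_le_sum (fun _ _ => zero_le) (Finset.mem_univ i)
    calc C i ≤ 1 + ∑ i, C i := le_add_left this
      _ ≤ _ := le_self_pow₀ (le_add_right le_rfl) two_ne_zero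
  refine (hC i φ hφ y hi).trans (mul_le_mul' (by exact_mod_cast h1) ?_)
  exact Finset.single_le_sum (f := fun i => ∫⁻ x in T.map i '' refSimplex d, ‖derivSum φ x‖ₑ ^ 2)
    (fun _ _ => zero_le) (Finset.mem_univ i)

/-- The interpolation error for a smooth function, up to a perturbation of the nodal values. -/
theorem exists_eLpNorm_weakPartial_sub_le (hd : d ≤ 3) (hΩ : IsC3Domain Ω) (hΛ : 0 < Λ) :
    ∃ C : ℝ≥0, ∀ (T : CurvedTriangulation Ω) (h : ℝ), 0 < h →
      (∀ i, IsElementMap (T.map i) h Λ) → ∃ C' : ℝ≥0, ∀ (φ w U : E d → ℝ) (ε : ℝ≥0),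
        ContDiff ℝ ∞ φ → (∀ y ∈ closure Ω, |U y - φ y| ≤ ε) →
        (∀ i, ∀ x ∈ refSimplex d, w (T.map i x)
          = (U ∘ T.map i) 0 + interpLin (U ∘ T.map i) x) →
        ∀ i, eLpNorm (fun x => pd i φ x - weakPartial Ω i w x) 2 (volume.restrict Ω)
          ≤ C * ENNReal.ofReal h * eLpNorm (derivSum φ) 2 (volume.restrict Ω) + C' * ε := by
  obtain ⟨C, hC⟩ := IsElementMap.exists_lintegral_fderiv_interp_sub_le hd hΛ
  refine ⟨1 + C, fun T h hh hT => ?_⟩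
  choose C' hC' using fun i => hC (T.map i) h hh (hT i)
  refine ⟨1 + ∑ i, C' i, fun φ w U ε hφ hU hw i => ?_⟩
  obtain ⟨K, hK⟩ := exists_lipschitzOnWith hΩ hh hΛ hT hw
  obtain ⟨-, hae⟩ := memH1_of_lipschitzOnWith hΩ.isOpen hΩ.isBounded hK
  have hel : ∀ j, T.map j '' refSimplex d ⊆ closure Ω := fun j =>
    T.iUnion_eq ▸ subset_iUnion (fun j => T.map j '' refSimplex d) j
  set S := eLpNorm (derivSum φ) 2 (volume.restrict Ω) with hS
  have h1 : eLpNorm (fun x => pd i φ x - weakPartial Ω i w x) 2 (volume.restrict Ω) ^ 2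
      ≤ C * ENNReal.ofReal h ^ 2 * S ^ 2 + (∑ j, C' j : ℝ≥0) * ε ^ 2 := by
    calc _ ≤ ∫⁻ x in Ω, {y | DifferentiableAt ℝ w y}.indicator
            (fun y => ‖fderiv ℝ w y - fderiv ℝ φ y‖ₑ ^ 2) x := by
          rw [eLpNorm_two_sq]
          refine lintegral_mono_ae ?_
          filter_upwards [hae] with x hx
          rw [indicator_of_mem (show x ∈ {y | DifferentiableAt ℝ w y} from hx.1), hx.2 i]
          refine pow_le_pow_left₀ zero_le ?_ 2
          have e : pd i φ x - pd i w x
              = -((fderiv ℝ w x - fderiv ℝ φ x) (EuclideanSpace.single i 1)) := by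
            simp [pd]
          rw [e, enorm_neg, ← ofReal_norm, ← ofReal_norm]
          refine ENNReal.ofReal_le_ofReal ((ContinuousLinearMap.le_opNorm _ _).trans_eq ?_)
          simp
      _ ≤ ∑ j, (C * ENNReal.ofReal h ^ 2 * (∫⁻ y in T.map j '' refSimplex d,
            ‖derivSum φ y‖ₑ ^ 2) + C' j * ε ^ 2) := by
          rw [lintegral_eq_sum hΩ.isOpen hh hΛ hT]
          refine Finset.sum_le_sum fun j _ => hC' j φ w (U ∘ T.map j) ε hφ (fun k => ?_) (hw j)
          exact hU _ (hel j (mem_image_of_mem _ (refVertex_mem_refSimplex k)))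
      _ = _ := by
          rw [Finset.sum_add_distrib, ← Finset.mul_sum, ← Finset.sum_mul, hS, eLpNorm_two_sq,
            lintegral_eq_sum hΩ.isOpen hh hΛ hT]
          push_cast
          rfl
  rw [← ENNReal.pow_le_pow_left_iff two_ne_zero]
  have h2 : ∀ c : ℝ≥0, (c : ℝ≥0∞) ≤ ((1 + c : ℝ≥0) : ℝ≥0∞) ^ 2 := by
    intro c
    have : c ≤ (1 + c) ^ 2 :=
      (le_add_left le_rfl).trans (le_self_pow₀ (le_add_right le_rfl) two_ne_zero)
    exact_mod_cast this
  calc _ ≤ _ := h1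
    _ ≤ ((1 + C : ℝ≥0) : ℝ≥0∞) ^ 2 * ENNReal.ofReal h ^ 2 * S ^ 2
        + ((1 + ∑ j, C' j : ℝ≥0) : ℝ≥0∞) ^ 2 * ε ^ 2 := by
        gcongr
        · exact h2 C
        · exact h2 _
    _ = (((1 + C : ℝ≥0) : ℝ≥0∞) * ENNReal.ofReal h * S) ^ 2
        + (((1 + ∑ j, C' j : ℝ≥0) : ℝ≥0∞) * ε) ^ 2 := by ring
    _ ≤ _ := by
        rw [add_sq]
        gcongr
        exact le_self_add

end CurvedTriangulation

theorem eLpNorm_sub_le_add_of_sub {α : Type*} [MeasurableSpace α] {μ : Measure α}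
    {u f g : α → ℝ} (hu : AEStronglyMeasurable u μ) (hf : AEStronglyMeasurable f μ)
    (hg : AEStronglyMeasurable g μ) : eLpNorm (fun x => f x - g x) 2 μ
      ≤ eLpNorm (fun x => u x - f x) 2 μ + eLpNorm (fun x => u x - g x) 2 μ := by
  have e : (fun x => f x - g x) = (fun x => u x - g x) - fun x => u x - f x := by
    ext x; simp
  rw [e, add_comm]
  exact eLpNorm_sub_le (hu.sub hg) (hu.sub hf) (by norm_num)

theorem pd_sub {d : ℕ} {f g : E d → ℝ} (hf : ContDiff ℝ ∞ f) (hg : ContDiff ℝ ∞ g) (i : Fin d) :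
    pd i (fun x => f x - g x) = fun x => pd i f x - pd i g x := by
  ext x
  simp only [pd]
  rw [fderiv_fun_sub (hf.differentiable (by norm_num)).differentiableAt
    (hg.differentiable (by norm_num)).differentiableAt]
  rfl

/-- A single rate `r` measures all the convergences. The Cauchy bound in `derivSum` becomes uniform
convergence through the Sobolev bound on the elements. -/
theorem MemH2.exists_approx_derivSum {d : ℕ} {D : Set (E d)} (hD : IsC3Domain D) {u : E d → ℝ}
    (hu : MemH2 D u) : ∃ (φ : ℕ → E d → ℝ) (r : ℕ → ℝ≥0∞), (∀ n, ContDiff ℝ ∞ (φ n)) ∧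
      Tendsto r atTop (𝓝 0) ∧
      (∀ n, eLpNorm (fun x => u x - φ n x) 2 (volume.restrict D) ≤ r n) ∧
      (∀ n i, eLpNorm (fun x => weakPartial D i u x - pd i (φ n) x) 2 (volume.restrict D) ≤ r n) ∧
      (∀ n m, eLpNorm (derivSum (fun x => φ n x - φ m x)) 2 (volume.restrict D) ≤ r n + r m) ∧
      ∀ n, eLpNorm (derivSum (φ n)) 2 (volume.restrict D)
        ≤ (1 + d + d * d) * h2Norm D u + r n := by
  obtain ⟨φ, hφ, h0, h1, h2⟩ := hu.exists_approx hD
  have mu := hu.1.1.1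
  have mu1 : ∀ i, AEStronglyMeasurable (weakPartial D i u) (volume.restrict D) := fun i =>
    (hu.2 i).1.1
  have mu2 : ∀ i j, AEStronglyMeasurable (weakPartial D j (weakPartial D i u))
      (volume.restrict D) := fun i j => ((hu.2 i).memLp_weakPartial hD.isOpen j).1
  have mφ : ∀ n, AEStronglyMeasurable (φ n) (volume.restrict D) := fun n =>
    (hφ n).continuous.aestronglyMeasurable
  have mφ1 : ∀ n i, AEStronglyMeasurable (pd i (φ n)) (volume.restrict D) := fun n i =>
    (contDiff_pd (hφ n) i).continuous.aestronglyMeasurable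
  have mφ2 : ∀ n i j, AEStronglyMeasurable (pd j (pd i (φ n))) (volume.restrict D) :=
    fun n i j => (contDiff_pd (contDiff_pd (hφ n) i) j).continuous.aestronglyMeasurable
  set a := fun n => eLpNorm (fun x => u x - φ n x) 2 (volume.restrict D) with ha
  set b := fun i n => eLpNorm (fun x => weakPartial D i u x - pd i (φ n) x) 2 (volume.restrict D)
    with hb
  set c := fun i j n => eLpNorm (fun x => weakPartial D j (weakPartial D i u) x
    - pd j (pd i (φ n)) x) 2 (volume.restrict D) with hc
  refine ⟨φ, fun n => a n + ∑ i, b i n + ∑ i, ∑ j, c i j n, hφ, ?_, fun n => ?_, fun n i => ?_,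
    fun n m => ?_, fun n => ?_⟩
  · have := (h0.add (tendsto_finsetSum Finset.univ fun i _ => h1 i)).add
      (tendsto_finsetSum Finset.univ fun i _ => tendsto_finsetSum Finset.univ fun j _ => h2 i j)
    simpa using this
  · exact le_add_right le_self_add
  · exact le_add_right (le_add_left (Finset.single_le_sum (f := fun i => b i n)
      (fun _ _ => zero_le) (Finset.mem_univ i)))
  · refine (eLpNorm_derivSum_le ((hφ n).sub (hφ m))).trans ?_
    simp only [pd_sub (hφ n) (hφ m), pd_sub (contDiff_pd (hφ n) _) (contDiff_pd (hφ m) _)]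
    calc _ ≤ (a n + a m) + ∑ i, (b i n + b i m) + ∑ i, ∑ j, (c i j n + c i j m) := by
          gcongr with i _ i _ j _
          · exact eLpNorm_sub_le_add_of_sub mu (mφ n) (mφ m)
          · exact eLpNorm_sub_le_add_of_sub (mu1 i) (mφ1 n i) (mφ1 m i)
          · exact eLpNorm_sub_le_add_of_sub (mu2 i j) (mφ2 n i j) (mφ2 m i j)
      _ = _ := by simp only [Finset.sum_add_distrib]; ring
  · refine (eLpNorm_derivSum_le (hφ n)).trans ?_
    calc _ ≤ (eLpNorm u 2 (volume.restrict D) + a n)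
          + ∑ i, (eLpNorm (weakPartial D i u) 2 (volume.restrict D) + b i n)
          + ∑ i, ∑ j, (eLpNorm (weakPartial D j (weakPartial D i u)) 2 (volume.restrict D)
            + c i j n) := by
          gcongr with i _ i _ j _
          · exact eLpNorm_le_of_sub mu (mφ n)
          · exact eLpNorm_le_of_sub (mu1 i) (mφ1 n i)
          · exact eLpNorm_le_of_sub (mu2 i j) (mφ2 n i j)
      _ = (eLpNorm u 2 (volume.restrict D)
          + ∑ i, eLpNorm (weakPartial D i u) 2 (volume.restrict D)
          + ∑ i, ∑ j, eLpNorm (weakPartial D j (weakPartial D i u)) 2 (volume.restrict D))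
          + (a n + ∑ i, b i n + ∑ i, ∑ j, c i j n) := by
          simp only [Finset.sum_add_distrib]; ring
      _ ≤ _ := by gcongr; exact eLpNorm_le_h2Norm D u

/-- A sequence that is uniformly Cauchy with rate `r` has a limit with rate `r`. -/
theorem exists_enorm_sub_le_of_cauchy {X : Type*} {s : Set X} {f : ℕ → X → ℝ} {r : ℕ → ℝ≥0∞}
    (hr : Tendsto r atTop (𝓝 0)) (h : ∀ n m, ∀ x ∈ s, ‖f n x - f m x‖ₑ ≤ r n + r m) :
    ∃ g : X → ℝ, ∀ n, ∀ x ∈ s, ‖g x - f n x‖ₑ ≤ r n := by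
  have hex : ∀ x ∈ s, ∃ y, Tendsto (fun n => f n x) atTop (𝓝 y) := by
    intro x hx
    refine cauchySeq_tendsto_of_complete (EMetric.cauchySeq_iff.2 fun ε hε => ?_)
    obtain ⟨N, hN⟩ := eventually_atTop.1 (hr.eventually_lt_const (ENNReal.half_pos hε.ne'))
    refine ⟨N, fun m hm n hn => ?_⟩
    rw [edist_eq_enorm_sub]
    calc _ ≤ r m + r n := h m n x hx
      _ < ε / 2 + ε / 2 := ENNReal.add_lt_add (hN m hm) (hN n hn)
      _ = ε := ENNReal.add_halves ε
  choose! g hg using hex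
  refine ⟨g, fun n x hx => ?_⟩
  have h1 : Tendsto (fun m => ‖f m x - f n x‖ₑ) atTop (𝓝 ‖g x - f n x‖ₑ) :=
    ((hg x hx).sub_const _).enorm
  have h2 : Tendsto (fun m => r m + r n) atTop (𝓝 (0 + r n)) := hr.add_const _
  rw [zero_add] at h2
  exact le_of_tendsto_of_tendsto' h1 h2 fun m => h m n x hx

/-- The surface measure charges every ball centred on the boundary, so a continuous function cannot
be nonzero on a null set only. -/
theorem eq_zero_of_ae_eq_zero {m : ℕ} {D : Set (E (m + 1))} (hD : IsC3Domain D)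
    {f : E (m + 1) → ℝ} (hf : ContinuousOn f (frontier D))
    (h0 : f =ᵐ[surfaceMeasure (frontier D)] 0) {p : E (m + 1)} (hp : p ∈ frontier D) :
    f p = 0 := by
  by_contra hne
  have hev : ∀ᶠ x in 𝓝[frontier D] p, f x ≠ 0 := (hf p hp).eventually_ne hne
  obtain ⟨r, hr, hball⟩ := Metric.mem_nhdsWithin_iff.1 hev
  refine (surfaceMeasure_pos hD hp hr).ne' (measure_mono_null ?_
    (measure_union_null (ae_iff.1 h0) (ae_iff.1 (ae_restrict_mem
      (isClosed_frontier (s := D)).measurableSet))))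
  intro x hx
  by_cases hxD : x ∈ frontier D
  · exact Or.inl (hball ⟨hx, hxD⟩)
  · exact Or.inr hxD

/-- Uniform convergence implies `L²` convergence on the boundary, whose surface measure is finite.
This links the pointwise values used for interpolation with the boundary condition on `u`. -/
theorem isTrace_of_uniform_approx {m : ℕ} {Ω : Set (E (m + 1))} (hΩ : IsC3Domain Ω)
    {u U : E (m + 1) → ℝ} (hu : MemH1 Ω u) {φ : ℕ → E (m + 1) → ℝ}
    (hφ : ∀ n, ContDiff ℝ ∞ (φ n)) {r s : ℕ → ℝ≥0∞} (hr : Tendsto r atTop (𝓝 0))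
    (h0 : ∀ n, eLpNorm (fun x => u x - φ n x) 2 (volume.restrict Ω) ≤ r n)
    (h1 : ∀ n i, eLpNorm (fun x => weakPartial Ω i u x - pd i (φ n) x) 2 (volume.restrict Ω) ≤ r n)
    (hs : Tendsto s atTop (𝓝 0)) (hUc : ContinuousOn U (closure Ω))
    (hU : ∀ n, ∀ x ∈ closure Ω, ‖U x - φ n x‖ₑ ≤ s n) : IsTrace Ω u U := by
  have hfin : IsFiniteMeasure (surfaceMeasure (frontier Ω)) :=
    ⟨surfaceMeasure_frontier_lt_top hΩ⟩
  have hae : ∀ᵐ x ∂(surfaceMeasure (frontier Ω)), x ∈ closure Ω := by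
    filter_upwards [ae_restrict_mem isClosed_frontier.measurableSet] with x hx
      using frontier_subset_closure hx
  refine ⟨?_, φ, hφ, ?_, ?_⟩
  · have hUm : AEStronglyMeasurable U (surfaceMeasure (frontier Ω)) :=
      (hUc.mono frontier_subset_closure).aestronglyMeasurable isClosed_frontier.measurableSet
    obtain ⟨B, hB⟩ := hΩ.isBounded.isCompact_closure.exists_bound_of_continuousOn hUc
    exact MemLp.of_bound hUm B (by filter_upwards [hae] with x hx using hB x hx)
  · have hlim : Tendsto (fun n => r n + ∑ _i : Fin (m + 1), r n) atTop (𝓝 0) := by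
      have := hr.add (tendsto_finsetSum (Finset.univ : Finset (Fin (m + 1))) fun _ _ => hr)
      rwa [Finset.sum_const_zero, add_zero] at this
    refine tendsto_of_tendsto_of_tendsto_of_le_of_le tendsto_const_nhds hlim (fun _ => zero_le)
      fun n => ?_
    have hn := memH1_of_contDiff hΩ.isBounded (hφ n)
    refine (h1Norm_le (hu.sub hΩ.isOpen hn)).trans
      (add_le_add (h0 n) (Finset.sum_le_sum fun i _ => ?_))
    rw [eLpNorm_congr_ae (((hu.hasWeakPartial i).sub
      (hasWeakPartial_of_contDiff Ω i (hφ n))).weakPartial_ae_eq hΩ.isOpen)]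
    exact h1 n i
  · have hlim : Tendsto (fun n => s n * surfaceMeasure (frontier Ω) univ
        ^ (2 : ℝ≥0∞).toReal⁻¹) atTop (𝓝 0) := by
      simpa using ENNReal.Tendsto.mul_const hs (Or.inr (by finiteness))
    refine tendsto_of_tendsto_of_tendsto_of_le_of_le tendsto_const_nhds hlim (fun _ => zero_le)
      fun n => eLpNorm_le_of_ae_enorm_bound ?_
    filter_upwards [hae] with x hx using hU n x hx

/-- Functions of `H²` have finite element approximations of first order in `H¹`. -/
theorem exists_memVDiamond_gradNorm_sub_le {m : ℕ} (hm : m + 1 ≤ 3) {Ω D₂ Γ : Set (E (m + 1))}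
    (hΩ : IsC3Domain Ω) (hD₂ : IsC3Domain D₂) (hΓ : IsClosed Γ)
    (hdisj : Disjoint Γ (frontier D₂)) (hfr : frontier Ω = Γ ∪ frontier D₂) {κ c : ℝ} (c₂ : ℝ)
    (hκ : 0 < κ) (hc : c < 1) : ∃ C : ℝ≥0, ∀ T : CurvedTriangulation Ω,
      T.IsQuasiUniform κ c c₂ → ∀ u, MemH2 Ω u → MemH1Diamond Ω (frontier D₂) u →
        ∃ w, T.MemVDiamond (frontier D₂) w ∧ gradNorm Ω (fun x => u x - w x)
          ≤ C * ENNReal.ofReal T.meshSize * h2Norm Ω u := by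
  obtain ⟨Λ, hΛ, hmap⟩ := CurvedTriangulation.exists_isElementMap (Nat.succ_pos m)
    hΩ.isConnected.nonempty c₂ hκ hc
  obtain ⟨C, hC⟩ := CurvedTriangulation.exists_eLpNorm_weakPartial_sub_le hm hΩ hΛ
  -- One factor `m + 1` counts the partial derivatives in `gradNorm`; the sum compares the total of
  -- all derivative norms up to order two with `h2Norm`.
  refine ⟨(m + 1 : ℕ) * (C * (1 + (m + 1 : ℕ) + (m + 1 : ℕ) * (m + 1 : ℕ))), fun T hT u hu hud => ?_⟩
  have hh := T.meshSize_pos (Nat.succ_pos m) hΩ.isConnected.nonempty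
  have hTm := hmap T hT
  obtain ⟨C', hC'⟩ := hC T T.meshSize hh hTm
  obtain ⟨S, hS⟩ := CurvedTriangulation.exists_enorm_le hm hΩ.isOpen hh hΛ hTm
  obtain ⟨φ, r, hφ, hr, h0, h1, hcau, hbd⟩ := hu.exists_approx_derivSum hΩ
  have hSr : Tendsto (fun n => S * r n) atTop (𝓝 0) := by
    simpa using ENNReal.Tendsto.const_mul hr (Or.inr ENNReal.coe_ne_top)
  -- `U` is the continuous representative of `u` on the closure; its nodal values define the
  -- interpolant.
  obtain ⟨U, hU⟩ := exists_enorm_sub_le_of_cauchy (s := closure Ω) (f := φ) hSr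
    fun n k x hx => by
      rw [← mul_add]
      exact (hS _ ((hφ n).sub (hφ k)) x hx).trans (by gcongr; exact hcau n k)
  have hUc : ContinuousOn U (closure Ω) := by
    have hunif : TendstoUniformlyOn φ U atTop (closure Ω) := by
      refine EMetric.tendstoUniformlyOn_iff.2 fun ε hε => ?_
      filter_upwards [hSr.eventually_lt_const hε] with n hn x hx
      rw [edist_eq_enorm_sub]
      exact (hU n x hx).trans_lt hn
    exact hunif.continuousOn (Frequently.of_forall fun n => (hφ n).continuous.continuousOn)
  have hUtrace : IsTrace Ω u U := isTrace_of_uniform_approx hΩ hu.1 hφ hr h0 h1 hSr hUc hU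
  have hU0 : ∀ x ∈ frontier D₂, U x = 0 := by
    obtain ⟨-, t, ht, ht0⟩ := hud
    have hsub : frontier D₂ ⊆ frontier Ω := hfr ▸ subset_union_right
    have hle : surfaceMeasure (frontier D₂) ≤ surfaceMeasure (frontier Ω) :=
      Measure.restrict_mono hsub le_rfl
    have h2 := (ht.ae_eq hΩ hu.1 hUtrace).filter_mono (ae_mono hle)
    intro x hx
    exact eq_zero_of_ae_eq_zero hD₂ (hUc.mono (hsub.trans frontier_subset_closure))
      (h2.symm.trans ht0) hx
  obtain ⟨w, hw⟩ := T.exists_interpolant U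
  obtain ⟨K, hK⟩ := CurvedTriangulation.exists_lipschitzOnWith hΩ hh hΛ hTm hw
  obtain ⟨hw1, -⟩ := memH1_of_lipschitzOnWith hΩ.isOpen hΩ.isBounded hK
  refine ⟨w, ⟨CurvedTriangulation.memV_interpolant hK.continuousOn hw, hw1, w,
    isTrace_of_lipschitzOnWith hΩ hK hw1, ?_⟩, ?_⟩
  · filter_upwards [ae_restrict_mem isClosed_frontier.measurableSet] with x hx
    exact CurvedTriangulation.interpolant_eq_zero hΓ isClosed_frontier hdisj hfr hw hU0 hx
  set A : ℝ≥0∞ := (1 + (m + 1 : ℕ) + (m + 1 : ℕ) * (m + 1 : ℕ)) * h2Norm Ω u with hA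
  -- The mesh, and with it `C'` and `S`, stays fixed while `n → ∞`, so only the uniform constant `C`
  -- survives in the limit.
  have hbound : ∀ᶠ n in atTop, gradNorm Ω (fun x => u x - w x) ≤ ∑ _i : Fin (m + 1),
      (r n + (C * ENNReal.ofReal T.meshSize * (A + r n) + C' * (S * r n))) := by
    filter_upwards [hSr.eventually_lt_const ENNReal.zero_lt_top] with n hn
    refine Finset.sum_le_sum fun i _ => ?_
    have mφ : AEStronglyMeasurable (pd i (φ n)) (volume.restrict Ω) :=
      (contDiff_pd (hφ n) i).continuous.aestronglyMeasurable
    have mu := (hu.1.memLp_weakPartial hΩ.isOpen i).1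
    have mw := (hw1.memLp_weakPartial hΩ.isOpen i).1
    rw [eLpNorm_congr_ae (hu.1.weakPartial_sub hΩ.isOpen hw1 i)]
    have e : (fun x => weakPartial Ω i u x - weakPartial Ω i w x)
        = (fun x => weakPartial Ω i u x - pd i (φ n) x)
          + fun x => pd i (φ n) x - weakPartial Ω i w x := by
      ext x; simp
    rw [e]
    refine (eLpNorm_add_le (mu.sub mφ) (mφ.sub mw) (by norm_num)).trans
      (add_le_add (h1 n i) ?_)
    refine (hC' (φ n) w U (S * r n).toNNReal (hφ n) (fun y hy => ?_) hw i).trans ?_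
    · have h3 := hU n y hy
      rw [← ENNReal.coe_toNNReal hn.ne] at h3
      rw [← Real.norm_eq_abs]
      exact_mod_cast h3
    · rw [ENNReal.coe_toNNReal hn.ne]
      gcongr
      exact hbd n
  have hlim : Tendsto (fun n => ∑ _i : Fin (m + 1),
      (r n + (C * ENNReal.ofReal T.meshSize * (A + r n) + C' * (S * r n)))) atTop
      (𝓝 (∑ _i : Fin (m + 1), (0 + (C * ENNReal.ofReal T.meshSize * (A + 0) + C' * 0)))) :=
    tendsto_finsetSum _ fun i _ => hr.add ((ENNReal.Tendsto.const_mul (hr.const_add A)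
      (Or.inr (by finiteness))).add (ENNReal.Tendsto.const_mul hSr (Or.inr (by finiteness))))
  refine (ge_of_tendsto hlim hbound).trans_eq ?_
  simp only [zero_add, add_zero, mul_zero, Finset.sum_const, Finset.card_univ, Fintype.card_fin,
    nsmul_eq_mul, hA]
  push_cast
  ring

/-! ### Quasi-optimality of the Galerkin approximation -/

theorem enorm_integral_mul_le {α : Type*} [MeasurableSpace α] {μ : Measure α} {f g : α → ℝ}
    (hf : AEStronglyMeasurable f μ) (hg : AEStronglyMeasurable g μ) :
    ‖∫ x, f x * g x ∂μ‖ₑ ≤ eLpNorm f 2 μ * eLpNorm g 2 μ := by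
  refine (enorm_integral_le_lintegral_enorm _).trans ?_
  rw [← ENNReal.pow_le_pow_left_iff two_ne_zero, mul_pow, eLpNorm_two_sq, eLpNorm_two_sq]
  simp only [enorm_mul]
  exact sq_lintegral_mul_le hf.enorm hg.enorm

theorem integrable_fun_mul {α : Type*} [MeasurableSpace α] {μ : Measure α} {f g : α → ℝ}
    (hf : MemLp f 2 μ) (hg : MemLp g 2 μ) : Integrable (fun x => f x * g x) μ :=
  hf.integrable_mul hg

theorem sq_sum_le_card_mul {n : ℕ} (a : Fin n → ℝ≥0∞) : (∑ i, a i) ^ 2 ≤ n * ∑ i, a i ^ 2 := by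
  have hr : ∀ x : ℝ≥0∞, (x ^ (1 / 2 : ℝ)) ^ 2 = x := fun x => by
    rw [← ENNReal.rpow_natCast, ← ENNReal.rpow_mul]; norm_num
  have h := ENNReal.inner_le_Lp_mul_Lq Finset.univ (fun _ : Fin n => (1 : ℝ≥0∞)) a
    Real.HolderConjugate.two_two
  refine (pow_le_pow_left₀ zero_le (by simpa only [one_mul] using h) 2).trans_eq ?_
  rw [mul_pow, hr, hr]
  simp

/-- The abstract Céa argument. Here `p`, `q`, `s` are the gradients of `u`, `u_h`, `w`, the `tᵢ` are
the traces of `u`, `u_h`, `w`, and `b₁`, `b₂` are the boundary nonlinearities of `u`, `u_h`. In `(p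
- q)² = (p - q)(p - s) + (p - q)(s - q)` the orthogonality `heq` trades the last term for a boundary
term. -/
theorem sum_eLpNorm_sq_le {d : ℕ} {μ ν : Measure (E d)} {p q s : Fin d → E d → ℝ}
    {b₁ b₂ t₁ t₂ t₃ : E d → ℝ} (hp : ∀ i, MemLp (p i) 2 μ) (hq : ∀ i, MemLp (q i) 2 μ)
    (hs : ∀ i, MemLp (s i) 2 μ) (hb₁ : MemLp b₁ 2 ν) (hb₂ : MemLp b₂ 2 ν) (ht₁ : MemLp t₁ 2 ν)
    (ht₂ : MemLp t₂ 2 ν) (ht₃ : MemLp t₃ 2 ν)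
    (hmono : ∀ᵐ x ∂ν, 0 ≤ (b₁ x - b₂ x) * (t₁ x - t₂ x))
    (heq : (∫ x, ∑ i, p i x * (s i x - q i x) ∂μ) + ∫ x, b₁ x * (t₃ x - t₂ x) ∂ν
      = (∫ x, ∑ i, q i x * (s i x - q i x) ∂μ) + ∫ x, b₂ x * (t₃ x - t₂ x) ∂ν) :
    ∑ i, eLpNorm (fun x => p i x - q i x) 2 μ ^ 2
      ≤ ∑ i, eLpNorm (fun x => p i x - q i x) 2 μ * eLpNorm (fun x => p i x - s i x) 2 μ
        + eLpNorm (fun x => b₁ x - b₂ x) 2 ν * eLpNorm (fun x => t₁ x - t₃ x) 2 ν := by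
  have hpq : ∀ i, MemLp (fun x => p i x - q i x) 2 μ := fun i => (hp i).sub (hq i)
  have hps : ∀ i, MemLp (fun x => p i x - s i x) 2 μ := fun i => (hp i).sub (hs i)
  have hsq : ∀ i, MemLp (fun x => s i x - q i x) 2 μ := fun i => (hs i).sub (hq i)
  have hb : MemLp (fun x => b₁ x - b₂ x) 2 ν := hb₁.sub hb₂
  have ht12 : MemLp (fun x => t₁ x - t₂ x) 2 ν := ht₁.sub ht₂
  have ht13 : MemLp (fun x => t₁ x - t₃ x) 2 ν := ht₁.sub ht₃
  have ht32 : MemLp (fun x => t₃ x - t₂ x) 2 ν := ht₃.sub ht₂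
  have hi : ∀ i, ∫ x, (p i x - q i x) ^ 2 ∂μ = (∫ x, (p i x - q i x) * (p i x - s i x) ∂μ)
      + ((∫ x, p i x * (s i x - q i x) ∂μ) - ∫ x, q i x * (s i x - q i x) ∂μ) := by
    intro i
    have hsub : Integrable (fun x => p i x * (s i x - q i x) - q i x * (s i x - q i x)) μ :=
      (integrable_fun_mul (hp i) (hsq i)).sub (integrable_fun_mul (hq i) (hsq i))
    rw [← integral_sub (integrable_fun_mul (hp i) (hsq i)) (integrable_fun_mul (hq i) (hsq i)),
      ← integral_add (integrable_fun_mul (hpq i) (hps i)) hsub]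
    refine integral_congr_ae (Eventually.of_forall fun x => ?_)
    ring
  -- The integrands add up to `(b₁ - b₂)(t₁ - t₂)`, which is nonnegative by monotonicity.
  have hB : 0 ≤ (∫ x, (b₁ x - b₂ x) * (t₁ x - t₃ x) ∂ν)
      + ((∫ x, b₁ x * (t₃ x - t₂ x) ∂ν) - ∫ x, b₂ x * (t₃ x - t₂ x) ∂ν) := by
    have hsub : Integrable (fun x => b₁ x * (t₃ x - t₂ x) - b₂ x * (t₃ x - t₂ x)) ν :=
      (integrable_fun_mul hb₁ ht32).sub (integrable_fun_mul hb₂ ht32)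
    rw [← integral_sub (integrable_fun_mul hb₁ ht32) (integrable_fun_mul hb₂ ht32),
      ← integral_add (integrable_fun_mul hb ht13) hsub]
    refine integral_nonneg_of_ae ?_
    filter_upwards [hmono] with x hx
    refine hx.trans_eq ?_
    ring
  rw [integral_finsetSum _ fun i _ => integrable_fun_mul (hp i) (hsq i),
    integral_finsetSum _ fun i _ => integrable_fun_mul (hq i) (hsq i)] at heq
  have hreal : ∑ i, ∫ x, (p i x - q i x) ^ 2 ∂μ
      ≤ (∑ i, ∫ x, (p i x - q i x) * (p i x - s i x) ∂μ)
        + ∫ x, (b₁ x - b₂ x) * (t₁ x - t₃ x) ∂ν := by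
    rw [Finset.sum_congr rfl fun i _ => hi i, Finset.sum_add_distrib, Finset.sum_sub_distrib]
    linarith
  have hlhs : ∑ i, eLpNorm (fun x => p i x - q i x) 2 μ ^ 2
      = ENNReal.ofReal (∑ i, ∫ x, (p i x - q i x) ^ 2 ∂μ) := by
    rw [ENNReal.ofReal_sum_of_nonneg fun i _ => integral_nonneg fun x => sq_nonneg _]
    refine Finset.sum_congr rfl fun i _ => ?_
    rw [eLpNorm_two_sq, ofReal_integral_eq_lintegral_ofReal (hpq i).integrable_sq
      (Eventually.of_forall fun x => sq_nonneg _)]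
    refine lintegral_congr fun x => ?_
    rw [Real.enorm_eq_ofReal_abs, ← ENNReal.ofReal_pow (abs_nonneg _), sq_abs]
  rw [hlhs]
  refine (ENNReal.ofReal_le_ofReal hreal).trans ((Real.ofReal_le_enorm _).trans ?_)
  refine (enorm_add_le _ _).trans (add_le_add ((enorm_sum_le _ _).trans
    (Finset.sum_le_sum fun i _ => ?_)) ?_)
  · exact enorm_integral_mul_le (hpq i).1 (hps i).1
  · exact enorm_integral_mul_le hb.1 ht13.1

/-- On `H¹_⋄` the gradient controls the function by Poincaré, and then its trace. The boundary term
of the Céa estimate is thus bounded by the same product of gradient norms as the interior term. -/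
theorem exists_h1Norm_sub_le_gradNorm_sub {m : ℕ} {Ω Γ Γ₀ : Set (E (m + 1))} (hΩ : IsC3Domain Ω)
    (hΓ : Γ ⊆ frontier Ω) {p : E (m + 1)} (hp : p ∈ frontier Ω) {r : ℝ} (hr : 0 < r)
    (hΓ₀ : frontier Ω ∩ Metric.ball p r ⊆ Γ₀) (A L : ℝ≥0) :
    ∃ C : ℝ≥0, ∀ β : ℝ → ℝ, LipschitzWith L β → Monotone β → β 0 = 0 →
      ∀ a : E (m + 1) → ℝ, AEStronglyMeasurable a (surfaceMeasure Γ) →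
      (∀ᵐ x ∂(surfaceMeasure Γ), 0 ≤ a x) → (∀ᵐ x ∂(surfaceMeasure Γ), a x ≤ A) →
      ∀ u uh w, MemH1Diamond Ω Γ₀ u → MemH1Diamond Ω Γ₀ uh → MemH1Diamond Ω Γ₀ w →
        formB Ω Γ a β u (fun x => w x - uh x) = formB Ω Γ a β uh (fun x => w x - uh x) →
        h1Norm Ω (fun x => u x - uh x) ≤ C * gradNorm Ω (fun x => u x - w x) := by
  obtain ⟨CP, hCP⟩ := exists_poincare_memH1Diamond hΩ hp hr hΓ₀
  obtain ⟨CT, hCT⟩ := exists_trace_inequality_eLpNorm hΩ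
  -- `CP + 1` passes from the gradient to the full norm, `m + 1` from a squared sum to a sum of
  -- squares; `A L` bounds the increment of `a β`, and each of the two traces contributes `CT (CP +
  -- 1)`.
  refine ⟨(CP + 1) * ((m + 1 : ℕ) * (1 + A * L * (CT * (CP + 1)) ^ 2)),
    fun β hβ hmono hβ0 a ham ha0 haA u uh w hu huh hw heq => ?_⟩
  have hO := hΩ.isOpen
  have hb := hΩ.isBounded
  have hle : surfaceMeasure Γ ≤ surfaceMeasure (frontier Ω) := Measure.restrict_mono hΓ le_rfl
  have hv := hw.sub hO hb huh
  have he := hu.sub hO hb huh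
  have hη := hu.sub hO hb hw
  have htr : ∀ {z}, MemH1Diamond Ω Γ₀ z → MemLp (trace Ω z) 2 (surfaceMeasure Γ) := fun hz =>
    hz.isTrace_trace.1.mono_measure hle
  have hwp : ∀ {z}, MemH1Diamond Ω Γ₀ z → ∀ i, MemLp (weakPartial Ω i z) 2 (volume.restrict Ω) :=
    fun hz i => hz.1.memLp_weakPartial hO i
  have htrace : ∀ {z}, MemH1Diamond Ω Γ₀ z →
      eLpNorm (trace Ω z) 2 (surfaceMeasure Γ) ≤ (CT * (CP + 1) : ℝ≥0) * gradNorm Ω z := by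
    intro z hz
    refine (eLpNorm_mono_measure _ hle).trans
      ((hz.isTrace_trace.eLpNorm_le hΩ hCT hz.1).trans ?_)
    push_cast
    rw [mul_assoc]
    gcongr
    rw [add_mul, one_mul]
    gcongr
    exact hCP z hz
  have hβn : ∀ s t, ‖β s - β t‖ ≤ L * ‖s - t‖ := fun s t => by
    simpa [dist_eq_norm] using hβ.dist_le_mul s t
  have haβ : ∀ᵐ x ∂(surfaceMeasure Γ), ‖a x‖ ≤ A := by
    filter_upwards [ha0, haA] with x h1 h2
    rwa [Real.norm_of_nonneg h1]
  have hB : ∀ {z}, MemH1Diamond Ω Γ₀ z →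
      MemLp (fun x => a x * β (trace Ω z x)) 2 (surfaceMeasure Γ) := by
    intro z hz
    refine MemLp.of_le_mul (c := A * L) (htr hz)
      (ham.mul (hβ.continuous.comp_aestronglyMeasurable (htr hz).1)) ?_
    filter_upwards [haβ] with x hx
    rw [norm_mul, mul_assoc]
    have h1 := hβn (trace Ω z x) 0
    rw [hβ0, sub_zero, sub_zero] at h1
    gcongr
  have hform : ∀ {z}, MemH1Diamond Ω Γ₀ z → formB Ω Γ a β z (fun x => w x - uh x)
      = (∫ x in Ω, ∑ i, weakPartial Ω i z x * (weakPartial Ω i w x - weakPartial Ω i uh x))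
        + ∫ x, (a x * β (trace Ω z x)) * (trace Ω w x - trace Ω uh x) ∂(surfaceMeasure Γ) := by
    intro z _
    rw [formB]
    congr 1
    · refine integral_congr_ae ?_
      filter_upwards [ae_all_iff.2 fun i => hw.1.weakPartial_sub hO huh.1 i] with x hx
      exact Finset.sum_congr rfl fun i _ => by rw [hx i]
    · refine integral_congr_ae ?_
      filter_upwards [(hw.trace_sub hΩ huh).filter_mono (ae_mono hle)] with x hx
      rw [hx]
  rw [hform hu, hform huh] at heq
  have hte := (hu.trace_sub hΩ huh).filter_mono (ae_mono hle)
  have hmain := sum_eLpNorm_sq_le (hwp hu) (hwp huh) (hwp hw) (hB hu) (hB huh) (htr hu) (htr huh)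
    (htr hw) (by
      filter_upwards [ha0] with x hx
      rw [← mul_sub, mul_assoc]
      refine mul_nonneg hx ?_
      rcases le_total (trace Ω u x) (trace Ω uh x) with h | h
      · exact mul_nonneg_of_nonpos_of_nonpos (sub_nonpos.2 (hmono h)) (sub_nonpos.2 h)
      · exact mul_nonneg (sub_nonneg.2 (hmono h)) (sub_nonneg.2 h)) heq
  have hΔ : eLpNorm (fun x => a x * β (trace Ω u x) - a x * β (trace Ω uh x)) 2
      (surfaceMeasure Γ) ≤ (A * L : ℝ≥0) *
        eLpNorm (trace Ω fun x => u x - uh x) 2 (surfaceMeasure Γ) := by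
    refine eLpNorm_le_nnreal_smul_eLpNorm_of_ae_le_mul ?_ 2
    filter_upwards [haβ, hte] with x hx hx2
    rw [← mul_sub, hx2]
    have h1 := hβn (trace Ω u x) (trace Ω uh x)
    rw [← NNReal.coe_le_coe]
    push_cast
    rw [norm_mul, mul_assoc]
    gcongr
  have hηt : eLpNorm (fun x => trace Ω u x - trace Ω w x) 2 (surfaceMeasure Γ)
      = eLpNorm (trace Ω fun x => u x - w x) 2 (surfaceMeasure Γ) :=
    eLpNorm_congr_ae ((hu.trace_sub hΩ hw).filter_mono (ae_mono hle)).symm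
  have hge : gradNorm Ω (fun x => u x - uh x)
      = ∑ i, eLpNorm (fun x => weakPartial Ω i u x - weakPartial Ω i uh x) 2 (volume.restrict Ω) :=
    Finset.sum_congr rfl fun i _ => eLpNorm_congr_ae (hu.1.weakPartial_sub hO huh.1 i)
  have hgη : gradNorm Ω (fun x => u x - w x)
      = ∑ i, eLpNorm (fun x => weakPartial Ω i u x - weakPartial Ω i w x) 2 (volume.restrict Ω) :=
    Finset.sum_congr rfl fun i _ => eLpNorm_congr_ae (hu.1.weakPartial_sub hO hw.1 i)
  set G := gradNorm Ω (fun x => u x - uh x) with hG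
  set H := gradNorm Ω (fun x => u x - w x) with hH
  have hGtop : G ≠ ⊤ := ENNReal.sum_ne_top.2 fun i _ => (hwp he i).2.ne
  have hsum : ∑ i, eLpNorm (fun x => weakPartial Ω i u x - weakPartial Ω i uh x) 2
      (volume.restrict Ω) * eLpNorm (fun x => weakPartial Ω i u x - weakPartial Ω i w x) 2
      (volume.restrict Ω) ≤ G * H := by
    rw [hge, Finset.sum_mul]
    refine Finset.sum_le_sum fun i _ => ?_
    gcongr
    rw [hgη]
    exact Finset.single_le_sum (f := fun i => eLpNorm (fun x => weakPartial Ω i u x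
      - weakPartial Ω i w x) 2 (volume.restrict Ω)) (fun _ _ => zero_le) (Finset.mem_univ i)
  have hsq : G ^ 2 ≤ (m + 1 : ℕ) * ∑ i, eLpNorm (fun x => weakPartial Ω i u x
      - weakPartial Ω i uh x) 2 (volume.restrict Ω) ^ 2 := by
    rw [hge]
    exact sq_sum_le_card_mul _
  have hfinal : G ^ 2 ≤ ((m + 1 : ℕ) * (1 + A * L * (CT * (CP + 1)) ^ 2) : ℝ≥0) * H * G := by
    refine hsq.trans ((mul_le_mul_right (hmain.trans (add_le_add hsum (mul_le_mul'
      (hΔ.trans (mul_le_mul_right (htrace he) _)) (hηt.trans_le (htrace hη))))) _).trans_eq ?_)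
    push_cast
    ring
  -- One factor `G` is cancelled, which requires it to be nonzero and finite.
  have hGH : G ≤ ((m + 1 : ℕ) * (1 + A * L * (CT * (CP + 1)) ^ 2) : ℝ≥0) * H := by
    rcases eq_or_ne G 0 with h0 | h0
    · rw [h0]; exact zero_le
    · rw [pow_two] at hfinal
      exact (ENNReal.mul_le_mul_iff_left h0 hGtop).1 hfinal
  calc h1Norm Ω (fun x => u x - uh x)
      ≤ eLpNorm (fun x => u x - uh x) 2 (volume.restrict Ω) + G := h1Norm_le he.1
    _ ≤ CP * G + G := by gcongr; exact hCP _ he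
    _ = (CP + 1) * G := by ring
    _ ≤ (CP + 1) * (((m + 1 : ℕ) * (1 + A * L * (CT * (CP + 1)) ^ 2) : ℝ≥0) * H) := by gcongr
    _ = _ := by push_cast; ring

theorem CurvedTriangulation.MemVDiamond.sub {d : ℕ} {Ω Γ₀ : Set (E d)}
    {T : CurvedTriangulation Ω} (hΩ : IsOpen Ω) (hb : Bornology.IsBounded Ω) {v w : E d → ℝ}
    (hv : T.MemVDiamond Γ₀ v) (hw : T.MemVDiamond Γ₀ w) :
    T.MemVDiamond Γ₀ fun x => v x - w x := by
  refine ⟨⟨hv.1.1.sub hw.1.1, fun i => ?_⟩, hv.2.sub hΩ hb hw.2⟩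
  obtain ⟨A, hA⟩ := hv.1.2 i
  obtain ⟨B, hB⟩ := hw.1.2 i
  exact ⟨A - B, fun x hx => by simp [hA x hx, hB x hx]⟩

end RobinFE

end

/-! ### The error estimate -/

open RobinFE in
theorem lemma3p1 (d : ℕ) (hd : d = 2 ∨ d = 3)
    (Ω₁ Ω₂ : Set (E d)) (hΩ₁ : IsC3Domain Ω₁) (hΩ₂ : IsC3Domain Ω₂) (hΩ₁₂ : closure Ω₁ ⊆ Ω₂)
    (Ω : Set (E d)) (hΩ : Ω = Ω₂ \ closure Ω₁) (hΩc : IsConnected Ω)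
    (M L κ c c₂ : ℝ) (hκ : 0 < κ) (hc : c < 1) :
    ∃ C : ℝ≥0,
      ∀ β : ℝ → ℝ, ContDiff ℝ 3 β → Monotone β → β 0 = 0 →
        (∀ k ∈ Finset.Icc 1 3, ∃ R : ℝ, ∀ x, |iteratedDeriv k β x| ≤ R) →
        (∀ x, |deriv β x| ≤ L) →
      ∀ a : E d → ℝ, AEStronglyMeasurable a (surfaceMeasure (frontier Ω₁)) →
        (∃ a₀ : ℝ, 0 < a₀ ∧ ∀ᵐ x ∂(surfaceMeasure (frontier Ω₁)), a₀ ≤ a x) →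
        (∀ᵐ x ∂(surfaceMeasure (frontier Ω₁)), a x ≤ M) →
      ∀ f g : E d → ℝ, MemLp f 2 (volume.restrict Ω) →
        MemLp g 2 (surfaceMeasure (frontier Ω₁)) →
      ∀ T : CurvedTriangulation Ω, T.IsQuasiUniform κ c c₂ →
      ∀ u uh : E d → ℝ, IsWeakSolution Ω (frontier Ω₁) (frontier Ω₂) a β f g u →
        T.IsGalerkinSolution (frontier Ω₁) (frontier Ω₂) a β f g uh →
        h1Norm Ω (fun x => u x - uh x) ≤ C * ENNReal.ofReal T.meshSize * h2Norm Ω u := by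
  obtain ⟨m, rfl⟩ : ∃ m, d = m + 1 := ⟨d - 1, by omega⟩
  have hm : m + 1 ≤ 3 := by omega
  subst hΩ
  have hD := isC3Domain_diff hΩ₁ hΩ₂ hΩ₁₂ hΩc
  have hdisj : Disjoint (frontier Ω₁) (frontier Ω₂) :=
    Set.disjoint_left.2 fun x h1 h2 => by
      rw [hΩ₂.isOpen.frontier_eq] at h2
      exact h2.2 (hΩ₁₂ (frontier_subset_closure h1))
  have hfr₁ := frontier_left_subset_frontier_diff hΩ₁ hΩ₂.isOpen hΩ₁₂
  have hfr₂ := frontier_right_subset_frontier_diff hΩ₂.isOpen hΩ₁₂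
  have hfr : frontier (Ω₂ \ closure Ω₁) = frontier Ω₁ ∪ frontier Ω₂ :=
    (frontier_diff_subset hΩ₁.isOpen hΩ₂.isOpen).antisymm (union_subset hfr₁ hfr₂)
  obtain ⟨p, hp⟩ : (frontier Ω₂).Nonempty :=
    nonempty_frontier_iff.2 ⟨hΩ₂.isConnected.nonempty, fun h =>
      NormedSpace.unbounded_univ ℝ (E (m + 1)) (h ▸ hΩ₂.isBounded)⟩
  -- Near `p` the boundary of the annulus belongs to `Γ₀` alone, so the trace vanishes on a whole
  -- piece, as the Poincaré inequality demands.
  obtain ⟨r, hr, hball⟩ := Metric.mem_nhds_iff.1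
    (isClosed_frontier.isOpen_compl.mem_nhds (Set.disjoint_right.1 hdisj hp))
  have hΓ₀ : frontier (Ω₂ \ closure Ω₁) ∩ Metric.ball p r ⊆ frontier Ω₂ := by
    rintro x ⟨hx, hxb⟩
    rw [hfr] at hx
    exact hx.resolve_left (hball hxb)
  obtain ⟨C₁, hC₁⟩ := exists_h1Norm_sub_le_gradNorm_sub hD hfr₁ (hfr₂ hp) hr hΓ₀
    M.toNNReal L.toNNReal
  obtain ⟨C₂, hC₂⟩ := exists_memVDiamond_gradNorm_sub_le hm hD hΩ₂ isClosed_frontier hdisj hfr c₂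
    hκ hc
  -- The summand `1` keeps the constant positive, so that the right-hand side is `∞` when `u` is not
  -- in `H²`.
  refine ⟨C₁ * C₂ + 1, fun β hβ hmono hβ0 _ hL a ham ⟨a₀, ha₀, haa⟩ haM f g _ _ T hT u uh hu huh =>
    ?_⟩
  by_cases hu2 : MemH2 (Ω₂ \ closure Ω₁) u
  · obtain ⟨w, hw, hwle⟩ := hC₂ T hT u hu2 hu.1
    have hlip : LipschitzWith L.toNNReal β :=
      lipschitzWith_of_nnnorm_deriv_le (hβ.differentiable (by norm_num)) fun x => by
        rw [← NNReal.coe_le_coe, coe_nnnorm, Real.norm_eq_abs]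
        exact (hL x).trans (Real.le_coe_toNNReal L)
    have hwuh : T.MemVDiamond (frontier Ω₂) fun x => w x - uh x :=
      CurvedTriangulation.MemVDiamond.sub hD.isOpen hD.isBounded hw huh.1
    -- Galerkin orthogonality: `w - u_h` is a test function for both problems and the right-hand
    -- sides agree.
    have heq := (hu.2 _ hwuh.2).trans (huh.2 _ hwuh).symm
    have h := hC₁ β hlip hmono hβ0 a ham (haa.mono fun x hx => ha₀.le.trans hx)
      (haM.mono fun x hx => hx.trans (Real.le_coe_toNNReal M)) u uh w hu.1 huh.1.2 hw.2 heq
    calc _ ≤ (C₁ : ℝ≥0∞) * gradNorm (Ω₂ \ closure Ω₁) (fun x => u x - w x) := h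
      _ ≤ C₁ * (C₂ * ENNReal.ofReal T.meshSize * h2Norm (Ω₂ \ closure Ω₁) u) := by gcongr
      _ = ((C₁ * C₂ : ℝ≥0) : ℝ≥0∞) * ENNReal.ofReal T.meshSize * h2Norm (Ω₂ \ closure Ω₁) u := by
          push_cast; ring
      _ ≤ _ := by
          gcongr
          exact le_self_add
  · have hh := T.meshSize_pos (Nat.succ_pos m) hΩc.nonempty
    rw [h2Norm, if_neg hu2, ENNReal.mul_top]
    · exact le_top
    · exact mul_ne_zero (by simp) (by simpa using hh)
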